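/- Let $Q$ be a connected open subset of a finite-dimensional real vector space $E$, with a smooth one-form $\vartheta$, a smooth Hamiltonian $H:Q\to\mathbb{R}$, and a smooth almost complex structure $\mathbb{J}$ on $Q$ compatible with $\omega=-\mathbf{d}\vartheta$, i.e. $\omega(\mathbb{J}u,\mathbb{J}w)=\omega(u,w)$ and $g(u,w):=\omega(u,\mathbb{J}w)$ is positive definite (so $\omega$ is symplectic and $g$ is a Riemannian metric; write $|u|_q^2=g_q(u,u)$). Let $X_H$ be the Hamiltonian vector field, $\omega(X_H,\cdot)=\mathbf{d}H$, and identify $TQ=Q\times E$. Fix $\theta_0\in\mathbb{R}$ with $\theta_0/2\pi\notin\mathbb{Q}$. For $\hbar\in\mathbb{R}$ and $q,\overline q\in Q$ such that the segment from $q$ to $\overline q$ lies in $Q$, put $$S_\hbar(q,\overline q)=\int_0^1\vartheta_{q+t(\overline q-q)}(\overline q-q)\,dt+\Sigma_\hbar\big(\tfrac{q+\overline q}{2},\overline q-q\big),$$ $$\Sigma_\hbar(x,\xi)=-\hbar H(x)+\hbar^2 g_x(X_H,\xi)-\tfrac1{12}\hbar^2\,\partial_k\omega_{j\ell}(x)X_H^kX_H^j\xi^\ell-\tfrac14\,\frac{\sin\theta_0}{1-\cos\theta_0}\,g_x(\xi-\hbar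 X_H,\xi-\hbar X_H),$$ with $X_H$ evaluated at $x$ and components taken in linear coordinates on $E$. A symplectic Lorentz map is a map $(q,v)\mapsto\Psi_\hbar(q,v)=(\overline q,\overline v)\in TQ$, defined and smooth in $(q,v,\hbar)$ on an open neighborhood of $TQ\times\{0\}$ in $TQ\times\mathbb{R}$, which satisfies there (with the segment from $q$ to $\overline q$ contained in $Q$) $$\partial_{\overline q}S_\hbar(q,\overline q)=\vartheta_{\overline q}+\hbar^2 g_{\overline q}(\overline v,\cdot),\qquad -\partial_{q}S_\hbar(q,\overline q)=\vartheta_{q}+\hbar^2 g_{q}(v,\cdot),$$ and for which $\overline q=q$ when $\hbar=0$. Let $\mu_4(q,v)=\tfrac12|v-X_H(q)|_q^2$. A symplectic Lorentz map exists. Moreover, let $\Psi$ be any symplectic Lorentz map. For each $N>0$ and each compact set $C\subset TQ$ there is a constant $\mathcal{M}>0$, independent of $\hbar$ and of the point $(q,v)$, such that for every $\hbar>0$ and every $(q,v)$ with $\Psi_\hbar^k(q,v)\in C$ for all integers $k\ge0$, $$|\mu_4(\Psi_\hbar^k(q,v))-\mu_4(q,v)|\le\mathcal{M}\,\hbar\qquad\text{for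 all integers } 0\le k\le\lfloor\hbar^{-N}\rfloor .$$ -/

import Mathlib

open scoped ContDiff

noncomputable section

/-- For a one-form `ϑ` on (an open subset of) a vector space, the two-form `ω = -dϑ`, that is
`ω_q(u, w) = -(Dϑ(q)[u](w) - Dϑ(q)[w](u))`. -/
def negExtDeriv {E : Type*} [NormedAddCommGroup E] [NormedSpace ℝ E]
    (ϑ : E → E →L[ℝ] ℝ) (q : E) : E →L[ℝ] E →L[ℝ] ℝ :=
  (fderiv ℝ ϑ q).flip - fderiv ℝ ϑ q

/-- A Hamiltonian system on a connected open subset `Q` of a finite-dimensional real vector space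
`E`, with exact symplectic form `ω = -dϑ`, Hamiltonian `H`, and an almost complex structure `J`
on `Q` compatible with `ω`. (Non-degeneracy of `ω` follows from `taming`.) -/
structure ExactHamiltonianSystem (E : Type*) [NormedAddCommGroup E] [NormedSpace ℝ E]
    [FiniteDimensional ℝ E] where
  Q : Set E
  isOpen_Q : IsOpen Q
  isConnected_Q : IsConnected Q
  ϑ : E → E →L[ℝ] ℝ
  smooth_ϑ : ContDiffOn ℝ ∞ ϑ Q
  H : E → ℝ
  smooth_H : ContDiffOn ℝ ∞ H Q
  J : E → E →L[ℝ] E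
  smooth_J : ContDiffOn ℝ ∞ J Q
  J_sq : ∀ q ∈ Q, ∀ u : E, J q (J q u) = -u
  compatible : ∀ q ∈ Q, ∀ u w : E,
    negExtDeriv ϑ q (J q u) (J q w) = negExtDeriv ϑ q u w
  taming : ∀ q ∈ Q, ∀ u : E, u ≠ 0 → 0 < negExtDeriv ϑ q u (J q u)

namespace ExactHamiltonianSystem

variable {E : Type*} [NormedAddCommGroup E] [NormedSpace ℝ E] [FiniteDimensional ℝ E]

/-- The symplectic form `ω = -dϑ`. -/
def omega (D : ExactHamiltonianSystem E) (q : E) : E →L[ℝ] E →L[ℝ] ℝ :=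
  negExtDeriv D.ϑ q

/-- The metric `g_q(u, w) = ω_q(u, J_q w)`. -/
def g (D : ExactHamiltonianSystem E) (q : E) : E →L[ℝ] E →L[ℝ] ℝ :=
  (D.omega q).bilinearComp (ContinuousLinearMap.id ℝ E) (D.J q)

/-- The Hamiltonian vector field: the solution `X_H` of `ω(X_H, ·) = dH`
(see `omega_XH` below). -/
def XH (D : ExactHamiltonianSystem E) (q : E) : E :=
  (D.omega q).inverse (fderiv ℝ D.H q)

/-- The tangent bundle `TQ = Q × E`, as a set of pairs `(q, v)`. -/
def TQ (D : ExactHamiltonianSystem E) : Set (E × E) :=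
  D.Q ×ˢ Set.univ

/-- The line integral of `ϑ` along the straight segment from `q` to `q'`. -/
def lineIntegral (D : ExactHamiltonianSystem E) (q q' : E) : ℝ :=
  ∫ t in (0 : ℝ)..1, D.ϑ (q + t • (q' - q)) (q' - q)

/-- The function `Σ(x, ξ)` on `TQ`. The third summand is
`-(1/12) ħ² ∂_k ω_{jl}(x) X_H^k(x) X_H^j(x) ξ^l`. -/
def Sigma (D : ExactHamiltonianSystem E) (θ₀ ħ : ℝ) (x ξ : E) : ℝ :=
  -ħ * D.H x + ħ ^ 2 * D.g x (D.XH x) ξ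
    - (1 / 12) * ħ ^ 2 * fderiv ℝ D.omega x (D.XH x) (D.XH x) ξ
    - (1 / 4) * (Real.sin θ₀ / (1 - Real.cos θ₀))
        * D.g x (ξ - ħ • D.XH x) (ξ - ħ • D.XH x)

/-- The generating function `S(q, q')`. -/
def S (D : ExactHamiltonianSystem E) (θ₀ ħ : ℝ) (q q' : E) : ℝ :=
  D.lineIntegral q q' + D.Sigma θ₀ ħ ((1 / 2 : ℝ) • q + (1 / 2 : ℝ) • q') (q' - q)

/-- The implicit relations between `z = (q, v)` and `z' = (q', v')`:
`∂S/∂q' = ϑ_{q'} + ħ² g_{q'}(v', ·)` and `-∂S/∂q = ϑ_q + ħ² g_q(v, ·)` at `(q, q')`,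
where the segment from `q` to `q'` lies in `Q`, so that `S` is defined (and smooth)
near `(q, q')`. -/
def LorentzRelation (D : ExactHamiltonianSystem E) (θ₀ ħ : ℝ) (z z' : E × E) : Prop :=
  segment ℝ z.1 z'.1 ⊆ D.Q ∧
  HasFDerivAt (fun p => D.S θ₀ ħ z.1 p) (D.ϑ z'.1 + ħ ^ 2 • D.g z'.1 z'.2) z'.1 ∧
  HasFDerivAt (fun p => D.S θ₀ ħ p z'.1) (-(D.ϑ z.1 + ħ ^ 2 • D.g z.1 z.2)) z.1

/-- `Ψ` is (a representative of) the symplectic Lorentz map: on some open neighbourhood `U` of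
`{ħ = 0}` in `ℝ × TQ`, `(ħ, z) ↦ Ψ ħ z` is smooth, solves the implicit relations, and lies on the
branch of solutions with `q' = q` at `ħ = 0`. Outside `U` the values of `Ψ` are irrelevant. -/
def IsSymplecticLorentzMap (D : ExactHamiltonianSystem E) (θ₀ : ℝ)
    (Ψ : ℝ → E × E → E × E) : Prop :=
  ∃ U : Set (ℝ × (E × E)),
    IsOpen U ∧ (∀ p ∈ U, p.2 ∈ D.TQ) ∧ (∀ z ∈ D.TQ, ((0 : ℝ), z) ∈ U) ∧
    ContDiffOn ℝ ∞ (fun p : ℝ × (E × E) => Ψ p.1 p.2) U ∧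
    (∀ p ∈ U, D.LorentzRelation θ₀ p.1 p.2 (Ψ p.1 p.2)) ∧
    (∀ z ∈ D.TQ, (Ψ 0 z).1 = z.1)

/-- The leading adiabatic invariant `μ₄(q, v) = ½ |v - X_H(q)|²_q`. -/
def mu4 (D : ExactHamiltonianSystem E) (z : E × E) : ℝ :=
  (1 / 2) * D.g z.1 (z.2 - D.XH z.1) (z.2 - D.XH z.1)

theorem omega_apply (D : ExactHamiltonianSystem E) (q u w : E) :
    D.omega q u w = -(fderiv ℝ D.ϑ q u w - fderiv ℝ D.ϑ q w u) := by
  simp [omega, negExtDeriv]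

theorem g_apply (D : ExactHamiltonianSystem E) (q u w : E) :
    D.g q u w = D.omega q u (D.J q w) := by
  simp [g]

theorem isInvertible_omega (D : ExactHamiltonianSystem E) {q : E} (hq : q ∈ D.Q) :
    (D.omega q).IsInvertible := by
  have hinj : Function.Injective (D.omega q : E →ₗ[ℝ] (E →L[ℝ] ℝ)) := by
    rw [← LinearMap.ker_eq_bot, LinearMap.ker_eq_bot']
    intro u hu
    by_contra hne
    have h1 := D.taming q hq u hne
    have h2 : D.omega q u (D.J q u) = 0 := by
      have h3 : D.omega q u = 0 := hu
      rw [h3]; rfl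
    have h4 : 0 < D.omega q u (D.J q u) := h1
    linarith
  have hdim : Module.finrank ℝ E = Module.finrank ℝ (E →L[ℝ] ℝ) := by
    rw [← (LinearMap.toContinuousLinearMap : (E →ₗ[ℝ] ℝ) ≃ₗ[ℝ] (E →L[ℝ] ℝ)).finrank_eq]
    exact (Subspace.dual_finrank_eq).symm
  refine ⟨(LinearEquiv.ofInjectiveOfFinrankEq _ hinj hdim).toContinuousLinearEquiv, ?_⟩
  ext u w
  rfl

/-- Hamilton's equation `ω(X_H, ·) = dH` on `Q`. -/
theorem omega_XH (D : ExactHamiltonianSystem E) {q : E} (hq : q ∈ D.Q) :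
    D.omega q (D.XH q) = fderiv ℝ D.H q := by
  obtain ⟨e, he⟩ := D.isInvertible_omega hq
  simp only [XH, ← he, ContinuousLinearMap.inverse_equiv]
  simp

end ExactHamiltonianSystem

/-- `z` is positively-contained in `C` for the map `F`: its forward orbit stays in `C`. -/
def PositivelyContained {M : Type*} (F : M → M) (C : Set M) (z : M) : Prop :=
  ∀ k : ℕ, F^[k] z ∈ C

end

open Filter Topology Set Asymptotics
open scoped Interval

/-! ### Smoothness of integrals depending on a parameter -/

/-! Put $b=\hbar(v-X_H)$ and $h=\hbar$. In the variables $(q,b,h)$ the implicit relations can be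
divided by $\hbar$, and near the zero section $b=0$, $h=0$ they define a smooth map $F$ that
preserves $h$ and fixes the zero section pointwise. To leading order $F$ rotates $b$ by the angle
$-\theta_0$ in the complex structure $\mathbb J_q$ (`van_endB`); its base component is known up to
third order (`van_endPt`). All expansions are counted in powers of the ideal of functions vanishing
on the zero section (`Van`): $b$ and $h$ have order one, so order $n$ means $O(\hbar^n)$ locally
uniformly in $(q,v)$.

Irrationality of $\theta_0/2\pi$ excludes resonances, so the homological equation of the rotation is
solvable up to an equivariant remainder (`exists_homological_solution`). Hence a near-identity map
$T$ conjugates $F$, to any finite order, to a map $G$ commuting with the circle action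
$b\mapsto(\cos\theta+\sin\theta\,\mathbb J_q)b$ (`exists_normalForm`). Since $F$ comes from a
generating function, on slices of constant $h$ it preserves the one-form
$\Theta=\vartheta+h\,g(b+hX_H,\cdot)$ up to an exact form (`actionForm_sub`). As in Noether's
theorem, the mean of $\Theta$ along the $T$-images of the circle orbits is then invariant under $G$
to that order (`van_actionDensity_comp_sub`), and its leading term is
$\tfrac12h^2g(b,b)=\hbar^4\mu_4$ (`van_actionDensity_sub`). Composed with an approximate inverse of
$T$, it becomes a function $I$ with $I\circ F-I=O(\hbar^n)$ and $I=\hbar^4\mu_4+O(\hbar^5)$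
(`exists_adiabatic_invariant`).

Means over the circle are not integrals here: they are polynomials in the shift by the angle
$\alpha=-\theta_0$, chosen to kill the frequencies $1,\dots,n$. Such a finite sum is the true mean
on trigonometric polynomials of degree at most $n$, which covers Taylor expansions to the required
order.

Every symplectic Lorentz map coincides with $F$ in the rescaled variables near $\hbar=0$,
$\hbar\ne0$ (`IsReducedInverse.eventually_mapOf_rescale`), and compactness of $C$ makes the
estimates uniform. With $n=\lceil N\rceil+5$ the drift of $I$ over $\hbar^{-N}$ steps is
$O(\hbar^5)$; division by $\hbar^4$ gives the bound for small $\hbar$, and boundedness of $\mu_4$ on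
$C$ gives it for the others. Existence of a map comes from the same $F$, after recovering $v$ by
division by $\hbar$. -/

theorem eventually_forall_Icc_contDiffAt {X V : Type*} [NormedAddCommGroup X] [NormedSpace ℝ X]
    [NormedAddCommGroup V] [NormedSpace ℝ V] {f : X × ℝ → V} {x₀ : X} {n : ℕ}
    (hf : ∀ t ∈ Icc (0 : ℝ) 1, ContDiffAt ℝ n f (x₀, t)) :
    ∀ᶠ x in 𝓝 x₀, ∀ t ∈ Icc (0 : ℝ) 1, ContDiffAt ℝ n f (x, t) := by
  have := isCompact_Icc.eventually_forall_of_forall_eventually (x₀ := x₀)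
    (K := Icc (0 : ℝ) 1) (P := fun x t => ContDiffAt ℝ n f (x, t))
  exact this fun t ht => (hf t ht).eventually (by simp)

theorem hasFDerivAt_integral_param_aux {X V : Type*} [NormedAddCommGroup X] [NormedSpace ℝ X]
    [NormedAddCommGroup V] [NormedSpace ℝ V] {f : X × ℝ → V} {x₀ : X}
    (hf : ∀ t ∈ Icc (0 : ℝ) 1, ContDiffAt ℝ 1 f (x₀, t)) :
    HasFDerivAt (fun x => ∫ t in (0 : ℝ)..1, f (x, t))
      (∫ t in (0 : ℝ)..1, (fderiv ℝ f (x₀, t)).comp (ContinuousLinearMap.inl ℝ X ℝ)) x₀ := by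
  have hev : ∀ᶠ x in 𝓝 x₀, ∀ t ∈ Icc (0 : ℝ) 1, ContDiffAt ℝ 1 f (x, t) :=
    eventually_forall_Icc_contDiffAt (n := 1) (by simpa using hf)
  set f' : X → ℝ → X →L[ℝ] V :=
    fun x t => (fderiv ℝ f (x, t)).comp (ContinuousLinearMap.inl ℝ X ℝ) with hf'
  have hcont : ∀ x t, ContDiffAt ℝ 1 f (x, t) →
      ContinuousAt (fun p : X × ℝ => f' p.1 p.2) (x, t) := by
    intro x t h
    have h1 : ContinuousAt (fderiv ℝ f) (x, t) := (h.fderiv_right (m := 0) (by simp)).continuousAt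
    exact h1.clm_comp continuousAt_const
  have hcx : ∀ x, (∀ t ∈ Icc (0 : ℝ) 1, ContDiffAt ℝ 1 f (x, t)) →
      ContinuousOn (fun t => f (x, t)) (uIcc 0 1) := by
    intro x h t ht
    rw [uIcc_of_le zero_le_one] at ht
    have h2 : ContinuousAt (fun t => f (x, t)) t :=
      (h t ht).continuousAt.comp (f := fun t : ℝ => (x, t)) (by fun_prop)
    exact h2.continuousWithinAt
  have hcx' : ContinuousOn (fun t => f' x₀ t) (uIcc 0 1) := by
    intro t ht
    rw [uIcc_of_le zero_le_one] at ht
    have h2 : ContinuousAt (fun t => f' x₀ t) t :=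
      (hcont x₀ t (hf t ht)).comp (f := fun t : ℝ => (x₀, t)) (by fun_prop)
    exact h2.continuousWithinAt
  obtain ⟨C, hC⟩ : ∃ C, ∀ t ∈ Icc (0 : ℝ) 1, ‖f' x₀ t‖ ≤ C := by
    rw [uIcc_of_le zero_le_one] at hcx'
    exact isCompact_Icc.exists_bound_of_continuousOn hcx'
  have hbd : ∀ᶠ x in 𝓝 x₀, ∀ t ∈ Icc (0 : ℝ) 1, ‖f' x t‖ ≤ C + 1 := by
    refine isCompact_Icc.eventually_forall_of_forall_eventually (x₀ := x₀)
      (K := Icc (0 : ℝ) 1) (P := fun x t => ‖f' x t‖ ≤ C + 1) fun t ht => ?_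
    have h3 := (hcont x₀ t (hf t ht)).norm
    have h4 : ‖f' x₀ t‖ < C + 1 := (hC t ht).trans_lt (by linarith)
    exact (h3.eventually (eventually_lt_nhds h4)).mono fun p hp => hp.le
  have hI : Ι (0 : ℝ) 1 ⊆ Icc 0 1 := by
    rw [uIoc_of_le zero_le_one]; exact Ioc_subset_Icc_self
  refine intervalIntegral.hasFDerivAt_integral_of_dominated_of_fderiv_le
    (F := fun x t => f (x, t)) (F' := f') (bound := fun _ => C + 1) (hev.and hbd) ?_ ?_ ?_ ?_ ?_ ?_
  · filter_upwards [hev] with x hx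
    exact ((hcx x hx).intervalIntegrable).def'.aestronglyMeasurable
  · exact (hcx x₀ hf).intervalIntegrable
  · exact (hcx'.intervalIntegrable).def'.aestronglyMeasurable
  · exact Eventually.of_forall fun t ht x hx => hx.2 t (hI ht)
  · exact intervalIntegrable_const
  · refine Eventually.of_forall fun t ht x hx => ?_
    have h5 := ((hx.1 t (hI ht)).differentiableAt (by simp)).hasFDerivAt
    exact h5.comp x (f := fun x => (x, t)) (hasFDerivAt_prodMk_left x t)

theorem hasFDerivAt_integral_param {X V : Type*} [NormedAddCommGroup X] [NormedSpace ℝ X]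
    [NormedAddCommGroup V] [NormedSpace ℝ V] {f : X × ℝ → V} {x₀ : X}
    (hf : ∀ t ∈ Icc (0 : ℝ) 1, ContDiffAt ℝ 1 f (x₀, t)) :
    ∀ᶠ x in 𝓝 x₀, HasFDerivAt (fun x => ∫ t in (0 : ℝ)..1, f (x, t))
      (∫ t in (0 : ℝ)..1, (fderiv ℝ f (x, t)).comp (ContinuousLinearMap.inl ℝ X ℝ)) x := by
  have hev : ∀ᶠ x in 𝓝 x₀, ∀ t ∈ Icc (0 : ℝ) 1, ContDiffAt ℝ 1 f (x, t) :=
    eventually_forall_Icc_contDiffAt (n := 1) (by simpa using hf)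
  filter_upwards [hev] with x hx using hasFDerivAt_integral_param_aux hx

universe u v

/-- Induction on the order: the derivative of the integral is again such an integral, with values in
`X →L[ℝ] V`. The target changes at each step, so it must range over a universe containing that of
`X`. -/
theorem contDiffAt_integral_param_aux {X : Type u} [NormedAddCommGroup X] [NormedSpace ℝ X]
    (n : ℕ) : ∀ {V : Type (max u v)} [NormedAddCommGroup V] [NormedSpace ℝ V]
    {f : X × ℝ → V} {x₀ : X}, (∀ t ∈ Icc (0 : ℝ) 1, ContDiffAt ℝ ∞ f (x₀, t)) →
    ContDiffAt ℝ n (fun x => ∫ t in (0 : ℝ)..1, f (x, t)) x₀ := by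
  induction n with
  | zero =>
    intro V _ _ f x₀ hf
    have h1 := hasFDerivAt_integral_param fun t ht => (hf t ht).of_le (by exact_mod_cast le_top)
    simp only [CharP.cast_eq_zero]
    rw [contDiffAt_zero]
    exact ⟨_, h1, fun x hx => HasFDerivAt.continuousAt hx |>.continuousWithinAt⟩
  | succ n ih =>
    intro V _ _ f x₀ hf
    have h1 := hasFDerivAt_integral_param fun t ht => (hf t ht).of_le (by exact_mod_cast le_top)
    push_cast
    rw [contDiffAt_succ_iff_hasFDerivAt]
    refine ⟨_, ⟨_, h1, fun x hx => hx⟩, ?_⟩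
    refine ih (f := fun p => (fderiv ℝ f p).comp (ContinuousLinearMap.inl ℝ X ℝ)) fun t ht => ?_
    exact ((hf t ht).fderiv_right (m := ∞) (by simp)).clm_comp contDiffAt_const

theorem contDiffAt_integral_param {X : Type u} [NormedAddCommGroup X] [NormedSpace ℝ X]
    {V : Type v} [NormedAddCommGroup V] [NormedSpace ℝ V]
    {f : X × ℝ → V} {x₀ : X} (hf : ∀ t ∈ Icc (0 : ℝ) 1, ContDiffAt ℝ ∞ f (x₀, t)) :
    ContDiffAt ℝ ∞ (fun x => ∫ t in (0 : ℝ)..1, f (x, t)) x₀ := by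
  rw [contDiffAt_infty]
  intro n
  -- Lifting the target to the larger universe commutes with the integral, which removes the
  -- restriction.
  let e : ULift.{u} V ≃L[ℝ] V := (LinearIsometryEquiv.ulift ℝ V).toContinuousLinearEquiv
  have h := contDiffAt_integral_param_aux.{u, v} n (V := ULift.{u} V) (f := fun p => e.symm (f p))
    (x₀ := x₀) fun t ht => e.symm.contDiff.contDiffAt.comp _ (hf t ht)
  have h2 := e.contDiff.contDiffAt.comp x₀ h (n := n)
  refine h2.congr_of_eventuallyEq (Eventually.of_forall fun x => ?_)
  simp only [Function.comp, intervalIntegral, map_sub, ← e.integral_comp_comm,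
    ContinuousLinearEquiv.apply_symm_apply]

/-! ### Functions vanishing to finite order along a zero section -/

/-- The `i`-th coordinate on a finite-dimensional space. -/
noncomputable def yCoord (Y : Type*) [NormedAddCommGroup Y] [NormedSpace ℝ Y]
    [FiniteDimensional ℝ Y] (i : Fin (Module.finrank ℝ Y)) : Y →L[ℝ] ℝ :=
  LinearMap.toContinuousLinearMap ((Module.finBasis ℝ Y).coord i)

theorem sum_yCoord_smul {Y : Type*} [NormedAddCommGroup Y] [NormedSpace ℝ Y]
    [FiniteDimensional ℝ Y] (y : Y) :
    ∑ i, yCoord Y i y • Module.finBasis ℝ Y i = y :=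
  (Module.finBasis ℝ Y).sum_repr y

section Van

variable {X Y V W Z : Type*} [NormedAddCommGroup X] [NormedSpace ℝ X]
  [NormedAddCommGroup Y] [NormedSpace ℝ Y] [FiniteDimensional ℝ Y]
  [NormedAddCommGroup V] [NormedSpace ℝ V] [NormedAddCommGroup W] [NormedSpace ℝ W]
  [NormedAddCommGroup Z] [NormedSpace ℝ Z]

/-- `Van Q n f`: near each point of the zero section over `Q`, `f` is smooth and lies in the
`n`-th power of the ideal of functions vanishing on the zero section. -/
def Van (Q : Set X) : ℕ → (X × Y → V) → Prop
  | 0, f => ∀ q ∈ Q, ContDiffAt ℝ ∞ f (q, 0)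
  | n + 1, f => ∃ h : Fin (Module.finrank ℝ Y) → X × Y → V, (∀ i, Van Q n (h i)) ∧
      ∀ q ∈ Q, f =ᶠ[𝓝 (q, 0)] fun x => ∑ i, yCoord Y i x.2 • h i x

theorem Van.congr {Q : Set X} {n : ℕ} {f g : X × Y → V} (hf : Van Q n f)
    (h : ∀ q ∈ Q, g =ᶠ[𝓝 (q, 0)] f) : Van Q n g := by
  cases n with
  | zero => exact fun q hq => (hf q hq).congr_of_eventuallyEq (h q hq)
  | succ n =>
    obtain ⟨k, hk, hk'⟩ := hf
    exact ⟨k, hk, fun q hq => (h q hq).trans (hk' q hq)⟩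

theorem Van.congr_fun {Q : Set X} {n : ℕ} {f g : X × Y → V} (hf : Van Q n f)
    (h : ∀ x, g x = f x) : Van Q n g :=
  hf.congr fun _ _ => Eventually.of_forall h

theorem contDiff_yCoord_snd (i : Fin (Module.finrank ℝ Y)) :
    ContDiff ℝ ∞ (fun x : X × Y => yCoord Y i x.2) :=
  (yCoord Y i).contDiff.comp contDiff_snd

theorem Van.smooth {Q : Set X} {n : ℕ} : ∀ {f : X × Y → V}, Van Q n f → Van Q 0 f := by
  induction n with
  | zero => exact fun h => h
  | succ n ih =>
    rintro f ⟨k, hk, hk'⟩ q hq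
    refine ContDiffAt.congr_of_eventuallyEq ?_ (hk' q hq)
    exact ContDiffAt.sum fun i _ => (contDiff_yCoord_snd i).contDiffAt.smul (ih (hk i) q hq)

theorem Van.succ_le {Q : Set X} {n : ℕ} :
    ∀ {f : X × Y → V}, Van Q (n + 1) f → Van Q n f := by
  induction n with
  | zero => exact fun h => h.smooth
  | succ n ih =>
    rintro f ⟨k, hk, hk'⟩
    exact ⟨k, fun i => ih (hk i), hk'⟩

theorem Van.mono {Q : Set X} {m n : ℕ} {f : X × Y → V} (hf : Van Q n f) (h : m ≤ n) :
    Van Q m f := by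
  induction n, h using Nat.le_induction with
  | base => exact hf
  | succ n _ ih => exact ih hf.succ_le

theorem Van.add {Q : Set X} {n : ℕ} :
    ∀ {f g : X × Y → V}, Van Q n f → Van Q n g → Van Q n (fun x => f x + g x) := by
  induction n with
  | zero => exact fun hf hg q hq => (hf q hq).add (hg q hq)
  | succ n ih =>
    rintro f g ⟨k, hk, hk'⟩ ⟨l, hl, hl'⟩
    refine ⟨fun i x => k i x + l i x, fun i => ih (hk i) (hl i), fun q hq => ?_⟩
    filter_upwards [hk' q hq, hl' q hq] with x h1 h2
    simp [h1, h2, Finset.sum_add_distrib]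

theorem van_zero {Q : Set X} {n : ℕ} : Van Q n (fun _ : X × Y => (0 : V)) := by
  induction n with
  | zero => exact fun q _ => contDiffAt_const
  | succ n ih => exact ⟨fun _ _ => 0, fun _ => ih, fun q _ => Eventually.of_forall (by simp)⟩

theorem Van.clm {Q : Set X} {n : ℕ} (L : V →L[ℝ] W) :
    ∀ {f : X × Y → V}, Van Q n f → Van Q n (fun x => L (f x)) := by
  induction n with
  | zero => exact fun hf q hq => L.contDiff.contDiffAt.comp _ (hf q hq)
  | succ n ih =>
    rintro f ⟨k, hk, hk'⟩
    refine ⟨fun i x => L (k i x), fun i => ih (hk i), fun q hq => ?_⟩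
    filter_upwards [hk' q hq] with x h1
    simp [h1]

theorem Van.const_smul {Q : Set X} {n : ℕ} {f : X × Y → V} (c : ℝ) (hf : Van Q n f) :
    Van Q n (fun x => c • f x) :=
  hf.clm (c • ContinuousLinearMap.id ℝ V)

theorem Van.neg {Q : Set X} {n : ℕ} {f : X × Y → V} (hf : Van Q n f) :
    Van Q n (fun x => -f x) :=
  (hf.const_smul (-1)).congr_fun (by simp)

theorem Van.sub {Q : Set X} {n : ℕ} {f g : X × Y → V} (hf : Van Q n f) (hg : Van Q n g) :
    Van Q n (fun x => f x - g x) :=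
  (hf.add hg.neg).congr_fun fun x => sub_eq_add_neg _ _

theorem Van.sum {Q : Set X} {n : ℕ} {ι : Type*} {s : Finset ι} {f : ι → X × Y → V}
    (hf : ∀ i ∈ s, Van Q n (f i)) : Van Q n (fun x => ∑ i ∈ s, f i x) := by
  classical
  induction s using Finset.induction_on with
  | empty => exact van_zero.congr_fun (by simp)
  | insert a s ha ih =>
    refine ((hf a (by simp)).add (ih fun i hi => hf i (by simp [hi]))).congr_fun fun x => ?_
    simp [Finset.sum_insert ha]

theorem Van.bilin {Q : Set X} (B : V →L[ℝ] W →L[ℝ] Z) {m n : ℕ} {f : X × Y → V}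
    {g : X × Y → W} (hf : Van Q m f) (hg : Van Q n g) :
    Van Q (m + n) (fun x => B (f x) (g x)) := by
  have h0 : ∀ n, ∀ {f : X × Y → V} {g : X × Y → W}, Van Q 0 f → Van Q n g →
      Van Q n (fun x => B (f x) (g x)) := by
    intro n
    induction n with
    | zero =>
      exact fun hf hg q hq => (B.contDiff.contDiffAt.comp _ (hf q hq)).clm_apply (hg q hq)
    | succ n ih =>
      rintro f g hf ⟨k, hk, hk'⟩
      refine ⟨fun i x => B (f x) (k i x), fun i => ih hf (hk i), fun q hq => ?_⟩
      filter_upwards [hk' q hq] with x h1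
      simp [h1]
  induction m generalizing f with
  | zero => simpa using h0 n hf hg
  | succ m ih =>
    obtain ⟨k, hk, hk'⟩ := hf
    rw [Nat.succ_add]
    refine ⟨fun i x => B (k i x) (g x), fun i => ih (hk i), fun q hq => ?_⟩
    filter_upwards [hk' q hq] with x h1
    simp [h1]

theorem Van.smul {Q : Set X} {m n : ℕ} {f : X × Y → ℝ} {g : X × Y → V} (hf : Van Q m f)
    (hg : Van Q n g) : Van Q (m + n) (fun x => f x • g x) :=
  Van.bilin (ContinuousLinearMap.lsmul ℝ ℝ) hf hg

theorem Van.clm_apply {Q : Set X} {m n : ℕ} {f : X × Y → V →L[ℝ] W} {g : X × Y → V}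
    (hf : Van Q m f) (hg : Van Q n g) : Van Q (m + n) (fun x => f x (g x)) :=
  Van.bilin (ContinuousLinearMap.id ℝ (V →L[ℝ] W)) hf hg

theorem Van.clm_comp {Q : Set X} {m n : ℕ} {f : X × Y → W →L[ℝ] Z} {g : X × Y → V →L[ℝ] W}
    (hf : Van Q m f) (hg : Van Q n g) : Van Q (m + n) (fun x => (f x).comp (g x)) :=
  Van.bilin (ContinuousLinearMap.compL ℝ V W Z) hf hg

theorem Van.prodMk {Q : Set X} {n : ℕ} {f : X × Y → V} {g : X × Y → W} (hf : Van Q n f)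
    (hg : Van Q n g) : Van Q n (fun x => (f x, g x)) :=
  ((hf.clm (ContinuousLinearMap.inl ℝ V W)).add
    (hg.clm (ContinuousLinearMap.inr ℝ V W))).congr_fun (by simp)

theorem Van.fst {Q : Set X} {n : ℕ} {f : X × Y → V × W} (hf : Van Q n f) :
    Van Q n (fun x => (f x).1) :=
  hf.clm (ContinuousLinearMap.fst ℝ V W)

theorem Van.snd {Q : Set X} {n : ℕ} {f : X × Y → V × W} (hf : Van Q n f) :
    Van Q n (fun x => (f x).2) :=
  hf.clm (ContinuousLinearMap.snd ℝ V W)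

theorem Van.eq_zero {Q : Set X} {n : ℕ} {f : X × Y → V} (hf : Van Q (n + 1) f) {q : X}
    (hq : q ∈ Q) : f (q, 0) = 0 := by
  obtain ⟨k, -, hk'⟩ := hf
  simp [(hk' q hq).eq_of_nhds]

theorem van_snd (Q : Set X) : Van Q 1 (fun x : X × Y => x.2) :=
  ⟨fun i _ => Module.finBasis ℝ Y i, fun i q _ => contDiffAt_const,
    fun q _ => Eventually.of_forall fun x => (sum_yCoord_smul x.2).symm⟩

theorem van_of_contDiffOn {Q : Set X} (hQ : IsOpen Q) {c : X → V} (hc : ContDiffOn ℝ ∞ c Q) :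
    Van Q 0 (fun x : X × Y => c x.1) :=
  fun q hq => (hc.contDiffAt (hQ.mem_nhds hq)).comp (q, (0 : Y)) contDiffAt_fst

theorem van_id (Q : Set X) : Van Q 0 (fun x : X × Y => x) := fun _ _ => contDiffAt_id

/-- Maps which are smooth near the zero section and fix it pointwise. -/
def FixZ (Q : Set X) (u : X × Y → X × Y) : Prop :=
  Van Q 0 u ∧ ∀ q ∈ Q, u (q, 0) = (q, 0)

theorem fixZ_id (Q : Set X) : FixZ Q (fun x : X × Y => x) := ⟨van_id Q, fun _ _ => rfl⟩

theorem FixZ.tendsto {Q : Set X} {u : X × Y → X × Y} (hu : FixZ Q u) {q : X} (hq : q ∈ Q) :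
    Tendsto u (𝓝 (q, 0)) (𝓝 (q, 0)) := by
  have := (hu.1 q hq).continuousAt.tendsto
  rwa [hu.2 q hq] at this

theorem Van.integral {Q : Set X} {f : (X × Y) × ℝ → V}
    (hf : ∀ q ∈ Q, ∀ t ∈ Icc (0 : ℝ) 1, ContDiffAt ℝ ∞ f ((q, 0), t)) :
    Van Q 0 (fun x : X × Y => ∫ t in (0 : ℝ)..1, f (x, t)) :=
  fun q hq => contDiffAt_integral_param (hf q hq)

/-- The difference of the values of a smooth function at two maps fixing the zero section is
a smooth linear factor times the difference of the maps. -/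
theorem Van.exists_sub_eq [CompleteSpace V] {Q : Set X} {f : X × Y → V} (hf : Van Q 0 f)
    {u v : X × Y → X × Y} (hu : FixZ Q u) (hv : FixZ Q v) :
    ∃ M : X × Y → (X × Y →L[ℝ] V), Van Q 0 M ∧ (∀ q ∈ Q, M (q, 0) = fderiv ℝ f (q, 0)) ∧
      ∀ q ∈ Q, ∀ᶠ x in 𝓝 (q, 0), f (v x) - f (u x) = M x (v x - u x) := by
  set w : (X × Y) × ℝ → X × Y := fun p => u p.1 + p.2 • (v p.1 - u p.1) with hw
  have hwq : ∀ q ∈ Q, ∀ t, w ((q, 0), t) = (q, 0) := by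
    intro q hq t
    simp [hw, hu.2 q hq, hv.2 q hq]
  have hws : ∀ q ∈ Q, ∀ t, ContDiffAt ℝ ∞ w ((q, 0), t) := by
    intro q hq t
    have h1 : ContDiffAt ℝ ∞ (fun p : (X × Y) × ℝ => u p.1) ((q, 0), t) :=
      ContDiffAt.comp (g := u) (f := Prod.fst) ((q, (0 : Y)), t) (hu.1 q hq) contDiffAt_fst
    have h2 : ContDiffAt ℝ ∞ (fun p : (X × Y) × ℝ => v p.1) ((q, 0), t) :=
      ContDiffAt.comp (g := v) (f := Prod.fst) ((q, (0 : Y)), t) (hv.1 q hq) contDiffAt_fst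
    exact h1.add (contDiffAt_snd.smul (h2.sub h1))
  have hfd : ∀ q ∈ Q, ContDiffAt ℝ ∞ (fderiv ℝ f) (q, 0) := fun q hq =>
    (hf q hq).fderiv_right (m := ∞) (by simp)
  have hcd : ∀ q ∈ Q, ∀ t, ContDiffAt ℝ ∞ (fun p => fderiv ℝ f (w p)) ((q, 0), t) := by
    intro q hq t
    have h3 := hfd q hq
    rw [← hwq q hq t] at h3
    exact h3.comp _ (hws q hq t)
  -- Hadamard's lemma: the factor is the mean of the derivative over the segment from `u x` to `v
  -- x`. On the zero section the segment is a point, hence the value of `M` there.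
  refine ⟨fun x => ∫ t in (0 : ℝ)..1, fderiv ℝ f (w (x, t)), ?_, ?_, ?_⟩
  · exact Van.integral fun q hq t _ => hcd q hq t
  · intro q hq
    simp [hwq q hq]
  · intro q hq
    have hnear : ∀ᶠ x in 𝓝 (q, (0 : Y)), ∀ t ∈ Icc (0 : ℝ) 1, ContDiffAt ℝ 1 f (w (x, t)) := by
      refine isCompact_Icc.eventually_forall_of_forall_eventually (x₀ := (q, (0 : Y)))
        (K := Icc (0 : ℝ) 1) (P := fun x t => ContDiffAt ℝ 1 f (w (x, t))) fun t _ => ?_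
      have h4 : ∀ᶠ y in 𝓝 (q, (0 : Y)), ContDiffAt ℝ 1 f y :=
        ((hf q hq).of_le (by exact_mod_cast le_top)).eventually (by simp)
      have h5 := (hws q hq t).continuousAt.tendsto
      rw [hwq q hq t] at h5
      exact h5.eventually h4
    filter_upwards [hnear] with x hx
    have hderiv : ∀ t ∈ uIcc (0 : ℝ) 1,
        HasDerivAt (fun t => f (w (x, t))) (fderiv ℝ f (w (x, t)) (v x - u x)) t := by
      intro t ht
      rw [uIcc_of_le zero_le_one] at ht
      have h6 : HasDerivAt (fun t : ℝ => w (x, t)) (v x - u x) t := by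
        have h := ((hasDerivAt_id t).smul_const (v x - u x)).const_add (u x)
        rw [one_smul] at h
        exact h
      exact ((hx t ht).differentiableAt (by simp)).hasFDerivAt.comp_hasDerivAt t h6
    have hcont : ContinuousOn (fun t : ℝ => fderiv ℝ f (w (x, t))) (uIcc 0 1) := by
      intro t ht
      rw [uIcc_of_le zero_le_one] at ht
      have h7 : ContinuousAt (fderiv ℝ f) (w (x, t)) :=
        ((hx t ht).fderiv_right (m := 0) (by simp)).continuousAt
      exact (h7.comp (f := fun t : ℝ => w (x, t)) (by simp only [hw]; fun_prop)).continuousWithinAt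
    have h8 := intervalIntegral.integral_eq_sub_of_hasDerivAt hderiv
      ((hcont.clm_apply continuousOn_const).intervalIntegrable)
    have h9 : w (x, 1) = v x := by simp [hw]
    have h10 : w (x, 0) = u x := by simp [hw]
    rw [h9, h10] at h8
    rw [← h8, ContinuousLinearMap.intervalIntegral_apply hcont.intervalIntegrable]

/-- Hadamard's lemma for the identity and the projection to the zero section. The values of the
coefficients on the zero section are recorded so that the factorization can be repeated to reach
order two. -/
theorem Van.exists_coeff [CompleteSpace V] {Q : Set X} {f : X × Y → V} (hf : Van Q 0 f)
    (h0 : ∀ q ∈ Q, f (q, 0) = 0) (hQ : IsOpen Q) :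
    ∃ k : Fin (Module.finrank ℝ Y) → X × Y → V, (∀ i, Van Q 0 (k i)) ∧
      (∀ i, ∀ q ∈ Q, k i (q, 0) = fderiv ℝ f (q, 0) (0, Module.finBasis ℝ Y i)) ∧
      ∀ q ∈ Q, f =ᶠ[𝓝 (q, 0)] fun x => ∑ i, yCoord Y i x.2 • k i x := by
  have hu : FixZ Q (fun x : X × Y => (x.1, (0 : Y))) :=
    ⟨fun q _ => contDiffAt_fst.prodMk contDiffAt_const, fun _ _ => rfl⟩
  obtain ⟨M, hM, hMd, hM'⟩ := hf.exists_sub_eq hu (fixZ_id Q)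
  refine ⟨fun i x => M x (0, Module.finBasis ℝ Y i), fun i =>
    Van.clm_apply (n := 0) hM (fun q _ => contDiffAt_const), fun i q hq => by simp only [hMd q hq],
    fun q hq => ?_⟩
  have hq' : ∀ᶠ x in 𝓝 (q, (0 : Y)), x.1 ∈ Q := continuousAt_fst.eventually (hQ.mem_nhds hq)
  filter_upwards [hM' q hq, hq'] with x hx hxQ
  rw [h0 _ hxQ, sub_zero] at hx
  rw [hx]
  have h1 : x - (x.1, 0) = ∑ i, yCoord Y i x.2 • ((0 : X), Module.finBasis ℝ Y i) := by
    ext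
    · simp [Prod.fst_sum]
    · simp [Prod.snd_sum, sum_yCoord_smul]
  rw [h1, map_sum]
  exact Finset.sum_congr rfl fun i _ => map_smul _ _ _

theorem Van.of_eq_zero [CompleteSpace V] {Q : Set X} {f : X × Y → V} (hf : Van Q 0 f)
    (h0 : ∀ q ∈ Q, f (q, 0) = 0) (hQ : IsOpen Q) : Van Q 1 f := by
  obtain ⟨k, hk, -, hk'⟩ := hf.exists_coeff h0 hQ
  exact ⟨k, hk, hk'⟩

theorem Van.two_of_fderiv_eq_zero [CompleteSpace V] {Q : Set X} {f : X × Y → V} (hf : Van Q 0 f)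
    (h0 : ∀ q ∈ Q, f (q, 0) = 0) (h1 : ∀ q ∈ Q, ∀ y, fderiv ℝ f (q, 0) (0, y) = 0)
    (hQ : IsOpen Q) : Van Q 2 f := by
  obtain ⟨k, hk, hkd, hk'⟩ := hf.exists_coeff h0 hQ
  exact ⟨k, fun i => (hk i).of_eq_zero (fun q hq => by rw [hkd i q hq, h1 q hq]) hQ, hk'⟩

theorem FixZ.van_snd {Q : Set X} {u : X × Y → X × Y} (hu : FixZ Q u) (hQ : IsOpen Q) :
    Van Q 1 (fun x => (u x).2) := by
  have : CompleteSpace Y := FiniteDimensional.complete ℝ Y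
  exact hu.1.snd.of_eq_zero (fun q hq => by rw [hu.2 q hq]) hQ

/-- The fibre component of `u` vanishes on the zero section, so each coordinate factor is pulled
back to a function of order one. -/
theorem Van.comp {Q : Set X} (hQ : IsOpen Q) {n : ℕ} {u : X × Y → X × Y} (hu : FixZ Q u) :
    ∀ {f : X × Y → V}, Van Q n f → Van Q n (fun x => f (u x)) := by
  induction n with
  | zero =>
    intro f hf q hq
    have h1 := hf q hq
    rw [← hu.2 q hq] at h1
    exact h1.comp _ (hu.1 q hq)
  | succ n ih =>
    rintro f ⟨k, hk, hk'⟩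
    have h1 : Van Q (1 + n) (fun x => ∑ i, yCoord Y i (u x).2 • k i (u x)) :=
      Van.sum fun i _ => ((hu.van_snd hQ).clm (yCoord Y i)).smul (ih (hk i))
    rw [add_comm] at h1
    exact h1.congr fun q hq => (hu.tendsto hq).eventually (hk' q hq)

theorem FixZ.comp {Q : Set X} (hQ : IsOpen Q) {u v : X × Y → X × Y} (hu : FixZ Q u)
    (hv : FixZ Q v) : FixZ Q (fun x => u (v x)) :=
  ⟨hu.1.comp hQ hv, fun q hq => by simp only [hv.2 q hq, hu.2 q hq]⟩

theorem FixZ.of_van_sub {Q : Set X} {u v : X × Y → X × Y} (hu : FixZ Q u)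
    (h : Van Q 1 (fun x => v x - u x)) : FixZ Q v :=
  ⟨(hu.1.add h.smooth).congr_fun fun x => by abel, fun q hq => by
    have := h.eq_zero hq
    rw [sub_eq_zero, hu.2 q hq] at this
    exact this⟩

theorem Van.eventually_differentiableAt {Q : Set X} {f : X × Y → V} (hf : Van Q 0 f) {q : X}
    (hq : q ∈ Q) : ∀ᶠ x in 𝓝 (q, (0 : Y)), DifferentiableAt ℝ f x := by
  have h4 : ∀ᶠ y in 𝓝 (q, (0 : Y)), ContDiffAt ℝ 1 f y :=
    ((hf q hq).of_le (by exact_mod_cast le_top)).eventually (by simp)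
  exact h4.mono fun x hx => hx.differentiableAt (by simp)

theorem Van.fderiv_zero {Q : Set X} {f : X × Y → V} (hf : Van Q 0 f) : Van Q 0 (fderiv ℝ f) :=
  fun q hq => (hf q hq).fderiv_right (m := ∞) (by simp)

/-- Leibniz rule. In the first summand a coordinate factor is lost, unless the fibre part of `v`
itself vanishes on the zero section; this separates the general case from the tangent one. -/
theorem eventually_fderiv_sum_yCoord {Q : Set X} {f : X × Y → V}
    {k : Fin (Module.finrank ℝ Y) → X × Y → V} (hk : ∀ i, Van Q 0 (k i)) {q : X} (hq : q ∈ Q)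
    (hf : f =ᶠ[𝓝 (q, 0)] fun x => ∑ i, yCoord Y i x.2 • k i x) (v : X × Y → X × Y) :
    ∀ᶠ x in 𝓝 (q, (0 : Y)), fderiv ℝ f x (v x) =
      ∑ i, (yCoord Y i (v x).2 • k i x + yCoord Y i x.2 • fderiv ℝ (k i) x (v x)) := by
  have hd' : ∀ᶠ x in 𝓝 (q, (0 : Y)), ∀ i, DifferentiableAt ℝ (k i) x :=
    eventually_all.2 fun i => (hk i).eventually_differentiableAt hq
  filter_upwards [hf.fderiv (𝕜 := ℝ), hd'] with x hx hd
  have h1 : HasFDerivAt (fun x : X × Y => ∑ i, yCoord Y i x.2 • k i x)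
      (∑ i, (yCoord Y i x.2 • fderiv ℝ (k i) x +
        ((yCoord Y i).comp (ContinuousLinearMap.snd ℝ X Y)).smulRight (k i x))) x := by
    refine HasFDerivAt.fun_sum fun i _ => ?_
    have h2 := ((yCoord Y i).comp (ContinuousLinearMap.snd ℝ X Y)).hasFDerivAt (x := x)
    exact h2.smul (hd i).hasFDerivAt
  rw [hx, h1.fderiv]
  simp [add_comm]

theorem Van.fderiv_apply {Q : Set X} {n : ℕ} {v : X × Y → X × Y} (hv : Van Q 0 v) :
    ∀ {f : X × Y → V}, Van Q (n + 1) f → Van Q n (fun x => fderiv ℝ f x (v x)) := by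
  induction n with
  | zero => exact fun hf => Van.clm_apply (m := 0) (n := 0) hf.smooth.fderiv_zero hv
  | succ n ih =>
    rintro f ⟨k, hk, hk'⟩
    have h1 : Van Q (n + 1) (fun x =>
        ∑ i, (yCoord Y i (v x).2 • k i x + yCoord Y i x.2 • fderiv ℝ (k i) x (v x))) := by
      refine Van.sum fun i _ => Van.add ?_ ?_
      · exact (((hv.snd).clm (yCoord Y i)).smul (hk i)).mono (by omega)
      · exact (((van_snd Q).clm (yCoord Y i)).smul (ih (hk i))).mono (by omega)
    exact h1.congr fun q hq => eventually_fderiv_sum_yCoord (fun i => (hk i).smooth) hq (hk' q hq) v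

/-- Differentiating along a field tangent to the zero section does not lower the order. -/
theorem Van.fderiv_apply_tangent {Q : Set X} {n : ℕ} {v : X × Y → X × Y} (hv : Van Q 0 v)
    (hv2 : Van Q 1 (fun x => (v x).2)) :
    ∀ {f : X × Y → V}, Van Q n f → Van Q n (fun x => fderiv ℝ f x (v x)) := by
  induction n with
  | zero => exact fun hf => Van.clm_apply (m := 0) (n := 0) hf.fderiv_zero hv
  | succ n ih =>
    rintro f ⟨k, hk, hk'⟩
    have h1 : Van Q (n + 1) (fun x =>
        ∑ i, (yCoord Y i (v x).2 • k i x + yCoord Y i x.2 • fderiv ℝ (k i) x (v x))) := by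
      refine Van.sum fun i _ => Van.add ?_ ?_
      · exact ((hv2.clm (yCoord Y i)).smul (hk i)).mono (by omega)
      · exact (((van_snd Q).clm (yCoord Y i)).smul (ih (hk i))).mono (by omega)
    exact h1.congr fun q hq => eventually_fderiv_sum_yCoord (fun i => (hk i).smooth) hq (hk' q hq) v

theorem Van.fderiv_eq_zero {Q : Set X} {f : X × Y → V} (hf : Van Q 2 f) {q : X} (hq : q ∈ Q) :
    fderiv ℝ f (q, 0) = 0 := by
  refine ContinuousLinearMap.ext fun v => ?_
  exact (Van.fderiv_apply (v := fun _ => v) (fun _ _ => contDiffAt_const) hf).eq_zero hq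

/-! ### Values of one function at two nearby maps. -/

section Differences

variable [CompleteSpace V] {Q : Set X} {u v : X × Y → X × Y}

theorem Van.sub_comp {f : X × Y → V} (hf : Van Q 0 f) (hu : FixZ Q u) (hv : FixZ Q v) {n : ℕ}
    (h : Van Q n (fun x => v x - u x)) : Van Q n (fun x => f (v x) - f (u x)) := by
  obtain ⟨M, hM, -, hM'⟩ := hf.exists_sub_eq hu hv
  exact ((hM.clm_apply h).mono (by omega)).congr hM'

/-- The Hadamard factor equals the derivative of `f` on the zero section, which is zero at order
two; this gains one order over `Van.sub_comp`. -/
theorem Van.sub_comp_of_two {f : X × Y → V} (hf : Van Q 2 f) (hQ : IsOpen Q) (hu : FixZ Q u)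
    (hv : FixZ Q v) {n : ℕ} (h : Van Q n (fun x => v x - u x)) :
    Van Q (n + 1) (fun x => f (v x) - f (u x)) := by
  obtain ⟨M, hM, hMd, hM'⟩ := hf.smooth.exists_sub_eq hu hv
  have hM1 : Van Q 1 M := hM.of_eq_zero (fun q hq => by rw [hMd q hq, hf.fderiv_eq_zero hq]) hQ
  exact ((hM1.clm_apply h).mono (by omega)).congr hM'

/-- Each coordinate factor changes only at order two, so exchanging one factor gains an order; the
remaining factors are treated by induction. This is what allows a nonlinear equivariant map to be
replaced by its rotation part inside a correction term. -/
theorem Van.sub_comp_of_snd_two (hQ : IsOpen Q) (hu : FixZ Q u) (hv : FixZ Q v)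
    (h1 : Van Q 1 (fun x => (v x).1 - (u x).1)) (h2 : Van Q 2 (fun x => (v x).2 - (u x).2))
    {n : ℕ} : ∀ {f : X × Y → V}, Van Q n f → Van Q (n + 1) (fun x => f (v x) - f (u x)) := by
  induction n with
  | zero => exact fun hf => hf.sub_comp hu hv ((h1.prodMk h2.succ_le).congr_fun fun x => rfl)
  | succ n ih =>
    rintro f ⟨k, hk, hk'⟩
    have h3 : Van Q (n + 2) (fun x => ∑ i, (yCoord Y i ((v x).2 - (u x).2) • k i (v x) +
        yCoord Y i (u x).2 • (k i (v x) - k i (u x)))) := by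
      refine Van.sum fun i _ => Van.add ?_ ?_
      · exact ((h2.clm (yCoord Y i)).smul ((hk i).comp hQ hv)).mono (by omega)
      · exact (((hu.van_snd hQ).clm (yCoord Y i)).smul (ih (hk i))).mono (by omega)
    refine h3.congr fun q hq => ?_
    filter_upwards [(hu.tendsto hq).eventually (hk' q hq),
      (hv.tendsto hq).eventually (hk' q hq)] with x hx1 hx2
    rw [hx1, hx2, ← Finset.sum_sub_distrib]
    refine Finset.sum_congr rfl fun i _ => ?_
    rw [map_sub, sub_smul, smul_sub]
    abel

end Differences

theorem Van.exists_bound {Q : Set X} {n : ℕ} {q : X} (hq : q ∈ Q) :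
    ∀ {f : X × Y → V}, Van Q n f → ∃ C : ℝ, ∀ᶠ x in 𝓝 (q, (0 : Y)), ‖f x‖ ≤ C * ‖x.2‖ ^ n := by
  induction n with
  | zero =>
    intro f hf
    refine ⟨‖f (q, 0)‖ + 1, ?_⟩
    have h1 := (hf q hq).continuousAt.norm.eventually (eventually_lt_nhds (lt_add_one ‖f (q, 0)‖))
    filter_upwards [h1] with x hx
    simpa using hx.le
  | succ n ih =>
    rintro f ⟨k, hk, hk'⟩
    choose C hC using fun i => ih (hk i)
    refine ⟨∑ i, ‖yCoord Y i‖ * C i, ?_⟩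
    filter_upwards [hk' q hq, eventually_all.2 hC] with x hx hCx
    rw [hx, Finset.sum_mul]
    refine (norm_sum_le _ _).trans (Finset.sum_le_sum fun i _ => ?_)
    rw [norm_smul, pow_succ]
    calc ‖yCoord Y i x.2‖ * ‖k i x‖
        ≤ (‖yCoord Y i‖ * ‖x.2‖) * (C i * ‖x.2‖ ^ n) := by
          gcongr
          · exact (yCoord Y i).le_opNorm _
          · exact hCx i
      _ = _ := by ring

/-- Homogeneous polynomials of degree `n` in the fibre variable, with coefficients smooth
over `Q`. -/
def Hom (Q : Set X) : ℕ → (X × Y → V) → Prop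
  | 0, p => Van Q 0 p ∧ ∀ q ∈ Q, ∀ y, p (q, y) = p (q, 0)
  | n + 1, p => ∃ h : Fin (Module.finrank ℝ Y) → X × Y → V, (∀ i, Hom Q n (h i)) ∧
      ∀ q ∈ Q, ∀ y, p (q, y) = ∑ i, yCoord Y i y • h i (q, y)

theorem Hom.van {Q : Set X} (hQ : IsOpen Q) {n : ℕ} :
    ∀ {p : X × Y → V}, Hom Q n p → Van Q n p := by
  induction n with
  | zero => exact fun h => h.1
  | succ n ih =>
    rintro p ⟨h, hh, hp⟩
    refine ⟨h, fun i => ih (hh i), fun q hq => ?_⟩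
    have hq' : ∀ᶠ x in 𝓝 (q, (0 : Y)), x.1 ∈ Q := continuousAt_fst.eventually (hQ.mem_nhds hq)
    filter_upwards [hq'] with x hx using hp x.1 hx x.2

/-- Leading Taylor part in the fibre: freezing the last coefficients on the zero section costs one
order. Homogeneous polynomials matter because along circle orbits they are exactly trigonometric
polynomials. -/
theorem Van.exists_hom [CompleteSpace V] {Q : Set X} (hQ : IsOpen Q) {n : ℕ} :
    ∀ {f : X × Y → V}, Van Q n f → ∃ p, Hom Q n p ∧ Van Q (n + 1) (fun x => f x - p x) := by
  induction n with
  | zero =>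
    intro f hf
    have hu : FixZ Q (fun x : X × Y => (x.1, (0 : Y))) :=
      ⟨fun q _ => contDiffAt_fst.prodMk contDiffAt_const, fun _ _ => rfl⟩
    refine ⟨fun x => f (x.1, 0), ⟨hf.comp hQ hu, fun _ _ _ => rfl⟩, ?_⟩
    exact (hf.sub (hf.comp hQ hu)).of_eq_zero (fun q _ => sub_self _) hQ
  | succ n ih =>
    rintro f ⟨k, hk, hk'⟩
    choose p hp hp' using fun i => ih (hk i)
    refine ⟨fun x => ∑ i, yCoord Y i x.2 • p i x, ⟨p, hp, fun _ _ _ => rfl⟩,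
      ⟨fun i x => k i x - p i x, hp', fun q hq => ?_⟩⟩
    filter_upwards [hk' q hq] with x hx
    simp [hx, smul_sub]

end Van

/-! ### Trigonometric polynomials and the shift by an irrational angle -/

section Trig

variable {V W : Type*} [NormedAddCommGroup V] [NormedSpace ℝ V] [NormedAddCommGroup W]
  [NormedSpace ℝ W]

/-- Vector-valued trigonometric polynomials of degree at most `n`. -/
def trigSpan (V : Type*) [NormedAddCommGroup V] [NormedSpace ℝ V] (n : ℕ) :
    Submodule ℝ (ℝ → V) :=
  Submodule.span ℝ {f | ∃ m ≤ n, ∃ v : V, (f = fun θ => Real.cos (m * θ) • v) ∨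
    f = fun θ => Real.sin (m * θ) • v}

theorem cos_mem_trigSpan {m n : ℕ} (h : m ≤ n) (v : V) :
    (fun θ => Real.cos (m * θ) • v) ∈ trigSpan V n :=
  Submodule.subset_span ⟨m, h, v, Or.inl rfl⟩

theorem sin_mem_trigSpan {m n : ℕ} (h : m ≤ n) (v : V) :
    (fun θ => Real.sin (m * θ) • v) ∈ trigSpan V n :=
  Submodule.subset_span ⟨m, h, v, Or.inr rfl⟩

theorem const_mem_trigSpan (n : ℕ) (v : V) : (fun _ => v) ∈ trigSpan V n := by
  have := cos_mem_trigSpan (Nat.zero_le n) v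
  simpa using this

theorem trigSpan_mono {m n : ℕ} (h : m ≤ n) : trigSpan V m ≤ trigSpan V n := by
  refine Submodule.span_mono ?_
  rintro f ⟨k, hk, v, hf⟩
  exact ⟨k, hk.trans h, v, hf⟩

theorem trigSpan_induction {n : ℕ} {P : (ℝ → V) → Prop}
    (hc : ∀ m ≤ n, ∀ v : V, P (fun θ => Real.cos (m * θ) • v))
    (hs : ∀ m ≤ n, ∀ v : V, P (fun θ => Real.sin (m * θ) • v)) (h0 : P 0)
    (ha : ∀ f g, P f → P g → P (f + g)) (hm : ∀ (c : ℝ) f, P f → P (c • f)) {f : ℝ → V}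
    (hf : f ∈ trigSpan V n) : P f := by
  refine Submodule.span_induction (p := fun f _ => P f) ?_ h0 (fun f g _ _ => ha f g)
    (fun c f _ => hm c f) hf
  rintro f ⟨m, hm, v, rfl | rfl⟩
  exacts [hc m hm v, hs m hm v]

/-- Product-to-sum formulas. Frequency zero is treated apart because `m - 1` would leave the natural
numbers. -/
theorem cos_smul_mem_trigSpan {n : ℕ} {f : ℝ → V} (hf : f ∈ trigSpan V n) :
    (fun θ => Real.cos θ • f θ) ∈ trigSpan V (n + 1) := by
  refine trigSpan_induction (P := fun f => (fun θ => Real.cos θ • f θ) ∈ trigSpan V (n + 1))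
    ?_ ?_ ?_ ?_ ?_ hf
  · rintro (_ | m) hm v
    · have := cos_mem_trigSpan (m := 1) (n := n + 1) (by omega) v
      simpa using this
    · have h := ((trigSpan V (n + 1)).add_mem
        (cos_mem_trigSpan (m := m + 2) (n := n + 1) (by omega) ((1 / 2 : ℝ) • v))
        (cos_mem_trigSpan (m := m) (n := n + 1) (by omega) ((1 / 2 : ℝ) • v)))
      convert h using 1
      ext1 θ
      simp only [Pi.add_apply, smul_smul, ← add_smul]
      congr 1
      push_cast
      have h1 : ((m : ℝ) + 2) * θ = (m + 1) * θ + θ := by ring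
      have h2 : (m : ℝ) * θ = (m + 1) * θ - θ := by ring
      rw [h1, h2, Real.cos_add, Real.cos_sub]
      ring
  · rintro (_ | m) hm v
    · simpa using const_mem_trigSpan (n + 1) (0 : V)
    · have h := ((trigSpan V (n + 1)).add_mem
        (sin_mem_trigSpan (m := m + 2) (n := n + 1) (by omega) ((1 / 2 : ℝ) • v))
        (sin_mem_trigSpan (m := m) (n := n + 1) (by omega) ((1 / 2 : ℝ) • v)))
      convert h using 1
      ext1 θ
      simp only [Pi.add_apply, smul_smul, ← add_smul]
      congr 1
      push_cast
      have h1 : ((m : ℝ) + 2) * θ = (m + 1) * θ + θ := by ring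
      have h2 : (m : ℝ) * θ = (m + 1) * θ - θ := by ring
      rw [h1, h2, Real.sin_add, Real.sin_sub]
      ring
  · simpa using const_mem_trigSpan (n + 1) (0 : V)
  · intro f g hf hg
    have h := (trigSpan V (n + 1)).add_mem hf hg
    convert h using 1
    ext1 θ
    simp
  · intro c f hf
    have h := (trigSpan V (n + 1)).smul_mem c hf
    convert h using 1
    ext1 θ
    simp [smul_comm c]

theorem sin_smul_mem_trigSpan {n : ℕ} {f : ℝ → V} (hf : f ∈ trigSpan V n) :
    (fun θ => Real.sin θ • f θ) ∈ trigSpan V (n + 1) := by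
  refine trigSpan_induction (P := fun f => (fun θ => Real.sin θ • f θ) ∈ trigSpan V (n + 1))
    ?_ ?_ ?_ ?_ ?_ hf
  · rintro (_ | m) hm v
    · have := sin_mem_trigSpan (m := 1) (n := n + 1) (by omega) v
      simpa using this
    · have h := ((trigSpan V (n + 1)).sub_mem
        (sin_mem_trigSpan (m := m + 2) (n := n + 1) (by omega) ((1 / 2 : ℝ) • v))
        (sin_mem_trigSpan (m := m) (n := n + 1) (by omega) ((1 / 2 : ℝ) • v)))
      convert h using 1
      ext1 θ
      simp only [Pi.sub_apply, smul_smul, ← sub_smul]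
      congr 1
      push_cast
      have h1 : ((m : ℝ) + 2) * θ = (m + 1) * θ + θ := by ring
      have h2 : (m : ℝ) * θ = (m + 1) * θ - θ := by ring
      rw [h1, h2, Real.sin_add, Real.sin_sub]
      ring
  · rintro (_ | m) hm v
    · simpa using const_mem_trigSpan (n + 1) (0 : V)
    · have h := ((trigSpan V (n + 1)).sub_mem
        (cos_mem_trigSpan (m := m) (n := n + 1) (by omega) ((1 / 2 : ℝ) • v))
        (cos_mem_trigSpan (m := m + 2) (n := n + 1) (by omega) ((1 / 2 : ℝ) • v)))
      convert h using 1
      ext1 θ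
      simp only [Pi.sub_apply, smul_smul, ← sub_smul]
      congr 1
      push_cast
      have h1 : ((m : ℝ) + 2) * θ = (m + 1) * θ + θ := by ring
      have h2 : (m : ℝ) * θ = (m + 1) * θ - θ := by ring
      rw [h1, h2, Real.cos_add, Real.cos_sub]
      ring
  · simpa using const_mem_trigSpan (n + 1) (0 : V)
  · intro f g hf hg
    have h := (trigSpan V (n + 1)).add_mem hf hg
    convert h using 1
    ext1 θ
    simp
  · intro c f hf
    have h := (trigSpan V (n + 1)).smul_mem c hf
    convert h using 1
    ext1 θ
    simp [smul_comm c]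

theorem clm_comp_mem_trigSpan {n : ℕ} (L : V →L[ℝ] W) {f : ℝ → V} (hf : f ∈ trigSpan V n) :
    (fun θ => L (f θ)) ∈ trigSpan W n := by
  refine trigSpan_induction (P := fun f => (fun θ => L (f θ)) ∈ trigSpan W n) ?_ ?_ ?_ ?_ ?_ hf
  · intro m hm v
    simpa using cos_mem_trigSpan hm (L v)
  · intro m hm v
    simpa using sin_mem_trigSpan hm (L v)
  · simpa using const_mem_trigSpan n (0 : W)
  · intro f g hf hg
    convert (trigSpan W n).add_mem hf hg using 1
    ext1 θ
    simp
  · intro c f hf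
    convert (trigSpan W n).smul_mem c hf using 1
    ext1 θ
    simp

theorem differentiable_of_mem_trigSpan {n : ℕ} {f : ℝ → V} (hf : f ∈ trigSpan V n) :
    Differentiable ℝ f := by
  refine trigSpan_induction (P := Differentiable ℝ) ?_ ?_ ?_ ?_ ?_ hf
  · intro m _ v; fun_prop
  · intro m _ v; fun_prop
  · exact differentiable_const 0
  · intro f g hf hg; exact hf.add hg
  · intro c f hf; exact hf.const_smul c

theorem periodic_of_mem_trigSpan {n : ℕ} {f : ℝ → V} (hf : f ∈ trigSpan V n) :
    Function.Periodic f (2 * Real.pi) := by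
  refine trigSpan_induction (P := fun f => Function.Periodic f (2 * Real.pi)) ?_ ?_ ?_ ?_ ?_ hf
  · intro m _ v θ
    simp only [mul_add, Real.cos_add_nat_mul_two_pi]
  · intro m _ v θ
    simp only [mul_add, Real.sin_add_nat_mul_two_pi]
  · intro θ; rfl
  · intro f g hf hg; exact hf.add hg
  · intro c f hf; exact hf.smul c

/-- The shift `f ↦ f(· + α)`. -/
def shift (V : Type*) [NormedAddCommGroup V] [NormedSpace ℝ V] (α : ℝ) : Module.End ℝ (ℝ → V) :=
  LinearMap.funLeft ℝ V (· + α)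

theorem shift_pow_apply (α : ℝ) (k : ℕ) (f : ℝ → V) (θ : ℝ) :
    (shift V α ^ k) f θ = f (θ + k * α) := by
  induction k generalizing θ with
  | zero => simp
  | succ k ih =>
    rw [pow_succ', Module.End.mul_apply]
    change ((shift V α ^ k) f) (θ + α) = _
    rw [ih]
    congr 1
    push_cast
    ring

theorem aeval_shift_apply (α : ℝ) (c : Polynomial ℝ) (f : ℝ → V) (θ : ℝ) :
    Polynomial.aeval (shift V α) c f θ =
      ∑ k ∈ Finset.range (c.natDegree + 1), c.coeff k • f (θ + k * α) := by
  rw [Polynomial.aeval_eq_sum_range, LinearMap.sum_apply, Finset.sum_apply]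
  simp [shift_pow_apply]

open Polynomial in
/-- The product of the factors annihilating the nonzero frequencies up to `n`. -/
noncomputable def annihilator (α : ℝ) (n : ℕ) : Polynomial ℝ :=
  ∏ m ∈ Finset.range n, (X ^ 2 - C (2 * Real.cos ((m + 1 : ℕ) * α)) * X + 1)

open Polynomial in
-- The recurrence $f(\theta+2\alpha)-2\cos(m\alpha)f(\theta+\alpha)+f(\theta)=0$ holds for the
-- cosine and the sine of frequency $m$, and `X - 1` kills constants. The factors commute, so it is
-- enough that one of them divides the product and annihilates the given function.
theorem aeval_annihilator_eq_zero (α : ℝ) {n : ℕ} {f : ℝ → V} (hf : f ∈ trigSpan V n) :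
    aeval (shift V α) ((X - 1) * annihilator α n) f = 0 := by
  have hdvd : ∀ (d : Polynomial ℝ) (f : ℝ → V), d ∣ (X - 1) * annihilator α n →
      aeval (shift V α) d f = 0 → aeval (shift V α) ((X - 1) * annihilator α n) f = 0 := by
    rintro d f ⟨e, he⟩ hd
    rw [he, mul_comm, map_mul, Module.End.mul_apply, hd, map_zero]
  have h1 : ∀ v : V, aeval (shift V α) ((X - 1) * annihilator α n) (fun _ => v) = 0 := by
    intro v
    refine hdvd (X - 1) _ (dvd_mul_right _ _) ?_
    rw [map_sub, aeval_X, map_one, LinearMap.sub_apply]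
    exact sub_self _
  have h2 : ∀ m < n, X ^ 2 - C (2 * Real.cos ((m + 1 : ℕ) * α)) * X + 1 ∣
      (X - 1) * annihilator α n := fun m hm =>
    Dvd.dvd.mul_left (Finset.dvd_prod_of_mem (fun m : ℕ =>
      X ^ 2 - C (2 * Real.cos ((m + 1 : ℕ) * α)) * X + 1) (Finset.mem_range.2 hm)) _
  have h3 : ∀ (m : ℕ) (f : ℝ → V) (θ : ℝ),
      aeval (shift V α) (X ^ 2 - C (2 * Real.cos ((m + 1 : ℕ) * α)) * X + 1) f θ =
        f (θ + 2 * α) - (2 * Real.cos ((m + 1 : ℕ) * α)) • f (θ + α) + f θ := by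
    intro m f θ
    have e1 := shift_pow_apply (V := V) α 2 f θ
    generalize 2 * Real.cos ((m + 1 : ℕ) * α) = c
    simp only [map_add, map_sub, map_pow, aeval_X, map_mul, aeval_C, map_one]
    simp only [LinearMap.add_apply, LinearMap.sub_apply, Module.End.mul_apply, Pi.add_apply,
      Pi.sub_apply, Module.algebraMap_end_apply, Module.End.one_apply, Pi.smul_apply]
    rw [e1]
    rfl
  refine trigSpan_induction
    (P := fun f => aeval (shift V α) ((X - 1) * annihilator α n) f = 0) ?_ ?_ ?_ ?_ ?_ hf
  · rintro (_ | m) hm v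
    · simpa using h1 v
    · refine hdvd _ _ (h2 m (by omega)) ?_
      ext1 θ
      rw [h3]
      simp only [smul_smul, ← sub_smul, ← add_smul, Pi.zero_apply]
      convert zero_smul ℝ v
      have e1 : ((m + 1 : ℕ) : ℝ) * (θ + 2 * α) =
        ((m + 1 : ℕ) : ℝ) * (θ + α) + ((m + 1 : ℕ) : ℝ) * α := by ring
      have e2 : ((m + 1 : ℕ) : ℝ) * θ =
        ((m + 1 : ℕ) : ℝ) * (θ + α) - ((m + 1 : ℕ) : ℝ) * α := by ring
      rw [e1, e2, Real.cos_add, Real.cos_sub]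
      ring
  · rintro (_ | m) hm v
    · simpa using h1 (0 : V)
    · refine hdvd _ _ (h2 m (by omega)) ?_
      ext1 θ
      rw [h3]
      simp only [smul_smul, ← sub_smul, ← add_smul, Pi.zero_apply]
      convert zero_smul ℝ v
      have e1 : ((m + 1 : ℕ) : ℝ) * (θ + 2 * α) =
        ((m + 1 : ℕ) : ℝ) * (θ + α) + ((m + 1 : ℕ) : ℝ) * α := by ring
      have e2 : ((m + 1 : ℕ) : ℝ) * θ =
        ((m + 1 : ℕ) : ℝ) * (θ + α) - ((m + 1 : ℕ) : ℝ) * α := by ring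
      rw [e1, e2, Real.sin_add, Real.sin_sub]
      ring
  · exact map_zero _
  · intro f g hf hg
    rw [map_add, hf, hg, add_zero]
  · intro c f hf
    rw [map_smul, hf, smul_zero]

open Polynomial in
-- Each factor takes the value $2-2\cos(m\alpha)$ at $1$ with $m\ge1$, which vanishes only when
-- $m\alpha\in2\pi\mathbb Z$. This is the nonresonance condition that makes the normalized mean
-- possible.
theorem eval_one_annihilator_ne_zero {α : ℝ} (hα : Irrational (α / (2 * Real.pi))) (n : ℕ) :
    (annihilator α n).eval 1 ≠ 0 := by
  rw [annihilator, eval_prod, Finset.prod_ne_zero_iff]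
  intro m _ h
  simp only [eval_add, eval_sub, eval_pow, eval_X, eval_mul, eval_C, eval_one] at h
  have h1 : Real.cos ((m + 1 : ℕ) * α) = 1 := by linarith
  obtain ⟨k, hk⟩ := (Real.cos_eq_one_iff _).1 h1
  refine hα ⟨(k : ℚ) / ((m + 1 : ℕ) : ℚ), ?_⟩
  have hm : ((m + 1 : ℕ) : ℝ) ≠ 0 := by positivity
  push_cast
  push_cast at hm hk
  field_simp
  linarith

theorem shift_aeval_annihilator_eq_self (α : ℝ) {n : ℕ} {f : ℝ → V} (hf : f ∈ trigSpan V n)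
    (θ : ℝ) : Polynomial.aeval (shift V α) (annihilator α n) f (θ + α) =
      Polynomial.aeval (shift V α) (annihilator α n) f θ := by
  have h := congrFun (aeval_annihilator_eq_zero α hf) θ
  rw [map_mul, Module.End.mul_apply, map_sub, Polynomial.aeval_X, map_one, LinearMap.sub_apply,
    Pi.sub_apply, Pi.zero_apply, sub_eq_zero] at h
  exact h

/-- The annihilator of the nonzero frequencies maps trigonometric polynomials to constants. -/
theorem aeval_annihilator_const {α : ℝ} (hα : Irrational (α / (2 * Real.pi))) {n : ℕ}
    {f : ℝ → V} (hf : f ∈ trigSpan V n) (θ : ℝ) :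
    Polynomial.aeval (shift V α) (annihilator α n) f θ =
      Polynomial.aeval (shift V α) (annihilator α n) f 0 := by
  set g := Polynomial.aeval (shift V α) (annihilator α n) f with hg
  have hge : g = fun θ => ∑ k ∈ Finset.range ((annihilator α n).natDegree + 1),
      (annihilator α n).coeff k • f (θ + k * α) := funext fun θ => aeval_shift_apply α _ f θ
  have hfc := (differentiable_of_mem_trigSpan hf).continuous
  have hgc : Continuous g := by
    rw [hge]
    fun_prop
  have hgp : ∀ θ, g (θ + 2 * Real.pi) = g θ := by
    intro θ
    simp only [hge]
    refine Finset.sum_congr rfl fun k _ => ?_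
    have := periodic_of_mem_trigSpan hf (θ + k * α)
    rw [← this]
    congr 2
    ring
  -- The periods of the continuous function `g` form a closed subgroup containing $\alpha$ and
  -- $2\pi$, which is dense by irrationality; hence `g` is constant.
  let S : AddSubgroup ℝ :=
    { carrier := {s | ∀ θ, g (θ + s) = g θ}
      add_mem' := fun {a b} ha hb θ => by rw [← add_assoc, hb, ha]
      zero_mem' := fun θ => by rw [add_zero]
      neg_mem' := fun {a} ha θ => by
        have := ha (θ + -a)
        rw [← this]
        congr 1
        ring }
  have hS : IsClosed (S : Set ℝ) := by
    have : (S : Set ℝ) = ⋂ θ, {s | g (θ + s) = g θ} := by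
      ext s
      simp [S]
    rw [this]
    exact isClosed_iInter fun θ => isClosed_eq (by fun_prop) continuous_const
  have hd : Dense (S : Set ℝ) := by
    refine (dense_addSubgroupClosure_pair_iff.2 hα).mono ?_
    rw [SetLike.coe_subset_coe, AddSubgroup.closure_le]
    rintro s (rfl | rfl)
    · exact shift_aeval_annihilator_eq_self _ hf
    · exact hgp
  have : θ ∈ (S : Set ℝ) := by
    rw [← hS.closure_eq, hd.closure_eq]
    trivial
  have := this 0
  rwa [zero_add] at this

open Polynomial in
-- The normalized right-hand side vanishes at $1$, so `X - 1` divides it. The quotient, evaluated at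
-- the transport operator, inverts that operator minus the identity modulo the invariant part.
theorem exists_homological_polynomial {α : ℝ} (hα : Irrational (α / (2 * Real.pi))) (n : ℕ) :
    ∃ κ : Polynomial ℝ,
      (X - 1) * κ = 1 - C ((annihilator α n).eval 1)⁻¹ * annihilator α n := by
  have h : (1 - C ((annihilator α n).eval 1)⁻¹ * annihilator α n).IsRoot 1 := by
    simp [IsRoot, eval_one_annihilator_ne_zero hα n]
  obtain ⟨κ, hκ⟩ := dvd_iff_isRoot.2 h
  exact ⟨κ, by rw [hκ, C_1]⟩

end Trig

/-! ### The circle action and the homological equation -/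

section Rotation

variable {E : Type*} [NormedAddCommGroup E] [NormedSpace ℝ E]

/-- The rotation `cos θ + sin θ J_q`. -/
noncomputable def rot (J : E → E →L[ℝ] E) (θ : ℝ) (q : E) : E →L[ℝ] E :=
  Real.cos θ • ContinuousLinearMap.id ℝ E + Real.sin θ • J q

/-- The circle action `(q, (b, h)) ↦ (q, (rot θ b, h))`. -/
noncomputable def rotAct (J : E → E →L[ℝ] E) (θ : ℝ) (x : E × (E × ℝ)) : E × (E × ℝ) :=
  (x.1, (rot J θ x.1 x.2.1, x.2.2))

/-- The infinitesimal generator of `rotAct`. -/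
noncomputable def rotGen (J : E → E →L[ℝ] E) (x : E × (E × ℝ)) : E × (E × ℝ) :=
  (0, (J x.1 x.2.1, 0))

theorem rot_apply (J : E → E →L[ℝ] E) (θ : ℝ) (q u : E) :
    rot J θ q u = Real.cos θ • u + Real.sin θ • J q u := rfl

@[simp] theorem rot_zero (J : E → E →L[ℝ] E) (q u : E) : rot J 0 q u = u := by
  simp [rot_apply]

variable {J : E → E →L[ℝ] E} {Q : Set E}

theorem rot_add {q : E} (hJ2 : ∀ u, J q (J q u) = -u) (θ φ : ℝ) (u : E) :
    rot J (θ + φ) q u = rot J θ q (rot J φ q u) := by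
  simp only [rot_apply, map_add, map_smul, hJ2, Real.cos_add, Real.sin_add]
  module

theorem rot_rot_neg {q : E} (hJ2 : ∀ u, J q (J q u) = -u) (θ : ℝ) (u : E) :
    rot J θ q (rot J (-θ) q u) = u := by
  rw [← rot_add hJ2, add_neg_cancel, rot_zero]

theorem rot_comm {q : E} (hJ2 : ∀ u, J q (J q u) = -u) (θ φ : ℝ) (u : E) :
    rot J θ q (rot J φ q u) = rot J φ q (rot J θ q u) := by
  rw [← rot_add hJ2, ← rot_add hJ2, add_comm]

@[simp] theorem rotAct_fst (θ : ℝ) (x : E × (E × ℝ)) : (rotAct J θ x).1 = x.1 := rfl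

@[simp] theorem rotAct_zero (x : E × (E × ℝ)) : rotAct J 0 x = x := by
  simp [rotAct]

theorem rotAct_add {x : E × (E × ℝ)} (hJ2 : ∀ u, J x.1 (J x.1 u) = -u) (θ φ : ℝ) :
    rotAct J (θ + φ) x = rotAct J θ (rotAct J φ x) := by
  simp only [rotAct, rot_add hJ2]

theorem contDiffOn_rot (hJ : ContDiffOn ℝ ∞ J Q) (θ : ℝ) : ContDiffOn ℝ ∞ (rot J θ) Q :=
  contDiffOn_const.add (hJ.const_smul _)

variable [FiniteDimensional ℝ E]

theorem van_b (Q : Set E) : Van Q 1 (fun x : E × (E × ℝ) => x.2.1) := (van_snd Q).fst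

theorem van_h (Q : Set E) : Van Q 1 (fun x : E × (E × ℝ) => x.2.2) := (van_snd Q).snd

theorem van_q (Q : Set E) : Van Q 0 (fun x : E × (E × ℝ) => x.1) := (van_id Q).fst

theorem van_rot (hQ : IsOpen Q) (hJ : ContDiffOn ℝ ∞ J Q) (θ : ℝ) :
    Van Q 0 (fun x : E × (E × ℝ) => rot J θ x.1) :=
  van_of_contDiffOn hQ (contDiffOn_rot hJ θ)

theorem fixZ_rotAct (hQ : IsOpen Q) (hJ : ContDiffOn ℝ ∞ J Q) (θ : ℝ) :
    FixZ Q (rotAct J θ) := by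
  refine ⟨(van_q Q).prodMk (Van.prodMk ?_ (van_h Q).smooth), fun q _ => by simp [rotAct]⟩
  exact ((van_rot hQ hJ θ).clm_apply (van_b Q)).smooth

theorem van_rotGen (hQ : IsOpen Q) (hJ : ContDiffOn ℝ ∞ J Q) :
    Van Q 1 (rotGen J) :=
  van_zero.prodMk ((((van_of_contDiffOn hQ hJ).clm_apply (van_b Q)).mono (by omega)).prodMk
    van_zero)

theorem hasDerivAt_rotAct {x : E × (E × ℝ)} (hJ2 : ∀ u, J x.1 (J x.1 u) = -u) (θ : ℝ) :
    HasDerivAt (fun θ => rotAct J θ x) (rotGen J (rotAct J θ x)) θ := by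
  refine (hasDerivAt_const θ x.1).prodMk (HasDerivAt.prodMk ?_ (hasDerivAt_const θ x.2.2))
  have h : HasDerivAt (fun θ => rot J θ x.1 x.2.1)
      ((-Real.sin θ) • x.2.1 + Real.cos θ • J x.1 x.2.1) θ :=
    ((Real.hasDerivAt_cos θ).smul_const _).add ((Real.hasDerivAt_sin θ).smul_const _)
  convert h using 1
  simp only [rotAct_fst]
  simp only [rotAct, rot_apply, map_add, map_smul, hJ2]
  module

variable {V : Type*} [NormedAddCommGroup V] [NormedSpace ℝ V]

/-- Along an orbit a fibre coordinate is a constant plus a multiple of $\cos\theta$ plus a multiple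
of $\sin\theta$, so each coordinate factor raises the degree by at most one. -/
theorem Hom.comp_rotAct_mem {n : ℕ} : ∀ {p : E × (E × ℝ) → V}, Hom Q n p →
    ∀ x : E × (E × ℝ), x.1 ∈ Q → (fun θ => p (rotAct J θ x)) ∈ trigSpan V n := by
  induction n with
  | zero =>
    intro p hp x hx
    have : (fun θ => p (rotAct J θ x)) = fun _ => p (x.1, 0) := funext fun θ => hp.2 x.1 hx _
    rw [this]
    exact const_mem_trigSpan _ _
  | succ n ih =>
    rintro p ⟨h, hh, hp⟩ x hx
    have h1 : (fun θ => p (rotAct J θ x)) = ∑ i, (fun θ =>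
        yCoord (E × ℝ) i (0, x.2.2) • h i (rotAct J θ x) +
        Real.cos θ • (yCoord (E × ℝ) i (x.2.1, 0) • h i (rotAct J θ x)) +
        Real.sin θ • (yCoord (E × ℝ) i (J x.1 x.2.1, 0) • h i (rotAct J θ x))) := by
      ext1 θ
      rw [Finset.sum_apply]
      refine (hp x.1 hx _).trans (Finset.sum_congr rfl fun i _ => ?_)
      have h2 : ((rot J θ x.1 x.2.1, x.2.2) : E × ℝ) =
          (0, x.2.2) + Real.cos θ • (x.2.1, 0) + Real.sin θ • (J x.1 x.2.1, 0) := by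
        simp [rot_apply]
      change yCoord (E × ℝ) i (rot J θ x.1 x.2.1, x.2.2) • h i (rotAct J θ x) = _
      rw [h2, map_add, map_add, map_smul, map_smul, add_smul, add_smul, smul_smul, smul_smul,
        smul_eq_mul, smul_eq_mul]
    rw [h1]
    refine Submodule.sum_mem _ fun i _ => ?_
    have h3 := ih (hh i) x hx
    have h4 := trigSpan_mono (Nat.le_succ n) ((trigSpan V n).smul_mem
      (yCoord (E × ℝ) i (0, x.2.2)) h3)
    have h5 := cos_smul_mem_trigSpan ((trigSpan V n).smul_mem
      (yCoord (E × ℝ) i (x.2.1, 0)) h3)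
    have h6 := sin_smul_mem_trigSpan ((trigSpan V n).smul_mem
      (yCoord (E × ℝ) i (J x.1 x.2.1, 0)) h3)
    exact (trigSpan V (n + 1)).add_mem ((trigSpan V (n + 1)).add_mem h4 h5) h6

/-- The operator `∑ c_k ρ^k`, where `ρ f = M_α (f ∘ rotAct α)`. -/
noncomputable def polyAct (J : E → E →L[ℝ] E) (M : ℝ → E → V →L[ℝ] V) (α : ℝ)
    (c : Polynomial ℝ) (f : E × (E × ℝ) → V) (x : E × (E × ℝ)) : V :=
  ∑ k ∈ Finset.range (c.natDegree + 1), c.coeff k • M (k * α) x.1 (f (rotAct J (k * α) x))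

theorem Van.polyAct (hQ : IsOpen Q) (hJ : ContDiffOn ℝ ∞ J Q) {M : ℝ → E → V →L[ℝ] V}
    (hM : ∀ θ, ContDiffOn ℝ ∞ (M θ) Q) {α : ℝ} {c : Polynomial ℝ} {n : ℕ}
    {f : E × (E × ℝ) → V} (hf : Van Q n f) : Van Q n (polyAct J M α c f) := by
  refine (Van.sum (s := Finset.range (c.natDegree + 1)) (f := fun k x => c.coeff k •
    M (k * α) x.1 (f (rotAct J (k * α) x))) fun k _ => Van.const_smul _ ?_).congr_fun fun x => rfl
  exact ((van_of_contDiffOn hQ (hM _)).clm_apply (hf.comp hQ (fixZ_rotAct hQ hJ _))).mono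
    (by omega)

/-- Along an orbit the operator $f\mapsto M_\alpha(f\circ\mathrm{rotAct}_\alpha)$ becomes the shift
by $\alpha$ of $\theta\mapsto M_\theta f(\mathrm{rotAct}_\theta x)$, which transfers the facts about
trigonometric polynomials to functions on the bundle. -/
theorem polyAct_rotAct {M : ℝ → E → V →L[ℝ] V} {x : E × (E × ℝ)}
    (hJ2 : ∀ u, J x.1 (J x.1 u) = -u)
    (hM : ∀ θ φ v, M (θ + φ) x.1 v = M θ x.1 (M φ x.1 v)) (α : ℝ) (c : Polynomial ℝ)
    (f : E × (E × ℝ) → V) (θ : ℝ) :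
    M θ x.1 (polyAct J M α c f (rotAct J θ x)) =
      Polynomial.aeval (shift V α) c (fun θ => M θ x.1 (f (rotAct J θ x))) θ := by
  rw [aeval_shift_apply, polyAct, map_sum]
  refine Finset.sum_congr rfl fun k _ => ?_
  rw [map_smul, rotAct_fst, ← hM, ← rotAct_add hJ2, add_comm]

theorem polyAct_eq {M : ℝ → E → V →L[ℝ] V} {x : E × (E × ℝ)} (α : ℝ) (c : Polynomial ℝ)
    (f : E × (E × ℝ) → V) :
    polyAct J M α c f x =
      Polynomial.aeval (shift V α) c (fun θ => M θ x.1 (f (rotAct J θ x))) 0 := by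
  rw [aeval_shift_apply, polyAct]
  simp

/-- Solution of the homological equation `ρ τ - τ = p - γ` with `γ` invariant. -/
theorem exists_homological_solution (hQ : IsOpen Q) (hJ : ContDiffOn ℝ ∞ J Q)
    (hJ2 : ∀ q ∈ Q, ∀ u, J q (J q u) = -u) {α : ℝ} (hα : Irrational (α / (2 * Real.pi)))
    {M : ℝ → E → V →L[ℝ] V} (hM : ∀ θ, ContDiffOn ℝ ∞ (M θ) Q)
    (hMadd : ∀ q ∈ Q, ∀ θ φ v, M (θ + φ) q v = M θ q (M φ q v))
    (hM0 : ∀ q ∈ Q, ∀ v, M 0 q v = v)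
    (hMtrig : ∀ q ∈ Q, ∀ n, ∀ f ∈ trigSpan V n, (fun θ => M θ q (f θ)) ∈ trigSpan V (n + 1))
    {n : ℕ} {p : E × (E × ℝ) → V} (hp : Hom Q n p) :
    ∃ τ γ : E × (E × ℝ) → V, (∀ m, Van Q m p → Van Q m τ) ∧ (∀ m, Van Q m p → Van Q m γ) ∧
      (∀ x : E × (E × ℝ), x.1 ∈ Q → ∀ θ, M θ x.1 (γ (rotAct J θ x)) = γ x) ∧
      ∀ x : E × (E × ℝ), x.1 ∈ Q → M α x.1 (τ (rotAct J α x)) - τ x = p x - γ x := by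
  -- Degree `n + 1` rather than `n`, since applying `M` may raise the degree by one.
  obtain ⟨κ, hκ⟩ := exists_homological_polynomial hα (n + 1)
  set e := (annihilator α (n + 1)).eval 1
  have hg : ∀ x : E × (E × ℝ), x.1 ∈ Q →
      (fun θ => M θ x.1 (p (rotAct J θ x))) ∈ trigSpan V (n + 1) := fun x hx =>
    hMtrig x.1 hx n _ (hp.comp_rotAct_mem x hx)
  -- Here `γ` is the mean of `p` and `τ` is given by the quotient polynomial; the homological
  -- equation is the polynomial identity evaluated at the shift.
  refine ⟨polyAct J M α κ p, fun x => e⁻¹ • polyAct J M α (annihilator α (n + 1)) p x,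
    fun m hm => hm.polyAct hQ hJ hM, fun m hm => (hm.polyAct hQ hJ hM).const_smul _, ?_, ?_⟩
  · intro x hx θ
    rw [map_smul, polyAct_rotAct (hJ2 _ hx) (hMadd _ hx), aeval_annihilator_const hα (hg x hx),
      ← polyAct_eq]
  · intro x hx
    beta_reduce
    rw [polyAct_rotAct (hJ2 _ hx) (hMadd _ hx), polyAct_eq, polyAct_eq]
    have h := congrFun (LinearMap.congr_fun (congrArg (Polynomial.aeval (shift V α)) hκ)
      (fun θ => M θ x.1 (p (rotAct J θ x)))) 0
    simp only [map_mul, map_sub, Polynomial.aeval_X, map_one, Polynomial.aeval_C,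
      Module.End.mul_apply, LinearMap.sub_apply, Module.End.one_apply, Pi.sub_apply,
      Module.algebraMap_end_apply, Pi.smul_apply, rotAct_zero, hM0 _ hx] at h
    rw [← h]
    have h2 : ∀ f : ℝ → V, shift V α f 0 = f α := fun f => by
      change f (0 + α) = f α
      rw [zero_add]
    rw [h2]

/-- The average over the circle action, exact on polynomials of degree at most `n`. -/
noncomputable def rotAvg (J : E → E →L[ℝ] E) (α : ℝ) (n : ℕ) (f : E × (E × ℝ) → V)
    (x : E × (E × ℝ)) : V :=
  ((annihilator α n).eval 1)⁻¹ •
    polyAct J (fun _ _ => ContinuousLinearMap.id ℝ V) α (annihilator α n) f x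

theorem Van.rotAvg (hQ : IsOpen Q) (hJ : ContDiffOn ℝ ∞ J Q) {α : ℝ} {m n : ℕ}
    {f : E × (E × ℝ) → V} (hf : Van Q n f) : Van Q n (rotAvg J α m f) :=
  (hf.polyAct hQ hJ fun _ => contDiffOn_const).const_smul _

theorem rotAvg_add (α : ℝ) (n : ℕ) (f g : E × (E × ℝ) → V) (x : E × (E × ℝ)) :
    rotAvg J α n (fun x => f x + g x) x = rotAvg J α n f x + rotAvg J α n g x := by
  simp [rotAvg, polyAct, Finset.sum_add_distrib]

theorem rotAvg_comp (α : ℝ) (n : ℕ) (f : E × (E × ℝ) → V) {G : E × (E × ℝ) → E × (E × ℝ)}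
    {x : E × (E × ℝ)} (h : ∀ θ, G (rotAct J θ x) = rotAct J θ (G x)) :
    rotAvg J α n (fun x => f (G x)) x = rotAvg J α n f (G x) := by
  simp [rotAvg, polyAct, h]

theorem rotAvg_of_invariant {α : ℝ} (hα : Irrational (α / (2 * Real.pi))) (n : ℕ)
    {f : E × (E × ℝ) → V} {x : E × (E × ℝ)} (h : ∀ θ, f (rotAct J θ x) = f x) :
    rotAvg J α n f x = f x := by
  simp only [rotAvg, polyAct, h, ContinuousLinearMap.id_apply, ← Finset.sum_smul]
  have := Polynomial.eval_eq_sum_range (p := annihilator α n) (1 : ℝ)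
  simp only [one_pow, mul_one] at this
  rw [← this, smul_smul, inv_mul_cancel₀ (eval_one_annihilator_ne_zero hα n), one_smul]

/-- `P` is the Taylor polynomial of degree less than `n` in the fibre, built one homogeneous part at
a time. -/
theorem Van.exists_trig_approx [CompleteSpace V] (hQ : IsOpen Q) {s : E × (E × ℝ) → V}
    (hs : Van Q 0 s) (n : ℕ) : ∃ P : E × (E × ℝ) → V, Van Q 0 P ∧
      (∀ x : E × (E × ℝ), x.1 ∈ Q → (fun θ => P (rotAct J θ x)) ∈ trigSpan V n) ∧
      Van Q n (fun x => s x - P x) := by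
  induction n with
  | zero =>
    exact ⟨fun _ => 0, van_zero, fun _ _ => const_mem_trigSpan _ _, hs.congr_fun fun x => sub_zero _⟩
  | succ n ih =>
    obtain ⟨P, hP, hPt, hPn⟩ := ih
    obtain ⟨p, hp, hpn⟩ := hPn.exists_hom hQ
    refine ⟨fun x => P x + p x, hP.add (hp.van hQ).smooth, fun x hx => ?_,
      hpn.congr_fun fun x => (sub_sub _ _ _).symm⟩
    exact trigSpan_mono (Nat.le_succ n)
      ((trigSpan V n).add_mem (hPt x hx) (hp.comp_rotAct_mem x hx))

/-- A derivative along the orbits has mean zero. For the trigonometric approximation `P` this is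
exact, the annihilator being constant along the orbit. The remainder keeps order `n` because the
generator is tangent to the zero section. -/
theorem van_rotAvg_fderiv [CompleteSpace V] (hQ : IsOpen Q) (hJ : ContDiffOn ℝ ∞ J Q)
    (hJ2 : ∀ q ∈ Q, ∀ u, J q (J q u) = -u) {α : ℝ} (hα : Irrational (α / (2 * Real.pi)))
    {s : E × (E × ℝ) → V} (hs : Van Q 0 s) (n : ℕ) :
    Van Q n (rotAvg J α n (fun x => fderiv ℝ s x (rotGen J x))) := by
  obtain ⟨P, hP, hPt, hPn⟩ := hs.exists_trig_approx (J := J) hQ n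
  have hgen := van_rotGen hQ hJ
  have h1 : Van Q n (fun x => fderiv ℝ (fun x => s x - P x) x (rotGen J x)) :=
    Van.fderiv_apply_tangent hgen.smooth hgen.snd hPn
  refine (h1.rotAvg hQ hJ (α := α) (m := n)).congr fun q hq => ?_
  have hq' : ∀ᶠ x in 𝓝 (q, (0 : E × ℝ)), x.1 ∈ Q := continuousAt_fst.eventually (hQ.mem_nhds hq)
  have hd : ∀ᶠ x in 𝓝 (q, (0 : E × ℝ)), ∀ k ∈ Finset.range ((annihilator α n).natDegree + 1),
      DifferentiableAt ℝ s (rotAct J (k * α) x) ∧ DifferentiableAt ℝ P (rotAct J (k * α) x) := by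
    rw [Filter.eventually_all_finset]
    intro k _
    have h2 := (fixZ_rotAct hQ hJ (k * α)).tendsto hq
    exact (h2.eventually (hs.eventually_differentiableAt hq)).and
      (h2.eventually (hP.eventually_differentiableAt hq))
  filter_upwards [hq', hd] with x hx hdx
  have h0 : ∑ k ∈ Finset.range ((annihilator α n).natDegree + 1), (annihilator α n).coeff k •
      fderiv ℝ P (rotAct J (k * α) x) (rotGen J (rotAct J (k * α) x)) = 0 := by
    set f : ℝ → V := fun θ => P (rotAct J θ x) with hf
    have hc : HasDerivAt (fun θ => Polynomial.aeval (shift V α) (annihilator α n) f θ) 0 0 := by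
      have : (fun θ => Polynomial.aeval (shift V α) (annihilator α n) f θ) =
          fun _ => Polynomial.aeval (shift V α) (annihilator α n) f 0 :=
        funext fun θ => aeval_annihilator_const hα (hPt x hx) θ
      rw [this]
      exact hasDerivAt_const _ _
    have hc2 : HasDerivAt (fun θ => Polynomial.aeval (shift V α) (annihilator α n) f θ)
        (∑ k ∈ Finset.range ((annihilator α n).natDegree + 1), (annihilator α n).coeff k •
          fderiv ℝ P (rotAct J (k * α) x) (rotGen J (rotAct J (k * α) x))) 0 := by
      simp only [aeval_shift_apply]
      refine HasDerivAt.fun_sum fun k hk => HasDerivAt.const_smul _ ?_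
      have h3 := (hdx k hk).2.hasFDerivAt
      have h4 := hasDerivAt_rotAct (hJ2 _ hx) (k * α)
      have h5 : HasDerivAt f (fderiv ℝ P (rotAct J (k * α) x) (rotGen J (rotAct J (k * α) x)))
          (k * α) := h3.comp_hasDerivAt (k * α : ℝ) h4
      have h6 : HasDerivAt f (fderiv ℝ P (rotAct J (k * α) x) (rotGen J (rotAct J (k * α) x)))
          (0 + k * α) := by rwa [zero_add]
      exact h6.comp_add_const 0 (k * α)
    exact hc2.unique hc
  simp only [rotAvg, polyAct, ContinuousLinearMap.id_apply]
  congr 1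
  rw [← sub_eq_zero, ← Finset.sum_sub_distrib, ← h0]
  refine Finset.sum_congr rfl fun k hk => ?_
  rw [fderiv_fun_sub (hdx k hk).1 (hdx k hk).2, ← smul_sub, sub_apply]
  congr 1
  abel

end Rotation

/-! ### Equivariant normal form along the zero section -/

section NormalForm

variable {E : Type*} [NormedAddCommGroup E] [NormedSpace ℝ E] [FiniteDimensional ℝ E]
  {W : Type*} [NormedAddCommGroup W] [NormedSpace ℝ W]
  {Q : Set E} {J : E → E →L[ℝ] E}

/-- A parameter-preserving map of `E × (E × ℝ)`. -/
def mapOf (f g : E × (E × ℝ) → E) (x : E × (E × ℝ)) : E × (E × ℝ) := (f x, (g x, x.2.2))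

theorem fixZ_mapOf {f g : E × (E × ℝ) → E} (hf : Van Q 1 (fun x => f x - x.1))
    (hg : Van Q 1 g) : FixZ Q (mapOf f g) := by
  refine ⟨Van.prodMk ((hf.smooth.add (van_q Q)).congr_fun fun x => by abel)
    (hg.smooth.prodMk (van_h Q).smooth), fun q hq => ?_⟩
  have h1 := hf.eq_zero hq
  have h2 := hg.eq_zero hq
  simp only [sub_eq_zero] at h1
  simp [mapOf, h1, h2]

theorem van_mapOf_sub {f g f' g' : E × (E × ℝ) → E} {n : ℕ} (hf : Van Q n (fun x => f' x - f x))
    (hg : Van Q n (fun x => g' x - g x)) :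
    Van Q n (fun x => mapOf f' g' x - mapOf f g x) :=
  (hf.prodMk (hg.prodMk (van_zero (V := ℝ)))).congr_fun fun x => by simp [mapOf]

theorem fixZ_shiftFst {f : E × (E × ℝ) → E} (hf : Van Q 1 (fun x => f x - x.1)) :
    FixZ Q (fun x => (f x, x.2)) :=
  fixZ_mapOf hf (van_b Q)

theorem van_comp_fst (hQ : IsOpen Q) {c : E → W} (hc : ContDiffOn ℝ ∞ c Q)
    {f : E × (E × ℝ) → E} (hf : Van Q 1 (fun x => f x - x.1)) : Van Q 0 (fun x => c (f x)) :=
  Van.comp hQ (fixZ_shiftFst hf) (van_of_contDiffOn hQ hc)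

theorem van_comp_fst_sub [CompleteSpace W] (hQ : IsOpen Q) {c : E → W} (hc : ContDiffOn ℝ ∞ c Q)
    {f f' : E × (E × ℝ) → E} (hf : Van Q 1 (fun x => f x - x.1))
    (hf' : Van Q 1 (fun x => f' x - x.1)) {n : ℕ} (h : Van Q n (fun x => f' x - f x)) :
    Van Q n (fun x => c (f' x) - c (f x)) :=
  Van.sub_comp (f := fun x => c x.1) (van_of_contDiffOn hQ hc) (fixZ_shiftFst hf)
    (fixZ_shiftFst hf') ((h.prodMk (van_zero (V := E × ℝ))).congr_fun fun x => by simp)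

theorem van_sub_self_fst (Q : Set E) {n : ℕ} :
    Van Q n (fun x : E × (E × ℝ) => x.1 - x.1) :=
  van_zero.congr_fun fun x => sub_self _

/-- A linear map intertwining `J q` and `J q'`, equal to the identity for `q' = q`. -/
noncomputable def intertwiner (J : E → E →L[ℝ] E) (q q' : E) : E →L[ℝ] E :=
  (1 / 2 : ℝ) • (ContinuousLinearMap.id ℝ E - (J q').comp (J q))

theorem intertwiner_apply (q q' u : E) :
    intertwiner J q q' u = (1 / 2 : ℝ) • (u - J q' (J q u)) := rfl

/-- With $K=\tfrac12(1-J'J)$, both $KJ$ and $J'K$ equal $\tfrac12(J+J')$. Thus $K$ transports the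
circle action between fibres without any connection. -/
theorem intertwiner_rot {q q' : E} (hq : ∀ u, J q (J q u) = -u)
    (hq' : ∀ u, J q' (J q' u) = -u) (θ : ℝ) (u : E) :
    intertwiner J q q' (rot J θ q u) = rot J θ q' (intertwiner J q q' u) := by
  simp only [intertwiner_apply, rot_apply, map_smul, map_sub, map_add, hq, hq', map_neg]
  module

/-- The equivariant map with displacement `a` in the base and fibre part `β`. -/
noncomputable def equivMap (J : E → E →L[ℝ] E) (a β : E × (E × ℝ) → E) :
    E × (E × ℝ) → E × (E × ℝ) :=
  mapOf (fun x => x.1 + a x) (fun x => intertwiner J x.1 (x.1 + a x) (β x))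

theorem van_add_fst {a : E × (E × ℝ) → E} {n : ℕ} (ha : Van Q n a) :
    Van Q n (fun x => x.1 + a x - x.1) := ha.congr_fun fun x => by abel

theorem van_intertwiner (hQ : IsOpen Q) (hJ : ContDiffOn ℝ ∞ J Q)
    {a : E × (E × ℝ) → E} (ha : Van Q 1 a) :
    Van Q 0 (fun x => intertwiner J x.1 (x.1 + a x)) :=
  Van.const_smul _ (Van.sub (fun _ _ => contDiffAt_const)
    (Van.clm_comp (n := 0) (van_comp_fst hQ hJ (van_add_fst ha)) (van_of_contDiffOn hQ hJ)))

theorem van_intertwiner_sub_id (hQ : IsOpen Q) (hJ : ContDiffOn ℝ ∞ J Q)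
    (hJ2 : ∀ q ∈ Q, ∀ u, J q (J q u) = -u) {a : E × (E × ℝ) → E} (ha : Van Q 1 a) :
    Van Q 1 (fun x => intertwiner J x.1 (x.1 + a x) - ContinuousLinearMap.id ℝ E) := by
  refine Van.of_eq_zero ((van_intertwiner hQ hJ ha).sub fun _ _ => contDiffAt_const) ?_ hQ
  intro q hq
  ext u
  simp only [ha.eq_zero hq, add_zero, sub_apply, intertwiner_apply, hJ2 q hq,
    ContinuousLinearMap.id_apply, zero_apply]
  module

theorem fixZ_equivMap (hQ : IsOpen Q) (hJ : ContDiffOn ℝ ∞ J Q)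
    {a β : E × (E × ℝ) → E} (ha : Van Q 1 a) (hβ : Van Q 1 β) : FixZ Q (equivMap J a β) :=
  fixZ_mapOf (van_add_fst ha) (((van_intertwiner hQ hJ ha).clm_apply hβ).mono (by omega))

/-- Changing the fibre part of an equivariant map. -/
theorem van_equivMap_add_fibre (hQ : IsOpen Q) (hJ : ContDiffOn ℝ ∞ J Q)
    (hJ2 : ∀ q ∈ Q, ∀ u, J q (J q u) = -u) {a β γ : E × (E × ℝ) → E} (ha : Van Q 1 a) {n : ℕ}
    (hγ : Van Q n γ) :
    Van Q (n + 1) (fun x => (equivMap J a (fun x => β x + γ x) x).2.1 -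
      (equivMap J a β x).2.1 - γ x) := by
  refine (((van_intertwiner_sub_id hQ hJ hJ2 ha).clm_apply hγ).mono (by omega)).congr_fun
    fun x => ?_
  simp [equivMap, mapOf]

/-- Changing the displacement of an equivariant map. -/
theorem van_equivMap_add_base (hQ : IsOpen Q) (hJ : ContDiffOn ℝ ∞ J Q)
    {a β γ : E × (E × ℝ) → E} (ha : Van Q 1 a) (hβ : Van Q 1 β) {n : ℕ} (hγ : Van Q (n + 1) γ) :
    Van Q (n + 2) (fun x => (equivMap J (fun x => a x + γ x) β x).2.1 -
      (equivMap J a β x).2.1) := by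
  have h1 : Van Q (n + 1) (fun x => J (x.1 + (a x + γ x)) - J (x.1 + a x)) :=
    van_comp_fst_sub hQ hJ (van_add_fst ha) (van_add_fst (ha.add (hγ.mono (by omega))))
      (hγ.congr_fun fun x => by abel)
  have h2 : Van Q 1 (fun x => J x.1 (β x)) :=
    ((van_of_contDiffOn hQ hJ).clm_apply hβ).mono (by omega)
  refine (((h1.clm_apply h2).const_smul (-(1 / 2))).mono (by omega)).congr_fun fun x => ?_
  simp only [equivMap, mapOf, intertwiner_apply, sub_apply]
  module

/-- These are the two orders of agreement with the linear rotation that `Van.sub_comp_of_snd_two`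
requires. -/
theorem van_equivMap_sub_rotAct (hQ : IsOpen Q) (hJ : ContDiffOn ℝ ∞ J Q)
    (hJ2 : ∀ q ∈ Q, ∀ u, J q (J q u) = -u) {α : ℝ}
    {a β : E × (E × ℝ) → E} (ha : Van Q 1 a)
    (hβ : Van Q 2 (fun x => β x - rot J α x.1 x.2.1)) (hβ1 : Van Q 1 β) :
    Van Q 1 (fun x => (equivMap J a β x).1 - (rotAct J α x).1) ∧
      Van Q 2 (fun x => (equivMap J a β x).2 - (rotAct J α x).2) := by
  refine ⟨ha.congr_fun fun x => by simp [equivMap, mapOf], ?_⟩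
  have h1 := ((van_intertwiner_sub_id hQ hJ hJ2 ha).clm_apply hβ1).add hβ
  refine (h1.prodMk (van_zero (V := ℝ))).congr_fun fun x => ?_
  simp [equivMap, mapOf, rotAct]

variable (Q J) in
/-- The approximate conjugacy `(Tq, Tb)` of `(Fq, Fb)` to an equivariant map, up to order `n`. -/
structure NormalForm (α : ℝ) (Fq Fb : E × (E × ℝ) → E) (n : ℕ)
    (Tq Tb a β : E × (E × ℝ) → E) : Prop where
  van_Tq : Van Q 3 (fun x => Tq x - (x.1 - x.2.2 • J x.1 x.2.1))
  van_Tb : Van Q 2 (fun x => Tb x - x.2.1)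
  van_a : Van Q 1 a
  van_β : Van Q 2 (fun x => β x - rot J α x.1 x.2.1)
  inv_a : ∀ x : E × (E × ℝ), x.1 ∈ Q → ∀ θ, a (rotAct J θ x) = a x
  equiv_β : ∀ x : E × (E × ℝ), x.1 ∈ Q → ∀ θ, β (rotAct J θ x) = rot J θ x.1 (β x)
  -- The base error stays one order ahead: a fibre correction of order `n` disturbs it only at order
  -- `n + 1`, and the next base correction then has order `n + 1`.
  van_q : Van Q (n + 1) (fun x => Fq (mapOf Tq Tb x) - Tq (equivMap J a β x))
  van_b : Van Q n (fun x => Fb (mapOf Tq Tb x) - Tb (equivMap J a β x))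

variable {α : ℝ} {Fq Fb : E × (E × ℝ) → E} {n : ℕ} {Tq Tb a β : E × (E × ℝ) → E}

theorem van_rot_b (hQ : IsOpen Q) (hJ : ContDiffOn ℝ ∞ J Q) (α : ℝ) :
    Van Q 1 (fun x : E × (E × ℝ) => rot J α x.1 x.2.1) :=
  ((van_rot hQ hJ α).clm_apply (van_b Q)).mono (by omega)

theorem van_h_smul_J (hQ : IsOpen Q) (hJ : ContDiffOn ℝ ∞ J Q) :
    Van Q 2 (fun x : E × (E × ℝ) => x.2.2 • J x.1 x.2.1) :=
  ((van_h Q).smul ((van_of_contDiffOn hQ hJ).clm_apply (van_b Q))).mono (by omega)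

namespace NormalForm

theorem van_Tq_sub (h : NormalForm Q J α Fq Fb n Tq Tb a β) (hQ : IsOpen Q)
    (hJ : ContDiffOn ℝ ∞ J Q) : Van Q 2 (fun x => Tq x - x.1) :=
  ((h.van_Tq.mono (by omega : 2 ≤ 3)).sub (van_h_smul_J hQ hJ)).congr_fun fun x => by abel

theorem van_Tb_one (h : NormalForm Q J α Fq Fb n Tq Tb a β) : Van Q 1 Tb :=
  ((h.van_Tb.mono (by omega)).add (_root_.van_b Q)).congr_fun fun x => by abel

theorem van_β_one (h : NormalForm Q J α Fq Fb n Tq Tb a β) (hQ : IsOpen Q)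
    (hJ : ContDiffOn ℝ ∞ J Q) : Van Q 1 β :=
  ((h.van_β.mono (by omega)).add (van_rot_b hQ hJ α)).congr_fun fun x => by abel

theorem fixZ_T (h : NormalForm Q J α Fq Fb n Tq Tb a β) (hQ : IsOpen Q)
    (hJ : ContDiffOn ℝ ∞ J Q) : FixZ Q (mapOf Tq Tb) :=
  fixZ_mapOf ((h.van_Tq_sub hQ hJ).mono (by omega)) h.van_Tb_one

theorem fixZ_G (h : NormalForm Q J α Fq Fb n Tq Tb a β) (hQ : IsOpen Q)
    (hJ : ContDiffOn ℝ ∞ J Q) : FixZ Q (equivMap J a β) :=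
  fixZ_equivMap hQ hJ h.van_a (h.van_β_one hQ hJ)

/-- Let `p` be the leading part of the fibre error. Adding `τ` to `Tb` and `γ` to `β` changes the
error, modulo order `n + 1`, into
$p-\gamma-(\tau\circ\mathrm{rotAct}_\alpha-\mathrm{rot}_\alpha\tau)$, which the homological equation
makes zero. The part that cannot be removed is equivariant and is absorbed in `β`. The base error is
safe because `Fq` and `Tq` feel these changes only through terms of order two. -/
theorem exists_improve_fibre (h : NormalForm Q J α Fq Fb n Tq Tb a β) (hn : 2 ≤ n) (hQ : IsOpen Q)
    (hJ : ContDiffOn ℝ ∞ J Q) (hJ2 : ∀ q ∈ Q, ∀ u, J q (J q u) = -u)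
    (hα : Irrational (α / (2 * Real.pi))) {X₁ : E → E}
    (hFq : Van Q 2 (fun x => Fq x - (x.1 + x.2.2 • X₁ x.1)))
    (hFb : Van Q 2 (fun x => Fb x - rot J α x.1 x.2.1)) :
    ∃ Tb' β', NormalForm Q J α Fq Fb n Tq Tb' a β' ∧
      Van Q (n + 1) (fun x => Fb (mapOf Tq Tb' x) - Tb' (equivMap J a β' x)) := by
  obtain ⟨p, hp, hrp⟩ := h.van_b.exists_hom hQ
  have hpn := hp.van hQ
  obtain ⟨τ₀, γ, hτ₀, hγ, hγinv, hsol⟩ := exists_homological_solution hQ hJ hJ2 hα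
    -- With this twist, invariance of `γ` means equivariance of a fibre-valued map.
    (M := fun θ q => rot J (-θ) q) (fun θ => contDiffOn_rot hJ _)
    (fun q hq θ φ v => by rw [neg_add, rot_add (hJ2 q hq)]) (fun q _ v => by simp)
    (fun q _ n f hf => by
      have h1 := (trigSpan E (n + 1)).add_mem (cos_smul_mem_trigSpan hf)
        (sin_smul_mem_trigSpan (clm_comp_mem_trigSpan (-(J q)) hf))
      convert h1 using 1
      ext1 θ
      simp [rot_apply]) hp
  replace hτ₀ := hτ₀ n hpn
  replace hγ := hγ n hpn
  have hτ : Van Q n (fun x => rot J (-α) x.1 (τ₀ x)) :=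
    ((van_rot hQ hJ _).clm_apply hτ₀).mono (by omega)
  -- Rotating by $-\alpha$ turns the twisted difference for `τ₀` into
  -- $\tau\circ\mathrm{rotAct}_\alpha-\mathrm{rot}_\alpha\tau$.
  set τ : E × (E × ℝ) → E := fun x => rot J (-α) x.1 (τ₀ x) with hτdef
  have hsol' : ∀ x : E × (E × ℝ), x.1 ∈ Q →
      τ (rotAct J α x) - rot J α x.1 (τ x) = p x - γ x := fun x hx => by
    rw [← hsol x hx, hτdef]
    simp only [rotAct_fst, rot_rot_neg (hJ2 _ hx)]
  have hTb' : Van Q 2 (fun x => Tb x + τ x - x.2.1) :=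
    (h.van_Tb.add (hτ.mono hn)).congr_fun fun x => by abel
  have hβ' : Van Q 2 (fun x => β x + γ x - rot J α x.1 x.2.1) :=
    (h.van_β.add (hγ.mono hn)).congr_fun fun x => by abel
  have hTq1 : Van Q 1 (fun x => Tq x - x.1) := (h.van_Tq_sub hQ hJ).mono (by omega)
  have hT := h.fixZ_T hQ hJ
  have hG := h.fixZ_G hQ hJ
  have hβ1 : Van Q 1 (fun x => β x + γ x) := (h.van_β_one hQ hJ).add (hγ.mono (by omega))
  have hT' : FixZ Q (mapOf Tq (fun x => Tb x + τ x)) :=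
    fixZ_mapOf hTq1 (h.van_Tb_one.add (hτ.mono (by omega)))
  have hG' : FixZ Q (equivMap J a (fun x => β x + γ x)) := fixZ_equivMap hQ hJ h.van_a hβ1
  have hTT : Van Q n (fun x => mapOf Tq (fun x => Tb x + τ x) x - mapOf Tq Tb x) :=
    van_mapOf_sub (van_zero.congr_fun fun x => sub_self _) (hτ.congr_fun fun x => by abel)
  have hGb := van_equivMap_add_fibre (β := β) hQ hJ hJ2 h.van_a hγ
  have hGG : Van Q n (fun x => equivMap J a (fun x => β x + γ x) x - equivMap J a β x) :=
    van_mapOf_sub (van_zero.congr_fun fun x => sub_self _)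
      ((hGb.succ_le.add hγ).congr_fun fun x => by simp [equivMap, mapOf])
  have hFqd := hFq.sub_comp_of_two hQ hT hT' hTT
  have hFbd := hFb.sub_comp_of_two hQ hT hT' hTT
  have hTqd := (h.van_Tq_sub hQ hJ).sub_comp_of_two hQ hG hG' hGG
  have hTbd := h.van_Tb.sub_comp_of_two hQ hG hG' hGG
  obtain ⟨hU1, hU2⟩ := van_equivMap_sub_rotAct hQ hJ hJ2 h.van_a hβ' hβ1
  have hτd := Van.sub_comp_of_snd_two hQ (fixZ_rotAct hQ hJ α) hG' hU1 hU2 hτ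
  have hrot : Van Q (n + 1) (fun x => (rot J α (Tq x) - rot J α x.1) (τ x)) :=
    ((van_comp_fst_sub hQ (contDiffOn_rot hJ α) (van_sub_self_fst Q) hTq1 hTq1).clm_apply
      hτ).mono (by omega)
  have hb : Van Q (n + 1) (fun x => Fb (mapOf Tq (fun x => Tb x + τ x) x) -
      (Tb (equivMap J a (fun x => β x + γ x) x) +
        τ (equivMap J a (fun x => β x + γ x) x))) := by
    refine (((((hrp.add hFbd).sub hTbd).sub hτd).add hrot).sub hGb).congr fun q hq => ?_
    have hq' : ∀ᶠ x in 𝓝 (q, (0 : E × ℝ)), x.1 ∈ Q := continuousAt_fst.eventually (hQ.mem_nhds hq)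
    filter_upwards [hq'] with x hx
    have e := hsol' x hx
    rw [sub_eq_iff_eq_add] at e
    rw [e]
    simp only [mapOf, map_add, sub_apply]
    abel
  refine ⟨fun x => Tb x + τ x, fun x => β x + γ x, ⟨h.van_Tq, hTb', h.van_a, hβ', h.inv_a, ?_,
    ?_, hb.succ_le⟩, hb⟩
  · intro x hx θ
    rw [map_add, ← h.equiv_β x hx, ← hγinv x hx θ, rot_rot_neg (hJ2 _ hx)]
  · refine ((h.van_q.add hFqd).sub hTqd).congr_fun fun x => ?_
    simp only [mapOf, equivMap]
    abel

/-- The same scheme without a twist: the invariant part `γ` joins the displacement `a`. The fibre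
error, already of order `n + 1`, changes only at order `n + 2`; it contains the change of `rot J α`
and of the intertwiner with the base point, which are multiplied by `Tb` or `β`, of order one. -/
theorem exists_improve_base (h : NormalForm Q J α Fq Fb n Tq Tb a β) (hn : 2 ≤ n)
    (hb : Van Q (n + 1) (fun x => Fb (mapOf Tq Tb x) - Tb (equivMap J a β x))) (hQ : IsOpen Q)
    (hJ : ContDiffOn ℝ ∞ J Q) (hJ2 : ∀ q ∈ Q, ∀ u, J q (J q u) = -u)
    (hα : Irrational (α / (2 * Real.pi))) {X₁ : E → E} (hX : ContDiffOn ℝ ∞ X₁ Q)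
    (hFq : Van Q 2 (fun x => Fq x - (x.1 + x.2.2 • X₁ x.1)))
    (hFb : Van Q 2 (fun x => Fb x - rot J α x.1 x.2.1)) :
    ∃ Tq' a', NormalForm Q J α Fq Fb (n + 1) Tq' Tb a' β := by
  obtain ⟨p, hp, hrp⟩ := h.van_q.exists_hom hQ
  have hpn := hp.van hQ
  obtain ⟨τ, γ, hτ, hγ, hγinv, hsol⟩ := exists_homological_solution hQ hJ hJ2 hα
    (M := fun _ _ => ContinuousLinearMap.id ℝ E) (fun θ => contDiffOn_const)
    (fun q hq θ φ v => rfl) (fun q _ v => rfl)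
    (fun q _ n f hf => trigSpan_mono (Nat.le_succ n) hf) hp
  replace hτ := hτ _ hpn
  replace hγ := hγ _ hpn
  simp only [ContinuousLinearMap.id_apply] at hγinv hsol
  have hTq' : Van Q 3 (fun x => Tq x + τ x - (x.1 - x.2.2 • J x.1 x.2.1)) :=
    (h.van_Tq.add (hτ.mono (by omega))).congr_fun fun x => by abel
  have ha' : Van Q 1 (fun x => a x + γ x) := h.van_a.add (hγ.mono (by omega))
  have hTq1 : Van Q 1 (fun x => Tq x - x.1) := (h.van_Tq_sub hQ hJ).mono (by omega)
  have hTq1' : Van Q 1 (fun x => Tq x + τ x - x.1) :=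
    (hTq1.add (hτ.mono (by omega))).congr_fun fun x => by abel
  have hT := h.fixZ_T hQ hJ
  have hG := h.fixZ_G hQ hJ
  have hβ1 := h.van_β_one hQ hJ
  have hT' : FixZ Q (mapOf (fun x => Tq x + τ x) Tb) := fixZ_mapOf hTq1' h.van_Tb_one
  have hG' : FixZ Q (equivMap J (fun x => a x + γ x) β) := fixZ_equivMap hQ hJ ha' hβ1
  have hττ : Van Q (n + 1) (fun x => Tq x + τ x - Tq x) := hτ.congr_fun fun x => by abel
  have hTT : Van Q (n + 1) (fun x => mapOf (fun x => Tq x + τ x) Tb x - mapOf Tq Tb x) :=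
    van_mapOf_sub hττ (van_zero.congr_fun fun x => sub_self _)
  have hGb := van_equivMap_add_base hQ hJ h.van_a hβ1 hγ
  have hGG : Van Q (n + 1) (fun x => equivMap J (fun x => a x + γ x) β x - equivMap J a β x) :=
    van_mapOf_sub (hγ.congr_fun fun x => by module) hGb.succ_le
  have hFqd := hFq.sub_comp_of_two hQ hT hT' hTT
  have hFbd := hFb.sub_comp_of_two hQ hT hT' hTT
  have hTqd := (h.van_Tq_sub hQ hJ).sub_comp_of_two hQ hG hG' hGG
  have hTbd := h.van_Tb.sub_comp_of_two hQ hG hG' hGG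
  obtain ⟨hU1, hU2⟩ := van_equivMap_sub_rotAct hQ hJ hJ2 ha' h.van_β hβ1
  have hτd := Van.sub_comp_of_snd_two hQ (fixZ_rotAct hQ hJ α) hG' hU1 hU2 hτ
  have hX' : Van Q (n + 2) (fun x => x.2.2 • (X₁ (Tq x + τ x) - X₁ (Tq x))) :=
    ((van_h Q).smul (van_comp_fst_sub hQ hX hTq1 hTq1' hττ)).mono (by omega)
  have hrot : Van Q (n + 2) (fun x => (rot J α (Tq x + τ x) - rot J α (Tq x)) (Tb x)) :=
    ((van_comp_fst_sub hQ (contDiffOn_rot hJ α) hTq1 hTq1' hττ).clm_apply h.van_Tb_one).mono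
      (by omega)
  refine ⟨fun x => Tq x + τ x, fun x => a x + γ x, hTq', h.van_Tb, ha', h.van_β, ?_, h.equiv_β,
    ?_, ?_⟩
  · intro x hx θ
    rw [h.inv_a x hx, hγinv x hx]
  · refine ((((hrp.add hFqd).sub hTqd).sub hτd).add hX').congr fun q hq => ?_
    have hq' : ∀ᶠ x in 𝓝 (q, (0 : E × ℝ)), x.1 ∈ Q := continuousAt_fst.eventually (hQ.mem_nhds hq)
    filter_upwards [hq'] with x hx
    have e := hsol x hx
    rw [sub_eq_iff_eq_add] at e
    rw [e, smul_sub]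
    simp only [mapOf, equivMap]
    abel
  · refine ((((hb.add hFbd.succ_le).sub hTbd.succ_le).add hrot.succ_le).sub
      hGb.succ_le).congr_fun fun x => ?_
    simp only [mapOf, equivMap, sub_apply]
    abel

end NormalForm

/-- Existence of the equivariant normal form to every order. -/
theorem exists_normalForm (hQ : IsOpen Q) (hJ : ContDiffOn ℝ ∞ J Q)
    (hJ2 : ∀ q ∈ Q, ∀ u, J q (J q u) = -u) (hα : Irrational (α / (2 * Real.pi)))
    {X₁ X₂ : E → E} (hX : ContDiffOn ℝ ∞ X₁ Q) (hX2 : ContDiffOn ℝ ∞ X₂ Q)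
    (hFq : Van Q 3 (fun x => Fq x - (x.1 + x.2.2 • X₁ x.1 + x.2.2 ^ 2 • X₂ x.1 +
      x.2.2 • (J x.1 x.2.1 - J x.1 (rot J α x.1 x.2.1)))))
    (hFb : Van Q 2 (fun x => Fb x - rot J α x.1 x.2.1)) (n : ℕ) :
    ∃ Tq Tb a β, NormalForm Q J α Fq Fb (n + 2) Tq Tb a β := by
  have hJb := van_of_contDiffOn (Y := E × ℝ) hQ hJ
  have hh : Van Q 2 (fun x : E × (E × ℝ) => x.2.2 ^ 2) :=
    ((van_h Q).smul (van_h Q)).congr_fun fun x => by simp [sq]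
  have hX2' : Van Q 2 (fun x : E × (E × ℝ) => x.2.2 ^ 2 • X₂ x.1) :=
    hh.smul (van_of_contDiffOn hQ hX2)
  have hX1' : Van Q 1 (fun x : E × (E × ℝ) => x.2.2 • X₁ x.1) :=
    (van_h Q).smul (van_of_contDiffOn hQ hX)
  have hJR : Van Q 2 (fun x : E × (E × ℝ) => x.2.2 • (J x.1 x.2.1 -
      J x.1 (rot J α x.1 x.2.1))) :=
    ((van_h Q).smul ((hJb.clm_apply (van_b Q)).sub (hJb.clm_apply (van_rot_b hQ hJ α)))).mono
      (by omega)
  have hFq2 : Van Q 2 (fun x => Fq x - (x.1 + x.2.2 • X₁ x.1)) :=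
    (((hFq.mono (by omega : 2 ≤ 3)).add hX2').add hJR).congr_fun fun x => by abel
  induction n with
  | succ n ih =>
    obtain ⟨Tq, Tb, a, β, h⟩ := ih
    obtain ⟨Tb', β', h', hb⟩ := h.exists_improve_fibre (by omega) hQ hJ hJ2 hα hFq2 hFb
    obtain ⟨Tq', a', h''⟩ := h'.exists_improve_base (by omega) hb hQ hJ hJ2 hα hX hFq2 hFb
    exact ⟨Tq', Tb', a', β', h''⟩
  | zero =>
    -- The term $h(Jb-J\,\mathrm{rot}_\alpha b)$ of `Fq` is a coboundary: $-hJb$ in $T$ cancels its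
    -- first half, and $T\circ G$ reproduces the second half.
    set Tq : E × (E × ℝ) → E := fun x => x.1 - x.2.2 • J x.1 x.2.1 with hTq
    set a : E × (E × ℝ) → E := fun x => x.2.2 • X₁ x.1 + x.2.2 ^ 2 • X₂ x.1 with ha
    set β : E × (E × ℝ) → E := fun x => rot J α x.1 x.2.1 with hβ
    have hTq2 : Van Q 2 (fun x => Tq x - x.1) :=
      (van_h_smul_J hQ hJ).neg.congr_fun fun x => by simp only [hTq]; module
    have hTq1 := hTq2.mono (by omega : 1 ≤ 2)
    have ha1 : Van Q 1 a := hX1'.add (hX2'.mono (by omega))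
    have hβ1 : Van Q 1 β := van_rot_b hQ hJ α
    have hT : FixZ Q (mapOf Tq (fun x => x.2.1)) := fixZ_mapOf hTq1 (van_b Q)
    have hG : FixZ Q (equivMap J a β) := fixZ_equivMap hQ hJ ha1 hβ1
    obtain ⟨hU1, hU2⟩ := van_equivMap_sub_rotAct (α := α) hQ hJ hJ2 ha1
      (van_zero.congr_fun fun x => sub_self _) hβ1
    refine ⟨Tq, fun x => x.2.1, a, β, van_zero.congr_fun fun x => sub_self _,
      van_zero.congr_fun fun x => sub_self _, ha1, van_zero.congr_fun fun x => sub_self _,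
      fun x _ θ => rfl, fun x hx θ => rot_comm (hJ2 _ hx) _ _ _, ?_, ?_⟩
    · have e1 := hFq.comp hQ hT
      have e2 : Van Q 3 (fun x => x.2.2 • (X₁ (Tq x) - X₁ x.1)) :=
        ((van_h Q).smul (van_comp_fst_sub hQ hX (van_sub_self_fst Q) hTq1 hTq2)).mono (by omega)
      have e3 : Van Q 3 (fun x => x.2.2 ^ 2 • (X₂ (Tq x) - X₂ x.1)) :=
        (hh.smul (van_comp_fst_sub hQ hX2 (van_sub_self_fst Q) hTq1 hTq2)).mono (by omega)
      have e4 : Van Q 3 (fun x => x.2.2 • ((J (Tq x) - J x.1) x.2.1)) :=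
        ((van_h Q).smul ((van_comp_fst_sub hQ hJ (van_sub_self_fst Q) hTq1 hTq2).clm_apply
          (van_b Q))).mono (by omega)
      have e5 : Van Q 3 (fun x => x.2.2 • ((J (Tq x) - J x.1) (rot J α (Tq x) x.2.1))) :=
        ((van_h Q).smul ((van_comp_fst_sub hQ hJ (van_sub_self_fst Q) hTq1 hTq2).clm_apply
          ((van_comp_fst hQ (contDiffOn_rot hJ α) hTq1).clm_apply (van_b Q)))).mono (by omega)
      have e6 : Van Q 3 (fun x => x.2.2 • (J x.1 ((rot J α (Tq x) - rot J α x.1) x.2.1))) :=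
        ((van_h Q).smul (hJb.clm_apply ((van_comp_fst_sub hQ (contDiffOn_rot hJ α)
          (van_sub_self_fst Q) hTq1 hTq2).clm_apply (van_b Q)))).mono (by omega)
      have e7 : Van Q 3 (fun x => x.2.2 • ((J (x.1 + a x) - J x.1) (equivMap J a β x).2.1)) :=
        ((van_h Q).smul ((van_comp_fst_sub hQ hJ (van_sub_self_fst Q) (van_add_fst ha1)
          (van_add_fst ha1)).clm_apply (hG.van_snd hQ).fst)).mono (by omega)
      have e8 : Van Q 3 (fun x => x.2.2 • J x.1 ((equivMap J a β x).2.1 - rot J α x.1 x.2.1)) :=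
        ((van_h Q).smul (hJb.clm_apply hU2.fst)).mono (by omega)
      refine (((((((e1.add e2).add e3).add e4).sub e5).sub e6).add e7).add e8).congr_fun
        fun x => ?_
      have h1 : (equivMap J a β x).1 = x.1 + a x := rfl
      have h2 : (equivMap J a β x).2.2 = x.2.2 := rfl
      simp only [mapOf, hTq, h1, h2, sub_apply, map_sub, smul_sub]
      simp only [ha]
      abel
    · have e1 := hFb.comp hQ hT
      have e2 : Van Q 2 (fun x => (rot J α (Tq x) - rot J α x.1) x.2.1) :=
        ((van_comp_fst_sub hQ (contDiffOn_rot hJ α)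
          (van_sub_self_fst Q) hTq1 hTq2).clm_apply (van_b Q)).mono (by omega)
      refine ((e1.add e2).sub hU2.fst).congr_fun fun x => ?_
      simp only [mapOf, sub_apply, rotAct, Prod.fst_sub]
      abel

end NormalForm

/-! ### Approximate inverses and the action integral -/

section Inverse

variable {X Y : Type*} [NormedAddCommGroup X] [NormedSpace ℝ X] [CompleteSpace X]
  [NormedAddCommGroup Y] [NormedSpace ℝ Y] [FiniteDimensional ℝ Y] {Q : Set X}

/-- Bootstrap: if `v - u` has order `k`, then `T - id`, being of order two, changes by order `k +
1`; subtracting it from the difference of the values of `T` raises the order of `v - u`. -/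
theorem Van.of_map_sub (hQ : IsOpen Q) {T : X × Y → X × Y} (hT : Van Q 2 (fun x => T x - x))
    {u v : X × Y → X × Y} (hu : FixZ Q u) (hv : FixZ Q v) {n : ℕ}
    (h : Van Q n (fun x => T (v x) - T (u x))) : Van Q n (fun x => v x - u x) := by
  have : CompleteSpace Y := FiniteDimensional.complete ℝ Y
  have key : ∀ k ≤ n, Van Q k (fun x => v x - u x) := by
    intro k
    induction k with
    | zero => exact fun _ => hv.1.sub hu.1
    | succ k ih =>
      intro hk
      have h1 := hT.sub_comp_of_two hQ hu hv (ih (by omega))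
      exact ((h.mono hk).sub h1).congr_fun fun x => by abel
  exact key n le_rfl

/-- Iterating $S\mapsto S-(T\circ S-\mathrm{id})$: each step gains one order because $T-\mathrm{id}$
has order two. -/
theorem exists_approx_inverse (hQ : IsOpen Q) {T : X × Y → X × Y}
    (hT : Van Q 2 (fun x => T x - x)) (n : ℕ) :
    ∃ S : X × Y → X × Y, FixZ Q S ∧ Van Q 2 (fun x => S x - x) ∧
      Van Q (n + 2) (fun x => T (S x) - x) := by
  have : CompleteSpace Y := FiniteDimensional.complete ℝ Y
  induction n with
  | zero => exact ⟨fun x => x, fixZ_id Q, van_zero.congr_fun fun x => sub_self x, hT⟩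
  | succ n ih =>
    obtain ⟨S, hS, hS2, hTS⟩ := ih
    have hS' : FixZ Q (fun x => S x - (T (S x) - x)) := by
      refine hS.of_van_sub ((hTS.neg.mono (by omega)).congr_fun fun x => by abel)
    refine ⟨fun x => S x - (T (S x) - x), hS',
      (hS2.sub (hTS.mono (by omega))).congr_fun fun x => sub_right_comm _ _ _, ?_⟩
    have h1 := hT.sub_comp_of_two hQ hS hS' (n := n + 2) (hTS.neg.congr_fun fun x => by module)
    exact h1.congr_fun fun x => by module

end Inverse

/-! ### The action over circle orbits: invariance and leading term. -/

section Action

variable {E : Type*} [NormedAddCommGroup E] [NormedSpace ℝ E] [FiniteDimensional ℝ E]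
  {W : Type*} [NormedAddCommGroup W] [NormedSpace ℝ W]
  {Q : Set E} {J : E → E →L[ℝ] E}

/-- The Hadamard factor and the derivative at the base point agree on the zero section, so replacing
one by the other gains one order. -/
theorem van_comp_fst_taylor [CompleteSpace W] (hQ : IsOpen Q) {c : E → W}
    (hc : ContDiffOn ℝ ∞ c Q) {f : E × (E × ℝ) → E} {n : ℕ}
    (hf : Van Q (n + 1) (fun x => f x - x.1)) :
    Van Q (n + 2) (fun x => c (f x) - c x.1 - fderiv ℝ c x.1 (f x - x.1)) := by
  have hf1 : Van Q 1 (fun x => f x - x.1) := hf.mono (by omega)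
  obtain ⟨M, hM, hMd, hM'⟩ := (van_of_contDiffOn (Y := E × ℝ) hQ hc).exists_sub_eq
    (fixZ_shiftFst (van_sub_self_fst Q)) (fixZ_shiftFst hf1)
  have hdc : ContDiffOn ℝ ∞ (fderiv ℝ c) Q := hc.fderiv_of_isOpen hQ (by simp)
  have hM0 : Van Q 0 (fun x => (M x).comp (ContinuousLinearMap.inl ℝ E (E × ℝ))) :=
    Van.clm_comp (n := 0) hM (fun _ _ => contDiffAt_const)
  have h1 : Van Q 1 (fun x => (M x).comp (ContinuousLinearMap.inl ℝ E (E × ℝ)) -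
      fderiv ℝ c x.1) := by
    refine (hM0.sub (van_of_contDiffOn hQ hdc)).of_eq_zero (fun q hq => ?_) hQ
    have hd : HasFDerivAt (fun x : E × (E × ℝ) => c x.1)
        ((fderiv ℝ c q).comp (ContinuousLinearMap.fst ℝ E (E × ℝ))) (q, 0) := by
      have h2 := ((hc.contDiffAt (hQ.mem_nhds hq)).differentiableAt (by simp)).hasFDerivAt
      exact HasFDerivAt.comp (g := c) (f := Prod.fst) (q, (0 : E × ℝ)) h2 hasFDerivAt_fst
    simp only [hMd q hq, hd.fderiv]
    ext u
    simp
  refine ((h1.clm_apply hf).mono (by omega)).congr fun q hq => ?_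
  filter_upwards [hM' q hq] with x hx
  have h2 : ((f x, x.2) : E × (E × ℝ)) - (x.1, x.2) = (f x - x.1, 0) :=
    Prod.ext rfl (sub_self _)
  rw [hx, sub_apply, h2]
  rfl

/-- The one-form `ϑ_q + h g_q(b + h X(q), ·)`. -/
noncomputable def actionForm (ϑ : E → E →L[ℝ] ℝ) (gm : E → E →L[ℝ] E →L[ℝ] ℝ) (X₁ : E → E)
    (x : E × (E × ℝ)) : E →L[ℝ] ℝ :=
  ϑ x.1 + x.2.2 • gm x.1 (x.2.1 + x.2.2 • X₁ x.1)

variable {ϑ : E → E →L[ℝ] ℝ} {gm : E → E →L[ℝ] E →L[ℝ] ℝ} {X₁ : E → E}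

theorem van_actionForm (hQ : IsOpen Q) (hϑ : ContDiffOn ℝ ∞ ϑ Q) (hg : ContDiffOn ℝ ∞ gm Q)
    (hX : ContDiffOn ℝ ∞ X₁ Q) : Van Q 0 (actionForm ϑ gm X₁) := by
  have h1 : Van Q 0 (fun x : E × (E × ℝ) => x.2.1 + x.2.2 • X₁ x.1) :=
    (van_b Q).smooth.add (((van_h Q).smul (van_of_contDiffOn hQ hX)).smooth)
  exact (van_of_contDiffOn hQ hϑ).add
    ((van_h Q).smul ((van_of_contDiffOn hQ hg).clm_apply h1)).smooth

theorem fderiv_rotGen_eq {V : Type*} [NormedAddCommGroup V] [NormedSpace ℝ V]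
    {f : E × (E × ℝ) → V} {x : E × (E × ℝ)} (hJ2 : ∀ u, J x.1 (J x.1 u) = -u)
    (hf : DifferentiableAt ℝ f x) {f' : V}
    (h : HasDerivAt (fun θ => f (rotAct J θ x)) f' 0) : fderiv ℝ f x (rotGen J x) = f' := by
  have h1 := hasDerivAt_rotAct hJ2 0
  rw [rotAct_zero] at h1
  have h2 : HasFDerivAt f (fderiv ℝ f x) (rotAct J 0 x) := by
    rw [rotAct_zero]
    exact hf.hasFDerivAt
  exact (h2.comp_hasDerivAt (0 : ℝ) h1).unique h

theorem hasDerivAt_comp_rotAct {V : Type*} [NormedAddCommGroup V] [NormedSpace ℝ V]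
    {f : E × (E × ℝ) → V} {x : E × (E × ℝ)} (hJ2 : ∀ u, J x.1 (J x.1 u) = -u)
    (hf : DifferentiableAt ℝ f x) :
    HasDerivAt (fun θ => f (rotAct J θ x)) (fderiv ℝ f x (rotGen J x)) 0 := by
  have h1 := hasDerivAt_rotAct hJ2 0
  rw [rotAct_zero] at h1
  have h2 : HasFDerivAt f (fderiv ℝ f x) (rotAct J 0 x) := by
    rw [rotAct_zero]
    exact hf.hasFDerivAt
  exact h2.comp_hasDerivAt (0 : ℝ) h1

theorem hasDerivAt_rot_zero (q u : E) : HasDerivAt (fun θ => rot J θ q u) (J q u) 0 := by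
  have h : HasDerivAt (fun θ => rot J θ q u)
      ((-Real.sin 0) • u + Real.cos 0 • J q u) 0 :=
    ((Real.hasDerivAt_cos 0).smul_const _).add ((Real.hasDerivAt_sin 0).smul_const _)
  simpa using h

theorem gm_rot {q : E} (hJ2 : ∀ u, J q (J q u) = -u)
    (hgJ : ∀ u w, gm q (J q u) (J q w) = gm q u w) (θ : ℝ) (u : E) :
    gm q (rot J θ q u) (rot J θ q u) = gm q u u := by
  -- Since $J^2=-1$, this gives $g(u,Ju)=-g(Ju,u)$, so the mixed terms in the rotated square cancel.
  have h1 := hgJ u (J q u)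
  rw [hJ2, map_neg] at h1
  simp only [rot_apply, map_add, map_smul, add_apply, smul_apply, hgJ,
    smul_eq_mul, ← h1]
  linear_combination gm q u u * Real.sin_sq_add_cos_sq θ

/-- The integrand of the action over the orbits of the circle action, pushed forward by
`(Tq, Tb)`. -/
noncomputable def actionDensity (J : E → E →L[ℝ] E) (ϑ : E → E →L[ℝ] ℝ)
    (gm : E → E →L[ℝ] E →L[ℝ] ℝ) (X₁ : E → E) (Tq Tb : E × (E × ℝ) → E) (x : E × (E × ℝ)) : ℝ :=
  actionForm ϑ gm X₁ (mapOf Tq Tb x) (fderiv ℝ Tq x (rotGen J x))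

variable {α : ℝ} {Fq Fb : E × (E × ℝ) → E} {n : ℕ} {Tq Tb a β : E × (E × ℝ) → E}

theorem equivMap_rotAct {x : E × (E × ℝ)} (hJ2 : ∀ q ∈ Q, ∀ u, J q (J q u) = -u) (hx : x.1 ∈ Q)
    (hxa : x.1 + a x ∈ Q) (ha : ∀ θ, a (rotAct J θ x) = a x)
    (hβ : ∀ θ, β (rotAct J θ x) = rot J θ x.1 (β x)) (θ : ℝ) :
    equivMap J a β (rotAct J θ x) = rotAct J θ (equivMap J a β x) := by
  simp only [equivMap, mapOf, rotAct_fst, ha, hβ, intertwiner_rot (hJ2 _ hx) (hJ2 _ hxa)]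
  rfl

/-- `G` carries the generator of the circle action to itself, so the density at `G x` is $\Theta$ on
the velocity of $T\circ G$ along the orbit of `x`. Replacing $T\circ G$ by $F\circ T$ costs order
`n`, and exact symplecticity of $F$ then turns the difference into the derivative of $\sigma\circ T$
along the orbit. The velocity is admissible because $T$ preserves $h$. -/
theorem van_actionDensity_comp_sub (h : NormalForm Q J α Fq Fb n Tq Tb a β) (hQ : IsOpen Q)
    (hJ : ContDiffOn ℝ ∞ J Q) (hJ2 : ∀ q ∈ Q, ∀ u, J q (J q u) = -u)
    (hF : FixZ Q (mapOf Fq Fb))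
    (hϑ : ContDiffOn ℝ ∞ ϑ Q) (hg : ContDiffOn ℝ ∞ gm Q) (hX : ContDiffOn ℝ ∞ X₁ Q)
    {σ : E × (E × ℝ) → ℝ} (hσ : Van Q 0 σ)
    (hsymp : ∀ q ∈ Q, ∀ᶠ x in 𝓝 (q, (0 : E × ℝ)), ∀ v : E × (E × ℝ), v.2.2 = 0 →
      actionForm ϑ gm X₁ (mapOf Fq Fb x) (fderiv ℝ Fq x v) - actionForm ϑ gm X₁ x v.1 =
        fderiv ℝ σ x v) :
    Van Q n (fun x => actionDensity J ϑ gm X₁ Tq Tb (equivMap J a β x) -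
      actionDensity J ϑ gm X₁ Tq Tb x -
      fderiv ℝ (fun x => σ (mapOf Tq Tb x)) x (rotGen J x)) := by
  have hT := h.fixZ_T hQ hJ
  have hG := h.fixZ_G hQ hJ
  have hTqs : Van Q 0 Tq := hT.1.fst
  have hFqs : Van Q 0 Fq := hF.1.fst
  have hΘ := van_actionForm hQ hϑ hg hX
  have hgen := van_rotGen hQ hJ
  have hFT := hF.comp hQ hT
  have hTG := hT.comp hQ hG
  have hTGq : Van Q 0 (fun x => Tq (equivMap J a β x)) := hTqs.comp hQ hG
  have hFTq : Van Q 0 (fun x => Fq (mapOf Tq Tb x)) := hFqs.comp hQ hT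
  have hdiff : Van Q n (fun x => mapOf Fq Fb (mapOf Tq Tb x) - mapOf Tq Tb (equivMap J a β x)) :=
    (h.van_q.succ_le.prodMk (h.van_b.prodMk (van_zero (V := ℝ)))).congr_fun fun x => by
      simp [mapOf, equivMap]
  -- The cost of that replacement has two parts: `e1` moves the point at which the form is taken,
  -- `e2` changes the velocity on which it acts.
  have e1 : Van Q n (fun x => (actionForm ϑ gm X₁ (mapOf Fq Fb (mapOf Tq Tb x)) -
      actionForm ϑ gm X₁ (mapOf Tq Tb (equivMap J a β x)))
        (fderiv ℝ (fun x => Tq (equivMap J a β x)) x (rotGen J x))) :=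
    ((hΘ.sub_comp hTG hFT hdiff).clm_apply
      (hTGq.fderiv_zero.clm_apply (n := 0) hgen.smooth)).mono (by omega)
  have e2 : Van Q n (fun x => actionForm ϑ gm X₁ (mapOf Fq Fb (mapOf Tq Tb x))
      (fderiv ℝ (fun x => Fq (mapOf Tq Tb x) - Tq (equivMap J a β x)) x (rotGen J x))) :=
    (Van.clm_apply (hΘ.comp hQ hFT)
      (Van.fderiv_apply_tangent hgen.smooth hgen.snd h.van_q.succ_le)).mono (by omega)
  refine (e1.add e2).neg.congr fun q hq => ?_
  have hq' : ∀ᶠ x in 𝓝 (q, (0 : E × ℝ)), x.1 ∈ Q := continuousAt_fst.eventually (hQ.mem_nhds hq)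
  have hGq : ∀ᶠ x in 𝓝 (q, (0 : E × ℝ)), (equivMap J a β x).1 ∈ Q :=
    (hG.tendsto hq).eventually hq'
  filter_upwards [hq', hGq, hG.1.eventually_differentiableAt hq,
    hT.1.eventually_differentiableAt hq,
    (hG.tendsto hq).eventually (hTqs.eventually_differentiableAt hq),
    (hT.tendsto hq).eventually (hFqs.eventually_differentiableAt hq),
    (hT.tendsto hq).eventually (hσ.eventually_differentiableAt hq),
    (hT.tendsto hq).eventually (hsymp q hq),
    hFTq.eventually_differentiableAt hq, hTGq.eventually_differentiableAt hq]
    with x hx hGx dG dT dTG dFT dσ hs dFTq dTGq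
  have hequiv := equivMap_rotAct (J := J) hJ2 hx hGx (h.inv_a x hx) (h.equiv_β x hx)
  have hν : fderiv ℝ (equivMap J a β) x (rotGen J x) = rotGen J (equivMap J a β x) := by
    refine fderiv_rotGen_eq (hJ2 _ hx) dG ?_
    simp only [hequiv]
    have := hasDerivAt_rotAct (hJ2 _ hGx) 0
    rwa [rotAct_zero] at this
  have c1 : fderiv ℝ (fun x => Tq (equivMap J a β x)) x (rotGen J x) =
      fderiv ℝ Tq (equivMap J a β x) (rotGen J (equivMap J a β x)) := by
    have := (dTG.hasFDerivAt.comp x dG.hasFDerivAt).fderiv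
    rw [← hν]
    exact congrArg (fun L => L (rotGen J x)) this
  have c2 : fderiv ℝ (fun x => Fq (mapOf Tq Tb x)) x (rotGen J x) =
      fderiv ℝ Fq (mapOf Tq Tb x) (fderiv ℝ (mapOf Tq Tb) x (rotGen J x)) := by
    have := (dFT.hasFDerivAt.comp x dT.hasFDerivAt).fderiv
    exact congrArg (fun L => L (rotGen J x)) this
  have c3 : fderiv ℝ (fun x => σ (mapOf Tq Tb x)) x (rotGen J x) =
      fderiv ℝ σ (mapOf Tq Tb x) (fderiv ℝ (mapOf Tq Tb) x (rotGen J x)) := by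
    have := (dσ.hasFDerivAt.comp x dT.hasFDerivAt).fderiv
    exact congrArg (fun L => L (rotGen J x)) this
  have c4 : (fderiv ℝ (mapOf Tq Tb) x (rotGen J x)).1 = fderiv ℝ Tq x (rotGen J x) := by
    have := (hasFDerivAt_fst.comp x dT.hasFDerivAt).fderiv
    exact (congrArg (fun L => L (rotGen J x)) this).symm
  have c5 : (fderiv ℝ (mapOf Tq Tb) x (rotGen J x)).2.2 = 0 := by
    have h3 := (hasFDerivAt_snd.comp x (hasFDerivAt_snd.comp x dT.hasFDerivAt)).fderiv
    have h4 : (Prod.snd ∘ Prod.snd ∘ mapOf Tq Tb) = fun x : E × (E × ℝ) => x.2.2 := rfl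
    rw [h4] at h3
    have h5 : HasFDerivAt (fun x : E × (E × ℝ) => x.2.2)
      ((ContinuousLinearMap.snd ℝ E ℝ).comp (ContinuousLinearMap.snd ℝ E (E × ℝ))) x :=
      ((ContinuousLinearMap.snd ℝ E ℝ).comp (ContinuousLinearMap.snd ℝ E (E × ℝ))).hasFDerivAt
    rw [h5.fderiv] at h3
    exact (congrArg (fun L => L (rotGen J x)) h3).symm
  have c6 := hs _ c5
  rw [c4] at c6
  have c7 : fderiv ℝ (fun x => Fq (mapOf Tq Tb x) - Tq (equivMap J a β x)) x (rotGen J x) =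
      fderiv ℝ (fun x => Fq (mapOf Tq Tb x)) x (rotGen J x) -
        fderiv ℝ (fun x => Tq (equivMap J a β x)) x (rotGen J x) := by
    rw [fderiv_fun_sub dFTq dTGq]
    rfl
  rw [c7, c3, ← c6, c2, c1]
  simp only [actionDensity, map_sub, sub_apply]
  ring

/-- The velocity of the orbit is $hb+O(3)$. Hence $h\,g(b,\cdot)$ contributes $h^2g(b,b)$, while
expanding $\vartheta$ at $q-hJb$ contributes $-h^2D\vartheta(Jb)(b)$, whose antisymmetric part is
$-\tfrac12h^2g(b,b)$. Every other term of order at most four is a derivative along the orbit and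
disappears from the mean. -/
theorem van_actionDensity_sub (h : NormalForm Q J α Fq Fb n Tq Tb a β) (hQ : IsOpen Q)
    (hJ : ContDiffOn ℝ ∞ J Q) (hJ2 : ∀ q ∈ Q, ∀ u, J q (J q u) = -u)
    (hϑ : ContDiffOn ℝ ∞ ϑ Q) (hg : ContDiffOn ℝ ∞ gm Q) (hX : ContDiffOn ℝ ∞ X₁ Q)
    (hω : ∀ q ∈ Q, ∀ u, fderiv ℝ ϑ q (J q u) u - fderiv ℝ ϑ q u (J q u) = gm q u u) :
    ∃ m : E × (E × ℝ) → ℝ, Van Q 0 m ∧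
      Van Q 5 (fun x => actionDensity J ϑ gm X₁ Tq Tb x -
        ((1 / 2) * x.2.2 ^ 2 * gm x.1 x.2.1 x.2.1 + fderiv ℝ m x (rotGen J x))) := by
  set t : E × (E × ℝ) → E := fun x => Tq x - (x.1 - x.2.2 • J x.1 x.2.1) with ht
  have ht3 : Van Q 3 t := h.van_Tq
  have hTq2 := h.van_Tq_sub hQ hJ
  have hTq1 : Van Q 1 (fun x => Tq x - x.1) := hTq2.mono (by omega)
  have hgen := van_rotGen hQ hJ
  have hJb : Van Q 1 (fun x : E × (E × ℝ) => J x.1 x.2.1) :=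
    ((van_of_contDiffOn hQ hJ).clm_apply (van_b Q)).mono (by omega)
  have hϑv := van_of_contDiffOn (Y := E × ℝ) hQ hϑ
  have hgv := van_of_contDiffOn (Y := E × ℝ) hQ hg
  have hXv := van_of_contDiffOn (Y := E × ℝ) hQ hX
  have hdϑ : ContDiffOn ℝ ∞ (fderiv ℝ ϑ) Q := hϑ.fderiv_of_isOpen hQ (by simp)
  have hdϑv := van_of_contDiffOn (Y := E × ℝ) hQ hdϑ
  have hTqs : Van Q 0 Tq := (h.fixZ_T hQ hJ).1.fst
  set d : E × (E × ℝ) → E := fun x => fderiv ℝ t x (rotGen J x) with hd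
  have hd3 : Van Q 3 d := Van.fderiv_apply_tangent hgen.smooth hgen.snd ht3
  -- A primitive along the orbits of, in turn, $\vartheta(d)$, $h\vartheta(b)$, $h^3g(X,b)$ and the
  -- symmetric part of $-h^2D\vartheta(Jb)(b)$; it uses that $-b$ is the derivative of $Jb$ under
  -- rotation.
  set m : E × (E × ℝ) → ℝ := fun x => ϑ x.1 (t x) - x.2.2 * ϑ x.1 (J x.1 x.2.1) -
    x.2.2 ^ 3 * gm x.1 (X₁ x.1) (J x.1 x.2.1) -
    (1 / 2) * (x.2.2 ^ 2 * fderiv ℝ ϑ x.1 x.2.1 x.2.1) with hm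
  have hpow : ∀ k, Van Q 0 (fun x : E × (E × ℝ) => x.2.2 ^ k) := fun k q hq =>
    ((van_h Q).smooth q hq).pow k
  have hmv : Van Q 0 m := by
    refine ((Van.sub ?_ ?_).sub ?_).sub ?_
    · exact (hϑv.clm_apply ht3).smooth
    · exact ((van_h Q).smul (hϑv.clm_apply hJb)).smooth
    · exact ((hpow 3).smul ((hgv.clm_apply hXv).clm_apply hJb)).smooth
    · exact (((hpow 2).smul ((hdϑv.clm_apply (van_b Q)).clm_apply (van_b Q))).const_smul
        (1 / 2)).smooth
  refine ⟨m, hmv, ?_⟩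
  have hhb : Van Q 2 (fun x : E × (E × ℝ) => x.2.2 • x.2.1) := (van_h Q).smul (van_b Q)
  have e1 : Van Q 5 (fun x => (ϑ (Tq x) - ϑ x.1) (d x)) :=
    (van_comp_fst_sub hQ hϑ (van_sub_self_fst Q) hTq1 hTq2).clm_apply hd3
  have e2 : Van Q 5 (fun x => (ϑ (Tq x) - ϑ x.1 - fderiv ℝ ϑ x.1 (Tq x - x.1))
      (x.2.2 • x.2.1)) := (van_comp_fst_taylor hQ hϑ hTq2).clm_apply hhb
  have e3 : Van Q 5 (fun x => fderiv ℝ ϑ x.1 (t x) (x.2.2 • x.2.1)) :=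
    ((hdϑv.clm_apply ht3).clm_apply hhb).mono (by omega)
  have hin : Van Q 2 (fun x => gm (Tq x) (Tb x + x.2.2 • X₁ (Tq x)) -
      gm x.1 (x.2.1 + x.2.2 • X₁ x.1)) := by
    have i1 : Van Q 2 (fun x => (gm (Tq x) - gm x.1) (Tb x + x.2.2 • X₁ (Tq x))) :=
      ((van_comp_fst_sub hQ hg (van_sub_self_fst Q) hTq1 hTq2).clm_apply (h.van_Tb_one.add
        ((van_h Q).smul (van_comp_fst hQ hX hTq1)))).mono (by omega)
    have i2 : Van Q 2 (fun x => gm x.1 (Tb x - x.2.1 + x.2.2 • (X₁ (Tq x) - X₁ x.1))) :=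
      (hgv.clm_apply (h.van_Tb.add (((van_h Q).smul (van_comp_fst_sub hQ hX (van_sub_self_fst Q)
        hTq1 hTq2)).mono (by omega)))).mono (by omega)
    refine (i1.add i2).congr_fun fun x => ?_
    simp only [map_add, map_sub, map_smul, sub_apply, smul_sub]
    abel
  have e4 : Van Q 5 (fun x => (x.2.2 • (gm (Tq x) (Tb x + x.2.2 • X₁ (Tq x)) -
      gm x.1 (x.2.1 + x.2.2 • X₁ x.1))) (x.2.2 • x.2.1 + d x)) :=
    (((van_h Q).smul hin).clm_apply (hhb.add (hd3.mono (by omega)))).mono (by omega)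
  have e5 : Van Q 5 (fun x => (x.2.2 • gm x.1 (x.2.1 + x.2.2 • X₁ x.1)) (d x)) := by
    have hbX : Van Q 1 (fun x : E × (E × ℝ) => x.2.1 + x.2.2 • X₁ x.1) :=
      (van_b Q).add ((van_h Q).smul hXv)
    exact (((van_h Q).smul (hgv.clm_apply hbX)).clm_apply hd3).mono (by omega)
  refine ((((e1.add e2).add e3).add e4).add e5).congr fun q hq => ?_
  have hq' : ∀ᶠ x in 𝓝 (q, (0 : E × ℝ)), x.1 ∈ Q := continuousAt_fst.eventually (hQ.mem_nhds hq)
  filter_upwards [hq', ht3.smooth.eventually_differentiableAt hq,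
    hTqs.eventually_differentiableAt hq, hmv.eventually_differentiableAt hq] with x hx dt dTq dm
  have hr := hasDerivAt_rot_zero (J := J) x.1 x.2.1
  have hJr : HasDerivAt (fun θ => J x.1 (rot J θ x.1 x.2.1)) (-x.2.1) 0 := by
    have := (J x.1).hasFDerivAt.comp_hasDerivAt (0 : ℝ) hr
    rwa [hJ2 _ hx] at this
  have hdt := hasDerivAt_comp_rotAct (hJ2 _ hx) dt
  have c1 : fderiv ℝ Tq x (rotGen J x) = x.2.2 • x.2.1 + d x := by
    refine fderiv_rotGen_eq (hJ2 _ hx) dTq ?_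
    have h1 : HasDerivAt (fun θ => x.1 - x.2.2 • J x.1 (rot J θ x.1 x.2.1) + t (rotAct J θ x))
        (-(x.2.2 • -x.2.1) + d x) 0 := ((hJr.const_smul x.2.2).const_sub x.1).add hdt
    rw [smul_neg, neg_neg] at h1
    refine h1.congr_of_eventuallyEq (Eventually.of_forall fun θ => ?_)
    simp only [ht, rotAct]
    abel
  have c2 : fderiv ℝ m x (rotGen J x) = ϑ x.1 (d x) - x.2.2 * ϑ x.1 (-x.2.1) -
      x.2.2 ^ 3 * gm x.1 (X₁ x.1) (-x.2.1) -
      (1 / 2) * (x.2.2 ^ 2 * (fderiv ℝ ϑ x.1 (J x.1 x.2.1) x.2.1 +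
        fderiv ℝ ϑ x.1 x.2.1 (J x.1 x.2.1))) := by
    refine fderiv_rotGen_eq (hJ2 _ hx) dm ?_
    have h1 := (ϑ x.1).hasFDerivAt.comp_hasDerivAt (0 : ℝ) hdt
    have h2 := ((ϑ x.1).hasFDerivAt.comp_hasDerivAt (0 : ℝ) hJr).const_mul x.2.2
    have h3 := ((gm x.1 (X₁ x.1)).hasFDerivAt.comp_hasDerivAt (0 : ℝ) hJr).const_mul (x.2.2 ^ 3)
    have h4 := (((fderiv ℝ ϑ x.1).hasFDerivAt.comp_hasDerivAt (0 : ℝ) hr).clm_apply hr)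
    have h5 := (h4.const_mul (x.2.2 ^ 2)).const_mul (1 / 2 : ℝ)
    simp only [Function.comp, rot_zero] at h5
    exact ((h1.sub h2).sub h3).sub h5
  have c3 : Tq x - x.1 = t x - x.2.2 • J x.1 x.2.1 := by
    simp only [ht]
    abel
  have c4 := hω x.1 hx x.2.1
  simp only [actionDensity, c1, c2, c3]
  simp only [actionForm, mapOf, map_add, map_sub, map_neg, map_smul, add_apply, sub_apply,
    smul_apply, smul_eq_mul]
  linear_combination (-(x.2.2 ^ 2 / 2)) * c4

/-- Existence of an adiabatic invariant to every order. -/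
theorem exists_adiabatic_invariant (hQ : IsOpen Q) (hJ : ContDiffOn ℝ ∞ J Q)
    (hJ2 : ∀ q ∈ Q, ∀ u, J q (J q u) = -u) (hα : Irrational (α / (2 * Real.pi)))
    (hϑ : ContDiffOn ℝ ∞ ϑ Q) (hg : ContDiffOn ℝ ∞ gm Q) (hX : ContDiffOn ℝ ∞ X₁ Q)
    (hω : ∀ q ∈ Q, ∀ u, fderiv ℝ ϑ q (J q u) u - fderiv ℝ ϑ q u (J q u) = gm q u u)
    (hgJ : ∀ q ∈ Q, ∀ u w, gm q (J q u) (J q w) = gm q u w)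
    {X₂ : E → E} (hX2 : ContDiffOn ℝ ∞ X₂ Q)
    (hF : FixZ Q (mapOf Fq Fb))
    (hFq : Van Q 3 (fun x => Fq x - (x.1 + x.2.2 • X₁ x.1 + x.2.2 ^ 2 • X₂ x.1 +
      x.2.2 • (J x.1 x.2.1 - J x.1 (rot J α x.1 x.2.1)))))
    (hFb : Van Q 2 (fun x => Fb x - rot J α x.1 x.2.1))
    {σ : E × (E × ℝ) → ℝ} (hσ : Van Q 0 σ)
    (hsymp : ∀ q ∈ Q, ∀ᶠ x in 𝓝 (q, (0 : E × ℝ)), ∀ v : E × (E × ℝ), v.2.2 = 0 →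
      actionForm ϑ gm X₁ (mapOf Fq Fb x) (fderiv ℝ Fq x v) - actionForm ϑ gm X₁ x v.1 =
        fderiv ℝ σ x v) (n : ℕ) :
    ∃ I : E × (E × ℝ) → ℝ, Van Q n (fun x => I (mapOf Fq Fb x) - I x) ∧
      Van Q 5 (fun x => I x - (1 / 2) * x.2.2 ^ 2 * gm x.1 x.2.1 x.2.1) := by
  obtain ⟨Tq, Tb, a, β, h⟩ := exists_normalForm hQ hJ hJ2 hα hX hX2 hFq hFb n
  have hT := h.fixZ_T hQ hJ
  have hG := h.fixZ_G hQ hJ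
  have hT2 : Van Q 2 (fun x => mapOf Tq Tb x - x) :=
    ((h.van_Tq_sub hQ hJ).prodMk (h.van_Tb.prodMk (van_zero (V := ℝ)))).congr_fun fun x => by
      simp [mapOf, Prod.ext_iff]
  obtain ⟨S, hS, hS2, hTS⟩ := exists_approx_inverse hQ hT2 n
  have hSF := hS.comp hQ hF
  have hGS := hG.comp hQ hS
  -- the approximate inverse conjugates the maps
  have hdiff : Van Q (n + 2)
      (fun x => mapOf Fq Fb (mapOf Tq Tb x) - mapOf Tq Tb (equivMap J a β x)) :=
    (h.van_q.succ_le.prodMk (h.van_b.prodMk (van_zero (V := ℝ)))).congr_fun fun x => by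
      simp [mapOf, equivMap]
  have hconj : Van Q (n + 2) (fun x => S (mapOf Fq Fb x) - equivMap J a β (S x)) := by
    refine Van.of_map_sub hQ hT2 hGS hSF ?_
    have k1 := hTS.comp hQ hF
    have k2 := hF.1.sub_comp (fixZ_id Q) (hT.comp hQ hS) hTS
    have k3 := hdiff.comp hQ hS
    exact ((k1.sub k2).add k3).congr_fun fun x => by abel
  set k := actionDensity J ϑ gm X₁ Tq Tb with hk
  have hkv : Van Q 0 k :=
    ((van_actionForm hQ hϑ hg hX).comp hQ hT).clm_apply (n := 0)
      (Van.clm_apply (n := 0) hT.1.fst.fderiv_zero (van_rotGen hQ hJ).smooth)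
  -- The mean must be exact to order `n + 2` for invariance and to order five for the leading term.
  set N := n + 5 with hN
  have hAv : Van Q 0 (rotAvg J α N k) := hkv.rotAvg hQ hJ
  have hcomp := van_actionDensity_comp_sub h hQ hJ hJ2 hF hϑ hg hX hσ hsymp
  have hinv : Van Q (n + 2) (fun x => rotAvg J α N k (equivMap J a β x) - rotAvg J α N k x) := by
    have hs : Van Q N (rotAvg J α N (fun x => fderiv ℝ (fun x => σ (mapOf Tq Tb x)) x
        (rotGen J x))) := van_rotAvg_fderiv hQ hJ hJ2 hα (hσ.comp hQ hT) N
    refine ((hcomp.rotAvg hQ hJ (α := α) (m := N)).add (hs.mono (by omega))).congr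
      fun q hq => ?_
    have hq' : ∀ᶠ x in 𝓝 (q, (0 : E × ℝ)), x.1 ∈ Q :=
      continuousAt_fst.eventually (hQ.mem_nhds hq)
    filter_upwards [hq', (hG.tendsto hq).eventually hq'] with x hx hGx
    have hequiv := equivMap_rotAct (J := J) hJ2 hx hGx (h.inv_a x hx) (h.equiv_β x hx)
    rw [← rotAvg_add, ← rotAvg_comp α N k hequiv, sub_eq_iff_eq_add, ← rotAvg_add]
    congr 1
    ext1 y
    simp only [hk]
    ring
  obtain ⟨m, hm, hkm⟩ := van_actionDensity_sub h hQ hJ hJ2 hϑ hg hX hω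
  have hgv := van_of_contDiffOn (Y := E × ℝ) hQ hg
  set f : E × (E × ℝ) → ℝ := fun x => (1 / 2) * x.2.2 ^ 2 * gm x.1 x.2.1 x.2.1 with hf
  have hf4 : Van Q 4 f := by
    have h1 := ((van_h Q).smul (van_h Q)).smul ((hgv.clm_apply (van_b Q)).clm_apply (van_b Q))
    refine (h1.const_smul (1 / 2)).congr_fun fun x => ?_
    simp only [hf, smul_eq_mul]
    ring
  have hlead : Van Q 5 (fun x => rotAvg J α N k x - f x) := by
    have hs : Van Q N (rotAvg J α N (fun x => fderiv ℝ m x (rotGen J x))) :=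
      van_rotAvg_fderiv hQ hJ hJ2 hα hm N
    refine ((hkm.rotAvg hQ hJ (α := α) (m := N)).add (hs.mono (by omega))).congr
      fun q hq => ?_
    have hq' : ∀ᶠ x in 𝓝 (q, (0 : E × ℝ)), x.1 ∈ Q :=
      continuousAt_fst.eventually (hQ.mem_nhds hq)
    filter_upwards [hq'] with x hx
    have hfi : rotAvg J α N f x = f x := rotAvg_of_invariant hα N fun θ => by
      simp only [hf, rotAct, gm_rot (hJ2 _ hx) (hgJ _ hx)]
    rw [← rotAvg_add, ← hfi, sub_eq_iff_eq_add, ← rotAvg_add]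
    congr 1
    ext1 y
    simp only [hk, hf]
    ring
  -- Invariance follows from $S\circ F\approx G\circ S$ and the approximate $G$-invariance of the
  -- mean. Since $S=\mathrm{id}+O(2)$ and `f` has order four, composing with `S` alters the leading
  -- term only at order five.
  refine ⟨fun x => rotAvg J α N k (S x), ?_, ?_⟩
  · have k1 := hAv.sub_comp hGS hSF hconj
    have k2 := hinv.comp hQ hS
    exact ((k1.add k2).congr_fun fun x => by ring).mono (by omega)
  · have k1 := hlead.comp hQ hS
    have k2 := Van.sub_comp_of_snd_two hQ (fixZ_id Q) hS (hS2.fst.mono (by omega)) hS2.snd hf4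
    exact (k1.add k2).congr_fun fun x => by ring

end Action

/-! ### Inverses along the zero section, division, and Taylor expansion of integrals -/

section Tube

variable {X Y : Type*} [NormedAddCommGroup X] [NormedSpace ℝ X] [CompleteSpace X]
  [NormedAddCommGroup Y] [NormedSpace ℝ Y] [CompleteSpace Y] {Q : Set X}

/-- A fibre-preserving map that is smooth near the zero section, fixes it and has invertible
derivative along it, has a smooth inverse on a neighbourhood of the zero section. -/
theorem exists_inverse_near_zero_section {B : X × Y → X × Y}
    (hB : ∀ q ∈ Q, ∀ᶠ x in 𝓝 (q, (0 : Y)), ContDiffAt ℝ ∞ B x)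
    (hfst : ∀ x, (B x).1 = x.1) (h0 : ∀ q ∈ Q, B (q, 0) = (q, 0))
    (hinv : ∀ q ∈ Q, (fderiv ℝ B (q, 0)).IsInvertible) {p : X × Y → Prop}
    (hp : ∀ q ∈ Q, ∀ᶠ x in 𝓝 (q, (0 : Y)), p x) :
    ∃ (N : Set (X × Y)) (S : X × Y → X × Y), IsOpen N ∧ (∀ q ∈ Q, (q, 0) ∈ N) ∧
      (∀ y ∈ N, ContDiffAt ℝ ∞ S y ∧ B (S y) = y ∧ p (S y)) ∧ (∀ q ∈ Q, S (q, 0) = (q, 0)) ∧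
      ∀ q ∈ Q, ∀ᶠ x in 𝓝 (q, (0 : Y)), S (B x) = x := by
  have hn : (∞ : WithTop ℕ∞) ≠ 0 := by simp
  have key : ∀ q ∈ Q, ∃ ε > 0, (∀ x ∈ Metric.ball (q, (0 : Y)) ε, ContDiffAt ℝ ∞ B x ∧
      (fderiv ℝ B x).IsInvertible ∧ p x) ∧ InjOn B (Metric.ball (q, (0 : Y)) ε) := by
    intro q hq
    have hc := (hB q hq).self_of_nhds
    obtain ⟨e, he⟩ := hinv q hq
    have hd : HasFDerivAt B (e : X × Y →L[ℝ] X × Y) (q, 0) := by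
      rw [he]
      exact (hc.differentiableAt hn).hasFDerivAt
    have h1 : ∀ᶠ x in 𝓝 (q, (0 : Y)), (fderiv ℝ B x).IsInvertible := by
      have h2 : ContinuousAt (fderiv ℝ B) (q, (0 : Y)) :=
        (hc.fderiv_right (m := 0) (by simp)).continuousAt
      have h3 := h2.eventually (he ▸ ContinuousLinearEquiv.nhds e)
      exact h3
    have h4 := (hc.toOpenPartialHomeomorph B hd hn).open_source.mem_nhds
      (hc.mem_toOpenPartialHomeomorph_source hd hn)
    obtain ⟨ε, hε, hball⟩ := Metric.mem_nhds_iff.1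
      (inter_mem (inter_mem (inter_mem (hB q hq) h1) (hp q hq)) h4)
    exact ⟨ε, hε, fun x hx => ⟨(hball hx).1.1.1, (hball hx).1.1.2, (hball hx).1.2⟩,
      (hc.toOpenPartialHomeomorph B hd hn).injOn.mono fun x hx => (hball hx).2⟩
  choose! ε hε hgood hinj using key
  set O : Set (X × Y) := ⋃ q ∈ Q, Metric.ball (q, (0 : Y)) (ε q) with hO
  have hOo : IsOpen O := isOpen_biUnion fun q _ => Metric.isOpen_ball
  have hO0 : ∀ q ∈ Q, (q, (0 : Y)) ∈ O := fun q hq =>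
    mem_biUnion hq (Metric.mem_ball_self (hε q hq))
  have hOgood : ∀ x ∈ O, ContDiffAt ℝ ∞ B x ∧ (fderiv ℝ B x).IsInvertible ∧ p x := by
    intro x hx
    obtain ⟨q, hq, hx⟩ := mem_iUnion₂.1 hx
    exact hgood q hq x hx
  -- Equal images force equal base points, since `B` preserves fibres. In the maximum metric the
  -- point of the smaller ball then lies in the larger ball as well, where `B` is injective. So
  -- local injectivity gives injectivity on the union of the balls.
  have hnest : ∀ q ∈ Q, ∀ q' ∈ Q, ε q' ≤ ε q → ∀ x ∈ Metric.ball (q, (0 : Y)) (ε q),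
      ∀ x' ∈ Metric.ball (q', (0 : Y)) (ε q'), B x = B x' → x = x' := by
    intro q hq q' hq' hle x hx x' hx' hxx
    refine hinj q hq hx ?_ hxx
    have h1 : x.1 = x'.1 := by rw [← hfst x, hxx, hfst x']
    rw [Metric.mem_ball, Prod.dist_eq, max_lt_iff] at hx hx' ⊢
    exact ⟨by rw [← h1]; exact hx.1, hx'.2.trans_le hle⟩
  have hOinj : InjOn B O := by
    intro x hx x' hx' hxx
    obtain ⟨q, hq, hx⟩ := mem_iUnion₂.1 hx
    obtain ⟨q', hq', hx'⟩ := mem_iUnion₂.1 hx'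
    rcases le_total (ε q') (ε q) with h | h
    · exact hnest q hq q' hq' h x hx x' hx' hxx
    · exact (hnest q' hq' q hq h x' hx' x hx hxx.symm).symm
  set S : X × Y → X × Y := fun y => (Function.invFunOn B O) y with hS
  have hSB : ∀ x ∈ O, S (B x) = x := fun x hx => hOinj.leftInvOn_invFunOn hx
  refine ⟨B '' O, S, ?_, fun q hq => ⟨(q, 0), hO0 q hq, h0 q hq⟩, ?_, fun q hq => ?_,
    fun q hq => ?_⟩
  · rw [isOpen_iff_mem_nhds]
    rintro _ ⟨x, hx, rfl⟩
    obtain ⟨hc, ⟨e, he⟩, -⟩ := hOgood x hx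
    have hd : HasFDerivAt B (e : X × Y →L[ℝ] X × Y) x := by
      rw [he]
      exact (hc.differentiableAt hn).hasFDerivAt
    rw [← (hc.hasStrictFDerivAt' hd hn).map_nhds_eq_of_equiv]
    exact image_mem_map (hOo.mem_nhds hx)
  · rintro _ ⟨x, hx, rfl⟩
    obtain ⟨hc, ⟨e, he⟩, hpx⟩ := hOgood x hx
    have hd : HasFDerivAt B (e : X × Y →L[ℝ] X × Y) x := by
      rw [he]
      exact (hc.differentiableAt hn).hasFDerivAt
    rw [hSB x hx]
    refine ⟨?_, rfl, hpx⟩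
    have hl := hc.to_localInverse hd hn
    refine hl.congr_of_eventuallyEq ?_
    have h1 : ∀ᶠ y in 𝓝 (B x), B (hc.localInverse hd hn y) = y :=
      (hc.hasStrictFDerivAt' hd hn).eventually_right_inverse
    have h2 : ∀ᶠ y in 𝓝 (B x), hc.localInverse hd hn y ∈ O := by
      have := hl.continuousAt.tendsto
      rw [hc.localInverse_apply_image hd hn] at this
      exact this (hOo.mem_nhds hx)
    filter_upwards [h1, h2] with y hy hyO
    have h3 := hSB _ hyO
    rwa [hy] at h3
  · have := hSB _ (hO0 q hq)
    rwa [h0 q hq] at this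
  · filter_upwards [hOo.mem_nhds (hO0 q hq)] with x hx using hSB x hx

end Tube

/-! ### Smooth division by the scalar variable. -/

section Division

variable {Z V : Type*} [NormedAddCommGroup Z] [NormedSpace ℝ Z]
  [NormedAddCommGroup V] [NormedSpace ℝ V]

theorem isOpen_setOf_forall_smul_fst_mem {U : Set (ℝ × Z)} (hU : IsOpen U) :
    IsOpen {p : ℝ × Z | ∀ s ∈ Icc (0 : ℝ) 1, (s * p.1, p.2) ∈ U} := by
  rw [isOpen_iff_mem_nhds]
  intro p hp
  refine isCompact_Icc.eventually_forall_of_forall_eventually (x₀ := p) fun s hs => ?_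
  have h : Continuous fun z : (ℝ × Z) × ℝ => (z.2 * z.1.1, z.1.2) := by fun_prop
  exact h.continuousAt.eventually (hU.mem_nhds (hp s hs))

/-- Hadamard's lemma in the scalar variable alone; it needs a domain that is star-shaped in that
variable. -/
theorem exists_contDiffAt_eq_fst_smul [CompleteSpace V] {U : Set (ℝ × Z)}
    (hU : ∀ p ∈ U, ∀ s ∈ Icc (0 : ℝ) 1, (s * p.1, p.2) ∈ U) {φ : ℝ × Z → V}
    (hφ : ∀ p ∈ U, ContDiffAt ℝ ∞ φ p) (h0 : ∀ p ∈ U, φ (0, p.2) = 0) :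
    ∃ ψ : ℝ × Z → V, ∀ p ∈ U, ContDiffAt ℝ ∞ ψ p ∧ φ p = p.1 • ψ p := by
  refine ⟨fun p => ∫ s in (0 : ℝ)..1, fderiv ℝ φ (s * p.1, p.2) (1, 0), fun p hp => ⟨?_, ?_⟩⟩
  · refine contDiffAt_integral_param
      (f := fun z : (ℝ × Z) × ℝ => fderiv ℝ φ (z.2 * z.1.1, z.1.2) (1, 0)) fun s hs => ?_
    have h1 : ContDiffAt ℝ ∞ (fderiv ℝ φ) (s * p.1, p.2) :=
      (hφ _ (hU p hp s hs)).fderiv_right (by simp)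
    have h2 : ContDiffAt ℝ ∞ (fun z : (ℝ × Z) × ℝ => (z.2 * z.1.1, z.1.2)) (p, s) :=
      (contDiffAt_snd.mul (contDiffAt_fst.comp _ contDiffAt_fst)).prodMk
        (contDiffAt_snd.comp _ contDiffAt_fst)
    exact (ContDiffAt.comp (p, s) (f := fun z : (ℝ × Z) × ℝ => (z.2 * z.1.1, z.1.2)) h1
      h2).clm_apply contDiffAt_const
  · have hderiv : ∀ s ∈ uIcc (0 : ℝ) 1, HasDerivAt (fun s => φ (s * p.1, p.2))
        (p.1 • fderiv ℝ φ (s * p.1, p.2) (1, 0)) s := by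
      intro s hs
      rw [uIcc_of_le zero_le_one] at hs
      have h1 := ((hφ _ (hU p hp s hs)).differentiableAt (by simp)).hasFDerivAt
      have h2 : HasDerivAt (fun s : ℝ => (s * p.1, p.2)) (p.1, (0 : Z)) s := by
        simpa using ((hasDerivAt_id s).mul_const p.1).prodMk (hasDerivAt_const s p.2)
      have h3 := h1.comp_hasDerivAt s h2
      have h4 : ((p.1, 0) : ℝ × Z) = p.1 • (1, 0) := by simp
      rwa [h4, map_smul] at h3
    have hcont : ContinuousOn (fun s : ℝ => p.1 • fderiv ℝ φ (s * p.1, p.2) (1, 0))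
        (uIcc 0 1) := by
      intro s hs
      rw [uIcc_of_le zero_le_one] at hs
      have h1 : ContinuousAt (fderiv ℝ φ) (s * p.1, p.2) :=
        ((hφ _ (hU p hp s hs)).fderiv_right (m := 0) (by simp)).continuousAt
      have h2 : ContinuousAt (fun s : ℝ => (s * p.1, p.2)) s := by fun_prop
      exact ((ContinuousAt.comp (f := fun s : ℝ => (s * p.1, p.2)) h1 h2).clm_apply
        continuousAt_const).const_smul p.1 |>.continuousWithinAt
    have h := intervalIntegral.integral_eq_sub_of_hasDerivAt hderiv
      hcont.intervalIntegrable
    rw [intervalIntegral.integral_smul] at h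
    simp only [one_mul, zero_mul, h0 p hp, sub_zero] at h
    exact h.symm

end Division

/-! ### Weighted averages along short segments. -/

section Taylor

variable {E : Type*} [NormedAddCommGroup E] [NormedSpace ℝ E] [FiniteDimensional ℝ E]
  {V : Type*} [NormedAddCommGroup V] [NormedSpace ℝ V] [CompleteSpace V] {Q : Set E}

/-- Differentiating under the integral shows that the average and its expansion have the same values
and the same fibre derivatives on the zero section, which is order two. -/
theorem van_integral_taylor (hQ : IsOpen Q) {c : E → V} (hc : ContDiffOn ℝ ∞ c Q)
    {u : E × (E × ℝ) → E} (hu : Van Q 1 u) {ρ : ℝ → ℝ} (hρ : ContDiff ℝ ∞ ρ) :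
    Van Q 2 (fun x => (∫ t in (0 : ℝ)..1, ρ t • c (x.1 + t • u x)) -
      ((∫ t in (0 : ℝ)..1, ρ t) • c x.1 + (∫ t in (0 : ℝ)..1, t * ρ t) •
        fderiv ℝ c x.1 (u x))) := by
  set G : (E × (E × ℝ)) × ℝ → V := fun z => ρ z.2 • c (z.1.1 + z.2 • u z.1) with hG
  have hdc : ContDiffOn ℝ ∞ (fderiv ℝ c) Q := hc.fderiv_of_isOpen hQ (by simp)
  have hcv := van_of_contDiffOn (Y := E × ℝ) hQ hc
  have hdcv := van_of_contDiffOn (Y := E × ℝ) hQ hdc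
  have hγ : ∀ q ∈ Q, ∀ t, ContDiffAt ℝ ∞ (fun z : (E × (E × ℝ)) × ℝ => z.1.1 + z.2 • u z.1)
      ((q, 0), t) := fun q hq t =>
    (contDiffAt_fst.comp _ contDiffAt_fst).add
      (contDiffAt_snd.smul ((hu.smooth q hq).comp ((q, (0 : E × ℝ)), t) contDiffAt_fst))
  have hcq : ∀ q ∈ Q, ContDiffAt ℝ ∞ c q := fun q hq => hc.contDiffAt (hQ.mem_nhds hq)
  have hu0 : ∀ q ∈ Q, u (q, 0) = 0 := fun q hq => hu.eq_zero hq
  have hGs : ∀ q ∈ Q, ∀ t ∈ Icc (0 : ℝ) 1, ContDiffAt ℝ ∞ G ((q, 0), t) := by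
    intro q hq t _
    refine (hρ.contDiffAt.comp _ contDiffAt_snd).smul
      (ContDiffAt.comp (g := c) _ ?_ (hγ q hq t))
    simpa [hu0 q hq] using hcq q hq
  have hI : Van Q 0 (fun x => ∫ t in (0 : ℝ)..1, G (x, t)) := Van.integral hGs
  have h1 : Van Q 0 (fun x => (∫ t in (0 : ℝ)..1, ρ t) • c x.1) := hcv.const_smul _
  have h2 : Van Q 1 (fun x => (∫ t in (0 : ℝ)..1, t * ρ t) • fderiv ℝ c x.1 (u x)) :=
    ((hdcv.clm_apply hu).mono (by omega)).const_smul _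
  refine (hI.sub (h1.add h2.smooth)).two_of_fderiv_eq_zero (fun q hq => ?_)
    (fun q hq y => ?_) hQ
  · simp [hG, hu0 q hq, intervalIntegral.integral_smul_const]
  · set u' := fderiv ℝ u (q, 0) (0, y) with hu'
    have hdu := ((hu.smooth q hq).differentiableAt (by simp)).hasFDerivAt
    have hdcq := ((hcq q hq).differentiableAt (by simp)).hasFDerivAt
    have hgt : ∀ t ∈ Icc (0 : ℝ) 1, fderiv ℝ G ((q, 0), t) ((0, y), 0) =
        (t * ρ t) • fderiv ℝ c q u' := by
      intro t ht
      have e1 := ((hGs q hq t ht).differentiableAt (by simp)).hasFDerivAt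
      have e2 : HasDerivAt (fun s : ℝ => ((q, s • y), t)) (((0 : E), y), (0 : ℝ)) 0 := by
        have := ((hasDerivAt_const (0 : ℝ) q).prodMk ((hasDerivAt_id (0 : ℝ)).smul_const y)).prodMk
          (hasDerivAt_const (0 : ℝ) t)
        simpa using this
      have e3 : HasDerivAt (fun s : ℝ => G ((q, s • y), t))
          (fderiv ℝ G ((q, 0), t) ((0, y), 0)) 0 := by
        refine HasFDerivAt.comp_hasDerivAt (l := G) (f := fun s : ℝ => ((q, s • y), t)) (0 : ℝ) ?_ e2
        simpa using e1
      have e4 : HasDerivAt (fun s : ℝ => (q, s • y)) ((0 : E), y) (0 : ℝ) := by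
        have := (hasDerivAt_const (0 : ℝ) q).prodMk ((hasDerivAt_id (0 : ℝ)).smul_const y)
        simpa using this
      have e5 : HasDerivAt (fun s : ℝ => u (q, s • y)) u' 0 := by
        refine HasFDerivAt.comp_hasDerivAt (l := u) (f := fun s : ℝ => (q, s • y)) (0 : ℝ) ?_ e4
        simpa using hdu
      have e6 : HasDerivAt (fun s : ℝ => q + t • u (q, s • y)) (t • u') 0 :=
        (e5.const_smul t).const_add q
      have e7 : HasDerivAt (fun s : ℝ => c (q + t • u (q, s • y))) (fderiv ℝ c q (t • u')) 0 := by
        refine HasFDerivAt.comp_hasDerivAt (l := c) (f := fun s : ℝ => q + t • u (q, s • y)) (0 : ℝ) ?_ e6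
        simpa [hu0 q hq] using hdcq
      have e8 := e3.unique (e7.const_smul (ρ t))
      rw [e8, map_smul, smul_smul, mul_comm]
    have hd1 := (hasFDerivAt_integral_param fun t ht =>
      (hGs q hq t ht).of_le (by exact_mod_cast le_top)).self_of_nhds
    have hint : IntervalIntegrable (fun t => (fderiv ℝ G ((q, 0), t)).comp
        (ContinuousLinearMap.inl ℝ (E × (E × ℝ)) ℝ)) MeasureTheory.volume 0 1 := by
      refine ContinuousOn.intervalIntegrable fun t ht => ?_
      rw [uIcc_of_le zero_le_one] at ht
      have f1 : ContinuousAt (fderiv ℝ G) ((q, 0), t) :=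
        ((hGs q hq t ht).fderiv_right (m := 0) (by simp)).continuousAt
      have f2 : ContinuousAt (fun t : ℝ => ((q, (0 : E × ℝ)), t)) t := by fun_prop
      exact ((ContinuousAt.comp (f := fun t : ℝ => ((q, (0 : E × ℝ)), t)) f1 f2).clm_comp
        continuousAt_const).continuousWithinAt
    have hd2 := ((h1 q hq).differentiableAt (by simp)).hasFDerivAt
    have hd3 := ((h2.smooth q hq).differentiableAt (by simp)).hasFDerivAt
    rw [(hd1.fun_sub (hd2.fun_add hd3)).fderiv]
    have g1 : fderiv ℝ (fun x : E × (E × ℝ) => (∫ t in (0 : ℝ)..1, ρ t) • c x.1) (q, 0) (0, y) =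
        0 := by
      have k1 : HasFDerivAt (fun x : E × (E × ℝ) => c x.1)
          ((fderiv ℝ c q).comp (ContinuousLinearMap.fst ℝ E (E × ℝ))) (q, 0) :=
        HasFDerivAt.comp (g := c) (f := Prod.fst) (q, (0 : E × ℝ)) hdcq hasFDerivAt_fst
      rw [(k1.fun_const_smul _).fderiv]
      simp
    have g2 : fderiv ℝ (fun x : E × (E × ℝ) => (∫ t in (0 : ℝ)..1, t * ρ t) •
        fderiv ℝ c x.1 (u x)) (q, 0) (0, y) = (∫ t in (0 : ℝ)..1, t * ρ t) •
          fderiv ℝ c q u' := by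
      have k2 : HasFDerivAt (fun x : E × (E × ℝ) => fderiv ℝ c x.1)
          (fderiv ℝ (fun x : E × (E × ℝ) => fderiv ℝ c x.1) (q, 0)) (q, 0) :=
        ((hdcv q hq).differentiableAt (by simp)).hasFDerivAt
      rw [((k2.clm_apply hdu).fun_const_smul _).fderiv]
      simp [hu0 q hq, hu']
    rw [sub_apply, add_apply, g1, g2, ContinuousLinearMap.intervalIntegral_apply hint]
    have g3 : (∫ t in (0 : ℝ)..1, ((fderiv ℝ G ((q, 0), t)).comp
        (ContinuousLinearMap.inl ℝ (E × (E × ℝ)) ℝ)) (0, y)) =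
        ∫ t in (0 : ℝ)..1, (t * ρ t) • fderiv ℝ c q u' := by
      refine intervalIntegral.integral_congr fun t ht => ?_
      rw [uIcc_of_le zero_le_one] at ht
      exact hgt t ht
    rw [g3, intervalIntegral.integral_smul_const]
    simp

end Taylor

/-! ### The geometry of an exact Hamiltonian system -/

namespace ExactHamiltonianSystem

set_option maxSynthPendingDepth 3

variable {E : Type*} [NormedAddCommGroup E] [NormedSpace ℝ E] [FiniteDimensional ℝ E]
  (D : ExactHamiltonianSystem E) {q : E}

theorem omega_swap (q u w : E) : D.omega q u w = -D.omega q w u := by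
  simp only [omega_apply]
  ring

theorem omega_J_J (hq : q ∈ D.Q) (u w : E) :
    D.omega q (D.J q u) (D.J q w) = D.omega q u w :=
  D.compatible q hq u w

theorem g_J_J (hq : q ∈ D.Q) (u w : E) : D.g q (D.J q u) (D.J q w) = D.g q u w := by
  rw [g_apply, g_apply, D.omega_J_J hq]

theorem g_J (hq : q ∈ D.Q) (u : E) : D.g q (D.J q u) = D.omega q u := by
  ext w
  rw [g_apply, D.omega_J_J hq]

theorem g_symm (hq : q ∈ D.Q) (u w : E) : D.g q u w = D.g q w u := by
  rw [g_apply, g_apply, ← D.omega_J_J hq u, D.J_sq q hq, map_neg, D.omega_swap, neg_neg]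

theorem fderiv_ϑ_sub (q u : E) :
    fderiv ℝ D.ϑ q (D.J q u) u - fderiv ℝ D.ϑ q u (D.J q u) = D.g q u u := by
  rw [g_apply, omega_apply]
  ring

/-- The inverse of the metric. -/
noncomputable def sharp (q : E) : (E →L[ℝ] ℝ) →L[ℝ] E := (D.J q).comp (D.omega q).inverse

theorem g_sharp (hq : q ∈ D.Q) (l : E →L[ℝ] ℝ) : D.g q (D.sharp q l) = l := by
  obtain ⟨e, he⟩ := D.isInvertible_omega hq
  simp only [sharp, ContinuousLinearMap.comp_apply, D.g_J hq]
  simp only [← he, ContinuousLinearMap.inverse_equiv]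
  simp

theorem sharp_omega (hq : q ∈ D.Q) (u : E) : D.sharp q (D.omega q u) = D.J q u := by
  obtain ⟨e, he⟩ := D.isInvertible_omega hq
  simp only [sharp, ContinuousLinearMap.comp_apply]
  simp only [← he, ContinuousLinearMap.inverse_equiv]
  simp

theorem sharp_g (hq : q ∈ D.Q) (u : E) : D.sharp q (D.g q u) = u := by
  have h : D.g q u = D.omega q (-(D.J q u)) := by
    rw [← D.g_J hq, map_neg, D.J_sq q hq, neg_neg]
  rw [h, D.sharp_omega hq, map_neg, D.J_sq q hq, neg_neg]

theorem contDiffOn_omega : ContDiffOn ℝ ∞ D.omega D.Q := by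
  have h := D.smooth_ϑ.fderiv_of_isOpen D.isOpen_Q (m := ∞) (by simp)
  exact ((ContinuousLinearMap.flipₗᵢ ℝ E E ℝ).contDiff.comp_contDiffOn h).sub h

theorem contDiffOn_g : ContDiffOn ℝ ∞ D.g D.Q := by
  have h1 := (ContinuousLinearMap.flipₗᵢ ℝ E E ℝ).contDiff.comp_contDiffOn D.contDiffOn_omega
  exact (ContinuousLinearMap.flipₗᵢ ℝ E E ℝ).contDiff.comp_contDiffOn (h1.clm_comp D.smooth_J)

theorem contDiffOn_dH : ContDiffOn ℝ ∞ (fderiv ℝ D.H) D.Q :=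
  D.smooth_H.fderiv_of_isOpen D.isOpen_Q (by simp)

theorem contDiffOn_inverse_omega : ContDiffOn ℝ ∞ (fun q => (D.omega q).inverse) D.Q := by
  intro q hq
  have : CompleteSpace E := FiniteDimensional.complete ℝ E
  exact ((D.isInvertible_omega hq).contDiffAt_map_inverse (n := ∞)).comp_contDiffWithinAt q
    (D.contDiffOn_omega q hq)

theorem contDiffOn_sharp : ContDiffOn ℝ ∞ D.sharp D.Q :=
  D.smooth_J.clm_comp D.contDiffOn_inverse_omega

theorem contDiffOn_XH : ContDiffOn ℝ ∞ D.XH D.Q :=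
  D.contDiffOn_inverse_omega.clm_apply D.contDiffOn_dH

/-- The covector field that enters the generating function at second order. -/
noncomputable def beta (x : E) : E →L[ℝ] ℝ :=
  D.g x (D.XH x) - (1 / 12 : ℝ) • fderiv ℝ D.omega x (D.XH x) (D.XH x)

theorem contDiffOn_beta : ContDiffOn ℝ ∞ D.beta D.Q := by
  have h := D.contDiffOn_omega.fderiv_of_isOpen D.isOpen_Q (m := ∞) (by simp)
  exact (D.contDiffOn_g.clm_apply D.contDiffOn_XH).sub
    (((h.clm_apply D.contDiffOn_XH).clm_apply D.contDiffOn_XH).const_smul (1 / 12 : ℝ))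

/-- The coefficient `sin θ₀ / (1 - cos θ₀)`. -/
noncomputable def cot (θ₀ : ℝ) : ℝ := Real.sin θ₀ / (1 - Real.cos θ₀)

theorem Sigma_eq (θ₀ ħ : ℝ) (x ξ : E) : D.Sigma θ₀ ħ x ξ = -ħ * D.H x + ħ ^ 2 * D.beta x ξ -
    (1 / 4 * cot θ₀) * D.g x (ξ - ħ • D.XH x) (ξ - ħ • D.XH x) := by
  simp only [Sigma, beta, cot, sub_apply, smul_apply, smul_eq_mul]
  ring

/-! ### The differential of the generating function -/

/-- The initial velocity of the segment encoded by `x = (q, (W, h))`. -/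
noncomputable def vel (x : E × (E × ℝ)) : E := D.XH x.1 + x.2.1

/-- The end point of the segment encoded by `x`. -/
noncomputable def endPt (x : E × (E × ℝ)) : E := x.1 + x.2.2 • D.vel x

/-- The mid point of the segment encoded by `x`. -/
noncomputable def midPt (x : E × (E × ℝ)) : E := x.1 + (x.2.2 / 2) • D.vel x

/-- The relative velocity at the mid point. -/
noncomputable def relVel (x : E × (E × ℝ)) : E := D.vel x - D.XH (D.midPt x)

/-- The weighted average of `ω` along the segment encoded by `x`. -/
noncomputable def avgOmega (ρ : ℝ → ℝ) (x : E × (E × ℝ)) : E →L[ℝ] E →L[ℝ] ℝ :=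
  ∫ t in (0 : ℝ)..1, ρ t • D.omega (x.1 + t • (x.2.2 • D.vel x))

/-- The base part of the differential of `Σ`, divided by `h`. -/
noncomputable def potForce (c : ℝ) (x : E × (E × ℝ)) : E →L[ℝ] ℝ :=
  -fderiv ℝ D.H (D.midPt x) + x.2.2 ^ 2 • (fderiv ℝ D.beta (D.midPt x)).flip (D.vel x) -
    (1 / 4 * c * x.2.2) • (((fderiv ℝ D.g (D.midPt x)).flip (D.relVel x)).flip (D.relVel x) -
      (2 : ℝ) • (D.g (D.midPt x) (D.relVel x)).comp (fderiv ℝ D.XH (D.midPt x)))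

/-- The fibre part of the differential of `Σ`, divided by `h`. -/
noncomputable def kinForce (c : ℝ) (x : E × (E × ℝ)) : E →L[ℝ] ℝ :=
  x.2.2 • D.beta (D.midPt x) - (1 / 2 * c) • D.g (D.midPt x) (D.relVel x)

/-- The covector `A` with `-∂S/∂q = ϑ_q + h A`. -/
noncomputable def startForce (c : ℝ) (x : E × (E × ℝ)) : E →L[ℝ] ℝ :=
  -(D.avgOmega (fun t => 1 - t) x (D.vel x) + (1 / 2 : ℝ) • D.potForce c x - D.kinForce c x)

/-- The covector `A` with `∂S/∂q' = ϑ_{q'} + h A`. -/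
noncomputable def endForce (c : ℝ) (x : E × (E × ℝ)) : E →L[ℝ] ℝ :=
  D.avgOmega (fun t => t) x (D.vel x) + (1 / 2 : ℝ) • D.potForce c x + D.kinForce c x

variable {D}

theorem intervalIntegral_apply_apply {φ : ℝ → E →L[ℝ] E →L[ℝ] ℝ}
    (hφ : IntervalIntegrable φ MeasureTheory.volume 0 1) (u w : E) :
    IntervalIntegrable (fun t => φ t u w) MeasureTheory.volume 0 1 ∧
      (∫ t in (0 : ℝ)..1, φ t) u w = ∫ t in (0 : ℝ)..1, φ t u w := by
  have h1 : IntervalIntegrable (fun t => φ t u) MeasureTheory.volume 0 1 :=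
    ⟨(ContinuousLinearMap.apply ℝ (E →L[ℝ] ℝ) u).integrable_comp hφ.1,
      (ContinuousLinearMap.apply ℝ (E →L[ℝ] ℝ) u).integrable_comp hφ.2⟩
  have h2 : IntervalIntegrable (fun t => φ t u w) MeasureTheory.volume 0 1 :=
    ⟨(ContinuousLinearMap.apply ℝ ℝ w).integrable_comp h1.1,
      (ContinuousLinearMap.apply ℝ ℝ w).integrable_comp h1.2⟩
  exact ⟨h2, by rw [ContinuousLinearMap.intervalIntegral_apply hφ,
    ContinuousLinearMap.intervalIntegral_apply h1]⟩

/-- The integrand of the line integral of `ϑ`. -/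
noncomputable def lineIntegrand (D : ExactHamiltonianSystem E) (z : (E × E) × ℝ) : ℝ :=
  D.ϑ (z.1.1 + z.2 • (z.1.2 - z.1.1)) (z.1.2 - z.1.1)

theorem contDiffAt_lineIntegrand {q q' : E} {t : ℝ} (hq : q + t • (q' - q) ∈ D.Q) :
    ContDiffAt ℝ ∞ D.lineIntegrand ((q, q'), t) := by
  have h1 : ContDiff ℝ ∞ (fun z : (E × E) × ℝ => z.1.1 + z.2 • (z.1.2 - z.1.1)) := by fun_prop
  have h2 : ContDiff ℝ ∞ (fun z : (E × E) × ℝ => z.1.2 - z.1.1) := by fun_prop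
  exact (ContDiffAt.comp (g := D.ϑ) ((q, q'), t)
    (D.smooth_ϑ.contDiffAt (D.isOpen_Q.mem_nhds hq)) h1.contDiffAt).clm_apply h2.contDiffAt

/-- First variation of the integral of $\vartheta$ over the segment $\gamma$: with variation field
$\eta$, the integrand varies by $\tfrac{d}{dt}\vartheta_\gamma(\eta)$ plus
$\omega(\dot\gamma,\eta)$. The first bracket is that total derivative; the weights $1-t$ and $t$
come from $\eta=(1-t)\delta_1+t\delta_2$. -/
theorem fderiv_lineIntegrand {q q' : E} {t : ℝ} (hq : q + t • (q' - q) ∈ D.Q) (δ : E × E) :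
    fderiv ℝ D.lineIntegrand ((q, q'), t) (δ, 0) =
      (fderiv ℝ D.ϑ (q + t • (q' - q)) (q' - q) (δ.1 + t • (δ.2 - δ.1)) +
        D.ϑ (q + t • (q' - q)) (δ.2 - δ.1)) +
      (((1 - t) • D.omega (q + t • (q' - q))) (q' - q) δ.1 +
        (t • D.omega (q + t • (q' - q))) (q' - q) δ.2) := by
  have h1 := ((D.smooth_ϑ.contDiffAt (D.isOpen_Q.mem_nhds hq)).differentiableAt
    (by simp)).hasFDerivAt
  have h2 := ((contDiffAt_lineIntegrand hq).differentiableAt (by simp)).hasFDerivAt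
  have e1 : HasFDerivAt (fun p : E × E => (p, t)) (ContinuousLinearMap.inl ℝ (E × E) ℝ) (q, q') :=
    hasFDerivAt_prodMk_left (q, q') t
  have e2 := HasFDerivAt.comp (g := D.lineIntegrand) (f := fun p : E × E => (p, t)) (q, q') h2 e1
  have e3 : HasFDerivAt (fun p : E × E => p.2 - p.1)
      (ContinuousLinearMap.snd ℝ E E - ContinuousLinearMap.fst ℝ E E) (q, q') :=
    hasFDerivAt_snd.sub hasFDerivAt_fst
  have e4 : HasFDerivAt (fun p : E × E => p.1 + t • (p.2 - p.1))
      (ContinuousLinearMap.fst ℝ E E +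
        t • (ContinuousLinearMap.snd ℝ E E - ContinuousLinearMap.fst ℝ E E)) (q, q') :=
    hasFDerivAt_fst.add (e3.const_smul t)
  have e5 := HasFDerivAt.comp (g := D.ϑ) (f := fun p : E × E => p.1 + t • (p.2 - p.1)) (q, q') h1 e4
  have e6 := congrArg (fun L => L δ) (e2.unique (e5.clm_apply e3))
  simp only [ContinuousLinearMap.comp_apply, ContinuousLinearMap.inl_apply] at e6
  rw [e6]
  simp only [smul_apply, smul_eq_mul, omega_apply, map_add, map_sub, map_smul, add_apply,
    sub_apply, ContinuousLinearMap.comp_apply, ContinuousLinearMap.flip_apply,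
    ContinuousLinearMap.coe_fst', ContinuousLinearMap.coe_snd', Function.comp]
  ring

theorem integral_deriv_pairing {q q' : E} (hseg : ∀ t ∈ Icc (0 : ℝ) 1, q + t • (q' - q) ∈ D.Q)
    (δ : E × E) :
    IntervalIntegrable (fun t : ℝ => fderiv ℝ D.ϑ (q + t • (q' - q)) (q' - q) (δ.1 + t • (δ.2 - δ.1)) +
      D.ϑ (q + t • (q' - q)) (δ.2 - δ.1)) MeasureTheory.volume 0 1 ∧
    (∫ t in (0 : ℝ)..1, (fderiv ℝ D.ϑ (q + t • (q' - q)) (q' - q) (δ.1 + t • (δ.2 - δ.1)) +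
      D.ϑ (q + t • (q' - q)) (δ.2 - δ.1))) = D.ϑ q' δ.2 - D.ϑ q δ.1 := by
  have hϑ : ∀ t ∈ Icc (0 : ℝ) 1, ContDiffAt ℝ ∞ D.ϑ (q + t • (q' - q)) := fun t ht =>
    D.smooth_ϑ.contDiffAt (D.isOpen_Q.mem_nhds (hseg t ht))
  have hγ' : ∀ t, HasDerivAt (fun t : ℝ => q + t • (q' - q)) (q' - q) t := fun t => by
    simpa using ((hasDerivAt_id t).smul_const (q' - q)).const_add q
  have hη' : ∀ t, HasDerivAt (fun t : ℝ => δ.1 + t • (δ.2 - δ.1)) (δ.2 - δ.1) t := fun t => by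
    simpa using ((hasDerivAt_id t).smul_const (δ.2 - δ.1)).const_add δ.1
  have hder : ∀ t ∈ uIcc (0 : ℝ) 1,
      HasDerivAt (fun t : ℝ => D.ϑ (q + t • (q' - q)) (δ.1 + t • (δ.2 - δ.1)))
      (fderiv ℝ D.ϑ (q + t • (q' - q)) (q' - q) (δ.1 + t • (δ.2 - δ.1)) +
        D.ϑ (q + t • (q' - q)) (δ.2 - δ.1)) t := by
    intro t ht
    rw [uIcc_of_le zero_le_one] at ht
    have h1 := ((hϑ t ht).differentiableAt (by simp)).hasFDerivAt
    have h2 : HasDerivAt (fun t : ℝ => D.ϑ (q + t • (q' - q)))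
        (fderiv ℝ D.ϑ (q + t • (q' - q)) (q' - q)) t :=
      HasFDerivAt.comp_hasDerivAt (l := D.ϑ) (f := fun t : ℝ => q + t • (q' - q)) t h1 (hγ' t)
    exact HasDerivAt.clm_apply h2 (hη' t)
  have hcont : ContinuousOn (fun t : ℝ => fderiv ℝ D.ϑ (q + t • (q' - q)) (q' - q)
      (δ.1 + t • (δ.2 - δ.1)) + D.ϑ (q + t • (q' - q)) (δ.2 - δ.1)) (uIcc 0 1) := by
    intro t ht
    rw [uIcc_of_le zero_le_one] at ht
    have h1 : ContinuousAt (fderiv ℝ D.ϑ) (q + t • (q' - q)) :=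
      ((hϑ t ht).fderiv_right (m := 0) (by simp)).continuousAt
    have h2 : ContinuousAt (fun t : ℝ => fderiv ℝ D.ϑ (q + t • (q' - q))) t :=
      ContinuousAt.comp (f := fun t : ℝ => q + t • (q' - q)) h1 (hγ' t).continuousAt
    have h3 : ContinuousAt (fun t : ℝ => D.ϑ (q + t • (q' - q))) t :=
      ContinuousAt.comp (f := fun t : ℝ => q + t • (q' - q)) (hϑ t ht).continuousAt
        (hγ' t).continuousAt
    exact (((h2.clm_apply continuousAt_const).clm_apply (hη' t).continuousAt).add
      (h3.clm_apply continuousAt_const)).continuousWithinAt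
  refine ⟨hcont.intervalIntegrable, ?_⟩
  rw [intervalIntegral.integral_eq_sub_of_hasDerivAt hder hcont.intervalIntegrable]
  simp

theorem hasFDerivAt_lineIntegral {q q' : E} (hseg : ∀ t ∈ Icc (0 : ℝ) 1, q + t • (q' - q) ∈ D.Q) :
    HasFDerivAt (fun p : E × E => D.lineIntegral p.1 p.2)
      ((-D.ϑ q + (∫ t in (0 : ℝ)..1, (1 - t) • D.omega (q + t • (q' - q))) (q' - q)).comp
          (ContinuousLinearMap.fst ℝ E E) +
        (D.ϑ q' + (∫ t in (0 : ℝ)..1, t • D.omega (q + t • (q' - q))) (q' - q)).comp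
          (ContinuousLinearMap.snd ℝ E E)) (q, q') := by
  have hfs : ∀ t ∈ Icc (0 : ℝ) 1, ContDiffAt ℝ ∞ D.lineIntegrand ((q, q'), t) := fun t ht =>
    contDiffAt_lineIntegrand (hseg t ht)
  have hd := (hasFDerivAt_integral_param fun t ht =>
    (hfs t ht).of_le (by exact_mod_cast le_top)).self_of_nhds
  refine HasFDerivAt.congr_fderiv hd ?_
  have hint : IntervalIntegrable (fun t => (fderiv ℝ D.lineIntegrand ((q, q'), t)).comp
      (ContinuousLinearMap.inl ℝ (E × E) ℝ)) MeasureTheory.volume 0 1 := by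
    refine ContinuousOn.intervalIntegrable fun t ht => ?_
    rw [uIcc_of_le zero_le_one] at ht
    have f1 : ContinuousAt (fderiv ℝ D.lineIntegrand) ((q, q'), t) :=
      ((hfs t ht).fderiv_right (m := 0) (by simp)).continuousAt
    have f2 : ContinuousAt (fun t : ℝ => ((q, q'), t)) t := by fun_prop
    exact ((ContinuousAt.comp (f := fun t : ℝ => ((q, q'), t)) f1 f2).clm_comp
      continuousAt_const).continuousWithinAt
  have hωc : ContinuousOn (fun t : ℝ => D.omega (q + t • (q' - q))) (uIcc 0 1) := by
    intro t ht
    rw [uIcc_of_le zero_le_one] at ht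
    have f2 : ContinuousAt (fun t : ℝ => q + t • (q' - q)) t := by fun_prop
    exact (ContinuousAt.comp (f := fun t : ℝ => q + t • (q' - q))
      (D.contDiffOn_omega.contDiffAt (D.isOpen_Q.mem_nhds (hseg t ht))).continuousAt
      f2).continuousWithinAt
  have hi0 : IntervalIntegrable (fun t : ℝ => (1 - t) • D.omega (q + t • (q' - q)))
      MeasureTheory.volume 0 1 :=
    ((continuous_const.sub continuous_id).continuousOn.smul hωc).intervalIntegrable
  have hi1 : IntervalIntegrable (fun t : ℝ => t • D.omega (q + t • (q' - q)))
      MeasureTheory.volume 0 1 :=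
    (continuous_id.continuousOn.smul hωc).intervalIntegrable
  refine ContinuousLinearMap.ext fun δ => ?_
  obtain ⟨i0, j0⟩ := intervalIntegral_apply_apply hi0 (q' - q) δ.1
  obtain ⟨i1, j1⟩ := intervalIntegral_apply_apply hi1 (q' - q) δ.2
  obtain ⟨i2, j2⟩ := integral_deriv_pairing hseg δ
  have hpt : ∀ t ∈ uIcc (0 : ℝ) 1, _ := fun t ht =>
    fderiv_lineIntegrand (hseg t (by rwa [uIcc_of_le zero_le_one] at ht)) δ
  rw [ContinuousLinearMap.intervalIntegral_apply hint]
  simp only [ContinuousLinearMap.comp_apply, ContinuousLinearMap.inl_apply]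
  rw [intervalIntegral.integral_congr hpt, intervalIntegral.integral_add i2 (i0.add i1), j2,
    intervalIntegral.integral_add i0 i1, ← j0, ← j1]
  simp only [add_apply, ContinuousLinearMap.comp_apply, ContinuousLinearMap.coe_fst',
    ContinuousLinearMap.coe_snd', neg_apply]
  ring

theorem hasFDerivAt_comp_midPt {V : Type*} [NormedAddCommGroup V] [NormedSpace ℝ V] {k : E → V}
    (hk : ContDiffOn ℝ ∞ k D.Q) {p : E × E} (hm : (1 / 2 : ℝ) • p.1 + (1 / 2 : ℝ) • p.2 ∈ D.Q) :
    HasFDerivAt (fun p : E × E => k ((1 / 2 : ℝ) • p.1 + (1 / 2 : ℝ) • p.2))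
      ((fderiv ℝ k ((1 / 2 : ℝ) • p.1 + (1 / 2 : ℝ) • p.2)).comp
        ((1 / 2 : ℝ) • ContinuousLinearMap.fst ℝ E E +
          (1 / 2 : ℝ) • ContinuousLinearMap.snd ℝ E E)) p := by
  have hM : HasFDerivAt (fun p : E × E => (1 / 2 : ℝ) • p.1 + (1 / 2 : ℝ) • p.2)
      ((1 / 2 : ℝ) • ContinuousLinearMap.fst ℝ E E + (1 / 2 : ℝ) • ContinuousLinearMap.snd ℝ E E)
      p := (hasFDerivAt_fst.const_smul _).add (hasFDerivAt_snd.const_smul _)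
  have h1 := ((hk.contDiffAt (D.isOpen_Q.mem_nhds hm)).differentiableAt (by simp)).hasFDerivAt
  exact h1.comp p hM

theorem hasFDerivAt_Sigma {θ₀ : ℝ} {x : E × (E × ℝ)} (hm : D.midPt x ∈ D.Q) :
    HasFDerivAt (fun p : E × E => D.Sigma θ₀ x.2.2 ((1 / 2 : ℝ) • p.1 + (1 / 2 : ℝ) • p.2)
        (p.2 - p.1))
      ((x.2.2 • ((1 / 2 : ℝ) • D.potForce (cot θ₀) x - D.kinForce (cot θ₀) x)).comp
          (ContinuousLinearMap.fst ℝ E E) +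
        (x.2.2 • ((1 / 2 : ℝ) • D.potForce (cot θ₀) x + D.kinForce (cot θ₀) x)).comp
          (ContinuousLinearMap.snd ℝ E E)) (x.1, D.endPt x) := by
  set h := x.2.2 with hh
  have hmid : (1 / 2 : ℝ) • x.1 + (1 / 2 : ℝ) • D.endPt x = D.midPt x := by
    simp only [endPt, midPt]
    module
  have hξ : D.endPt x - x.1 = h • D.vel x := by
    simp only [endPt]
    module
  have hr : h • D.vel x - h • D.XH (D.midPt x) = h • D.relVel x := by
    simp only [relVel, smul_sub]
  have hΞ : HasFDerivAt (fun p : E × E => p.2 - p.1)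
      (ContinuousLinearMap.snd ℝ E E - ContinuousLinearMap.fst ℝ E E) (x.1, D.endPt x) :=
    hasFDerivAt_snd.sub hasFDerivAt_fst
  have hm' : (1 / 2 : ℝ) • (x.1, D.endPt x).1 + (1 / 2 : ℝ) • (x.1, D.endPt x).2 ∈ D.Q := by
    rwa [hmid]
  have h1 := (hasFDerivAt_comp_midPt D.smooth_H hm').const_mul (-h)
  have h2 := ((hasFDerivAt_comp_midPt D.contDiffOn_beta hm').clm_apply hΞ).const_mul (h ^ 2)
  have h3 := hΞ.sub ((hasFDerivAt_comp_midPt D.contDiffOn_XH hm').const_smul h)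
  have h4 := (((hasFDerivAt_comp_midPt D.contDiffOn_g hm').clm_apply h3).clm_apply h3).const_mul (1 / 4 * cot θ₀)
  have h5 := (h1.add h2).sub h4
  simp only [Sigma_eq]
  refine h5.congr_fderiv (ContinuousLinearMap.ext fun δ => ?_)
  simp only [hmid, hξ, hr, potForce, kinForce, add_apply, sub_apply, smul_apply, neg_apply,
    ContinuousLinearMap.comp_apply, ContinuousLinearMap.coe_fst', ContinuousLinearMap.coe_snd',
    ContinuousLinearMap.flip_apply, map_add, map_sub, map_smul, smul_eq_mul, ← hh,
    Pi.sub_apply, Pi.smul_apply]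
  have s1 := fun u => D.g_symm hm u (D.relVel x)
  simp only [s1]
  ring

/-- With $q'-q=h\cdot\mathrm{vel}$ everything beyond $\vartheta$ carries a factor $h$. It matches
one factor of $\hbar^2g(v,\cdot)=\hbar\,g(b+\hbar X_H,\cdot)$, which is why the relations can be
divided by $\hbar$. -/
theorem hasFDerivAt_S {θ₀ : ℝ} {x : E × (E × ℝ)}
    (hx : ∀ t ∈ Icc (0 : ℝ) 1, x.1 + t • (x.2.2 • D.vel x) ∈ D.Q) :
    HasFDerivAt (fun p : E × E => D.S θ₀ x.2.2 p.1 p.2)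
      ((-(D.ϑ x.1 + x.2.2 • D.startForce (cot θ₀) x)).comp (ContinuousLinearMap.fst ℝ E E) +
        (D.ϑ (D.endPt x) + x.2.2 • D.endForce (cot θ₀) x).comp
          (ContinuousLinearMap.snd ℝ E E)) (x.1, D.endPt x) := by
  have hξ : D.endPt x - x.1 = x.2.2 • D.vel x := by
    simp only [endPt]
    module
  have hm : D.midPt x ∈ D.Q := by
    have := hx (1 / 2) ⟨by norm_num, by norm_num⟩
    rwa [smul_smul, show (1 / 2 : ℝ) * x.2.2 = x.2.2 / 2 by ring] at this
  have h1 := hasFDerivAt_lineIntegral (D := D) (q := x.1) (q' := D.endPt x) (by rwa [hξ])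
  refine (h1.add (hasFDerivAt_Sigma (θ₀ := θ₀) hm)).congr_fderiv
    (ContinuousLinearMap.ext fun δ => ?_)
  simp only [hξ, startForce, endForce, avgOmega, add_apply, sub_apply, smul_apply, neg_apply,
    ContinuousLinearMap.comp_apply, ContinuousLinearMap.coe_fst', ContinuousLinearMap.coe_snd',
    map_smul, smul_eq_mul]
  ring

end ExactHamiltonianSystem

/-! ### Smoothness and expansion of the reduced relations -/

namespace ExactHamiltonianSystem

set_option maxSynthPendingDepth 3

variable {E : Type*} [NormedAddCommGroup E] [NormedSpace ℝ E] [FiniteDimensional ℝ E]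
  (D : ExactHamiltonianSystem E)

/-- The points that encode segments contained in `Q`. -/
def dom : Set (E × (E × ℝ)) := {x | ∀ t ∈ Icc (0 : ℝ) 1, x.1 + t • (x.2.2 • D.vel x) ∈ D.Q}

variable {D} {x : E × (E × ℝ)}

theorem fst_mem_of_mem_dom (hx : x ∈ D.dom) : x.1 ∈ D.Q := by
  have := hx 0 ⟨le_rfl, zero_le_one⟩
  simpa using this

theorem endPt_mem (hx : x ∈ D.dom) : D.endPt x ∈ D.Q := by
  have := hx 1 ⟨zero_le_one, le_rfl⟩
  rwa [one_smul] at this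

theorem midPt_mem (hx : x ∈ D.dom) : D.midPt x ∈ D.Q := by
  have := hx (1 / 2) ⟨by norm_num, by norm_num⟩
  rwa [smul_smul, show (1 / 2 : ℝ) * x.2.2 = x.2.2 / 2 by ring] at this

theorem mem_dom_of_h_eq_zero (hx : x.1 ∈ D.Q) (h0 : x.2.2 = 0) : x ∈ D.dom := by
  intro t _
  simpa [h0] using hx

theorem contDiffAt_vel (hx : x.1 ∈ D.Q) : ContDiffAt ℝ ∞ D.vel x :=
  (ContDiffAt.comp x (D.contDiffOn_XH.contDiffAt (D.isOpen_Q.mem_nhds hx)) contDiffAt_fst).add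
    (contDiffAt_fst.comp _ contDiffAt_snd)

theorem contDiffAt_h : ContDiffAt ℝ ∞ (fun x : E × (E × ℝ) => x.2.2) x :=
  contDiffAt_snd.comp _ contDiffAt_snd

theorem contDiffAt_endPt (hx : x.1 ∈ D.Q) : ContDiffAt ℝ ∞ D.endPt x :=
  contDiffAt_fst.add (contDiffAt_h.smul (contDiffAt_vel hx))

theorem contDiffAt_midPt (hx : x.1 ∈ D.Q) : ContDiffAt ℝ ∞ D.midPt x :=
  contDiffAt_fst.add ((contDiffAt_h.div_const 2).smul (contDiffAt_vel hx))

theorem contDiffAt_segment (hx : x.1 ∈ D.Q) (t : ℝ) :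
    ContDiffAt ℝ ∞ (fun z : (E × (E × ℝ)) × ℝ => z.1.1 + z.2 • (z.1.2.2 • D.vel z.1)) (x, t) :=
  (contDiffAt_fst.comp _ contDiffAt_fst).add (contDiffAt_snd.smul
    ((contDiffAt_h.smul (contDiffAt_vel hx)).comp (x, t) contDiffAt_fst))

variable (D) in
theorem isOpen_dom : IsOpen D.dom := by
  rw [isOpen_iff_mem_nhds]
  intro x hx
  refine isCompact_Icc.eventually_forall_of_forall_eventually (x₀ := x) fun t ht => ?_
  exact (contDiffAt_segment (fst_mem_of_mem_dom hx) t).continuousAt.eventually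
    (D.isOpen_Q.mem_nhds (hx t ht))

theorem contDiffAt_comp_midPt {V : Type*} [NormedAddCommGroup V] [NormedSpace ℝ V] {k : E → V}
    (hk : ContDiffOn ℝ ∞ k D.Q) (hx : x ∈ D.dom) : ContDiffAt ℝ ∞ (fun x => k (D.midPt x)) x :=
  ContDiffAt.comp x (hk.contDiffAt (D.isOpen_Q.mem_nhds (midPt_mem hx)))
    (contDiffAt_midPt (fst_mem_of_mem_dom hx))

theorem contDiffAt_comp_endPt {V : Type*} [NormedAddCommGroup V] [NormedSpace ℝ V] {k : E → V}
    (hk : ContDiffOn ℝ ∞ k D.Q) (hx : x ∈ D.dom) : ContDiffAt ℝ ∞ (fun x => k (D.endPt x)) x :=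
  ContDiffAt.comp x (hk.contDiffAt (D.isOpen_Q.mem_nhds (endPt_mem hx)))
    (contDiffAt_endPt (fst_mem_of_mem_dom hx))

theorem contDiffAt_relVel (hx : x ∈ D.dom) : ContDiffAt ℝ ∞ D.relVel x :=
  (contDiffAt_vel (fst_mem_of_mem_dom hx)).sub (contDiffAt_comp_midPt D.contDiffOn_XH hx)

theorem contDiffAt_avgOmega {ρ : ℝ → ℝ} (hρ : ContDiff ℝ ∞ ρ) (hx : x ∈ D.dom) :
    ContDiffAt ℝ ∞ (D.avgOmega ρ) x := by
  refine contDiffAt_integral_param (f := fun z : (E × (E × ℝ)) × ℝ =>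
    ρ z.2 • D.omega (z.1.1 + z.2 • (z.1.2.2 • D.vel z.1))) fun t ht => ?_
  refine (hρ.contDiffAt.comp _ contDiffAt_snd).smul (ContDiffAt.comp (g := D.omega) (x, t) ?_
    (contDiffAt_segment (fst_mem_of_mem_dom hx) t))
  exact D.contDiffOn_omega.contDiffAt (D.isOpen_Q.mem_nhds (hx t ht))

theorem _root_.ContDiffAt.clm_flip {X A B C : Type*} [NormedAddCommGroup X] [NormedSpace ℝ X]
    [NormedAddCommGroup A] [NormedSpace ℝ A] [NormedAddCommGroup B] [NormedSpace ℝ B]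
    [NormedAddCommGroup C] [NormedSpace ℝ C] {f : X → A →L[ℝ] B →L[ℝ] C} {x : X}
    (hf : ContDiffAt ℝ ∞ f x) : ContDiffAt ℝ ∞ (fun x => (f x).flip) x :=
  (ContinuousLinearMap.flipₗᵢ ℝ A B C).contDiff.contDiffAt.comp x hf

theorem contDiffAt_potForce (c : ℝ) (hx : x ∈ D.dom) : ContDiffAt ℝ ∞ (D.potForce c) x := by
  have hr := contDiffAt_relVel hx
  have hβ := contDiffAt_comp_midPt (D.contDiffOn_beta.fderiv_of_isOpen D.isOpen_Q (m := ∞)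
    (by simp)) hx
  have hg := contDiffAt_comp_midPt (D.contDiffOn_g.fderiv_of_isOpen D.isOpen_Q (m := ∞)
    (by simp)) hx
  have hX := contDiffAt_comp_midPt (D.contDiffOn_XH.fderiv_of_isOpen D.isOpen_Q (m := ∞)
    (by simp)) hx
  refine ((contDiffAt_comp_midPt D.contDiffOn_dH hx).neg.add ((contDiffAt_h.pow 2).smul
    (hβ.clm_flip.clm_apply (contDiffAt_vel (fst_mem_of_mem_dom hx))))).sub
    ((contDiffAt_const.mul contDiffAt_h).smul ((((hg.clm_flip.clm_apply hr).clm_flip).clm_apply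
      hr).sub ((((contDiffAt_comp_midPt D.contDiffOn_g hx).clm_apply hr).clm_comp
        hX).const_smul (2 : ℝ))))

theorem contDiffAt_kinForce (c : ℝ) (hx : x ∈ D.dom) : ContDiffAt ℝ ∞ (D.kinForce c) x :=
  (contDiffAt_h.smul (contDiffAt_comp_midPt D.contDiffOn_beta hx)).sub
    (((contDiffAt_comp_midPt D.contDiffOn_g hx).clm_apply (contDiffAt_relVel hx)).const_smul
      (1 / 2 * c))

theorem contDiffAt_startForce (c : ℝ) (hx : x ∈ D.dom) : ContDiffAt ℝ ∞ (D.startForce c) x :=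
  (((((contDiffAt_avgOmega (by fun_prop) hx).clm_apply
    (contDiffAt_vel (fst_mem_of_mem_dom hx))).add
    ((contDiffAt_potForce c hx).const_smul (1 / 2 : ℝ))).sub (contDiffAt_kinForce c hx))).neg

theorem contDiffAt_endForce (c : ℝ) (hx : x ∈ D.dom) : ContDiffAt ℝ ∞ (D.endForce c) x :=
  (((contDiffAt_avgOmega (by fun_prop) hx).clm_apply
    (contDiffAt_vel (fst_mem_of_mem_dom hx))).add
    ((contDiffAt_potForce c hx).const_smul (1 / 2 : ℝ))).add (contDiffAt_kinForce c hx)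

theorem startForce_of_h_eq_zero (c : ℝ) (hx : x.1 ∈ D.Q) (h0 : x.2.2 = 0) :
    D.startForce c x = -((1 / 2 : ℝ) • D.omega x.1 x.2.1) - (1 / 2 * c) • D.g x.1 x.2.1 := by
  have hi : (∫ t in (0 : ℝ)..1, (1 - t)) = 1 / 2 := by
    rw [intervalIntegral.integral_sub (by simp) (by simp)]
    simp
    norm_num
  have ha : D.avgOmega (fun t => 1 - t) x = (1 / 2 : ℝ) • D.omega x.1 := by
    simp only [avgOmega, h0, zero_smul, smul_zero, add_zero]
    rw [intervalIntegral.integral_smul_const, hi]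
  have hm : D.midPt x = x.1 := by simp [midPt, h0]
  have hr : D.relVel x = x.2.1 := by simp [relVel, hm, vel]
  simp only [startForce, potForce, kinForce, ha, hm, hr, h0, ← D.omega_XH hx, vel, map_add,
    smul_apply]
  ext u
  simp
  ring

/-! #### Expansion along the zero section -/

variable (D)

theorem van_XH : Van D.Q 0 (fun x : E × (E × ℝ) => D.XH x.1) :=
  van_of_contDiffOn D.isOpen_Q D.contDiffOn_XH

theorem van_vel : Van D.Q 0 D.vel := D.van_XH.add (van_b D.Q).smooth

theorem van_step : Van D.Q 1 (fun x => x.2.2 • D.vel x) := (van_h D.Q).smul D.van_vel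

theorem van_step_sub : Van D.Q 2 (fun x => x.2.2 • D.vel x - x.2.2 • D.XH x.1) :=
  ((van_h D.Q).smul (van_b D.Q)).congr_fun fun x => by simp only [vel]; module

theorem van_midPt_sub : Van D.Q 1 (fun x => D.midPt x - x.1) :=
  (D.van_step.const_smul (1 / 2)).congr_fun fun x => by simp only [midPt]; module

theorem van_endPt_sub : Van D.Q 1 (fun x => D.endPt x - x.1) :=
  D.van_step.congr_fun fun x => by simp only [endPt]; module

variable {V : Type*} [NormedAddCommGroup V] [NormedSpace ℝ V] [CompleteSpace V]

variable {D} in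
theorem van_comp_midPt_taylor {k : E → V} (hk : ContDiffOn ℝ ∞ k D.Q) :
    Van D.Q 2 (fun x => k (D.midPt x) - (k x.1 + (x.2.2 / 2) • fderiv ℝ k x.1 (D.XH x.1))) := by
  have hdk : ContDiffOn ℝ ∞ (fderiv ℝ k) D.Q := hk.fderiv_of_isOpen D.isOpen_Q (by simp)
  have h1 := van_comp_fst_taylor (n := 0) D.isOpen_Q hk D.van_midPt_sub
  have h2 := (van_of_contDiffOn (Y := E × ℝ) D.isOpen_Q hdk).clm_apply
    (D.van_step_sub.const_smul (1 / 2))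
  refine (h1.add (h2.mono (by omega))).congr_fun fun x => ?_
  have : D.midPt x - x.1 = (1 / 2 : ℝ) • (x.2.2 • D.vel x) := by simp only [midPt]; module
  rw [this]
  simp only [map_sub, map_smul]
  module

variable {D} in
theorem van_comp_midPt_sub {k : E → V} (hk : ContDiffOn ℝ ∞ k D.Q) :
    Van D.Q 1 (fun x => k (D.midPt x) - k x.1) :=
  van_comp_fst_sub D.isOpen_Q hk (van_sub_self_fst D.Q) D.van_midPt_sub D.van_midPt_sub

variable {D} in
theorem van_comp_endPt_sub {k : E → V} (hk : ContDiffOn ℝ ∞ k D.Q) :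
    Van D.Q 1 (fun x => k (D.endPt x) - k x.1) :=
  van_comp_fst_sub D.isOpen_Q hk (van_sub_self_fst D.Q) D.van_endPt_sub D.van_endPt_sub

/-- The acceleration of the Hamiltonian flow. -/
noncomputable def accel (q : E) : E := fderiv ℝ D.XH q (D.XH q)

theorem contDiffOn_accel : ContDiffOn ℝ ∞ D.accel D.Q :=
  (D.contDiffOn_XH.fderiv_of_isOpen D.isOpen_Q (by simp)).clm_apply D.contDiffOn_XH

/-- The first-order part of the relative velocity at the mid point. -/
noncomputable def relVelLin (x : E × (E × ℝ)) : E := x.2.1 - (x.2.2 / 2) • D.accel x.1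

theorem van_relVelLin : Van D.Q 1 D.relVelLin :=
  ((van_b D.Q).sub (((van_h D.Q).smul (van_of_contDiffOn D.isOpen_Q
    D.contDiffOn_accel)).const_smul (1 / 2))).congr_fun fun x => by simp only [relVelLin]; module

theorem van_relVel_sub : Van D.Q 2 (fun x => D.relVel x - D.relVelLin x) :=
  (van_comp_midPt_taylor D.contDiffOn_XH).neg.congr_fun fun x => by
    simp only [relVel, relVelLin, vel, accel]
    module

theorem van_relVel : Van D.Q 1 D.relVel :=
  ((D.van_relVel_sub.mono (by omega)).add D.van_relVelLin).congr_fun fun x => by module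

/-- Product rule in $\omega(X_H,\cdot)=\mathbf dH$. It trades the Hessian of $H$ for the
acceleration and a $\partial\omega$ term of the kind the generating function corrects. -/
theorem fderiv_dH {q : E} (hq : q ∈ D.Q) (u : E) : fderiv ℝ (fderiv ℝ D.H) q u =
    fderiv ℝ D.omega q u (D.XH q) + D.omega q (fderiv ℝ D.XH q u) := by
  have h1 : fderiv ℝ D.H =ᶠ[𝓝 q] fun q => D.omega q (D.XH q) := by
    filter_upwards [D.isOpen_Q.mem_nhds hq] with p hp using (D.omega_XH hp).symm
  have h2 := ((D.contDiffOn_omega.contDiffAt (D.isOpen_Q.mem_nhds hq)).differentiableAt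
    (by simp)).hasFDerivAt
  have h3 := ((D.contDiffOn_XH.contDiffAt (D.isOpen_Q.mem_nhds hq)).differentiableAt
    (by simp)).hasFDerivAt
  rw [h1.fderiv_eq, (h2.clm_apply h3).fderiv]
  simp [add_comm]

variable {D} in
theorem van_comp_midPt {k : E → V} (hk : ContDiffOn ℝ ∞ k D.Q) :
    Van D.Q 0 (fun x => k (D.midPt x)) := van_comp_fst D.isOpen_Q hk D.van_midPt_sub

theorem _root_.Van.clm_flip {X Y A B C : Type*} [NormedAddCommGroup X] [NormedSpace ℝ X]
    [NormedAddCommGroup Y] [NormedSpace ℝ Y] [FiniteDimensional ℝ Y]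
    [NormedAddCommGroup A] [NormedSpace ℝ A] [NormedAddCommGroup B] [NormedSpace ℝ B]
    [NormedAddCommGroup C] [NormedSpace ℝ C] {Q : Set X} {f : X × Y → A →L[ℝ] B →L[ℝ] C}
    (hf : Van Q 0 f) : Van Q 0 (fun x => (f x).flip) := fun q hq => (hf q hq).clm_flip

theorem van_potForce (c : ℝ) : Van D.Q 2 (fun x => D.potForce c x +
    (fderiv ℝ D.H x.1 + (x.2.2 / 2) • fderiv ℝ (fderiv ℝ D.H) x.1 (D.XH x.1))) := by
  have hβ := van_comp_midPt (D.contDiffOn_beta.fderiv_of_isOpen D.isOpen_Q (m := ∞) (by simp))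
  have hg := van_comp_midPt (D.contDiffOn_g.fderiv_of_isOpen D.isOpen_Q (m := ∞) (by simp))
  have hX := van_comp_midPt (D.contDiffOn_XH.fderiv_of_isOpen D.isOpen_Q (m := ∞) (by simp))
  have h1 := van_comp_midPt_taylor D.contDiffOn_dH
  have h2 := ((van_h D.Q).smul (van_h D.Q)).smul (hβ.clm_flip.clm_apply D.van_vel)
  have h3 := (van_h D.Q).smul (Van.clm_apply (n := 1)
    (Van.clm_flip (hg.clm_flip.clm_apply D.van_relVel).smooth) D.van_relVel)
  have h4 := (van_h D.Q).smul (Van.clm_comp (n := 0)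
    ((van_comp_midPt D.contDiffOn_g).clm_apply D.van_relVel) hX)
  refine (((h1.neg.add (h2.mono (by omega))).sub ((h3.const_smul (1 / 4 * c)).mono
    (by omega))).add ((h4.const_smul (1 / 2 * c)).mono (by omega))).congr_fun fun x => ?_
  simp only [potForce]
  module

theorem van_kinForce (c : ℝ) : Van D.Q 2 (fun x => D.kinForce c x -
    (x.2.2 • D.beta x.1 - (1 / 2 * c) • D.g x.1 (D.relVelLin x))) := by
  have h1 := (van_h D.Q).smul (van_comp_midPt_sub D.contDiffOn_beta)
  have h2 := (van_comp_midPt_sub D.contDiffOn_g).clm_apply D.van_relVel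
  have h3 := (van_of_contDiffOn (Y := E × ℝ) D.isOpen_Q D.contDiffOn_g).clm_apply D.van_relVel_sub
  refine ((h1.mono (by omega)).sub (((h2.add (h3.mono (by omega))).const_smul
    (1 / 2 * c)))).congr_fun fun x => ?_
  simp only [kinForce, map_sub, sub_apply]
  module

theorem van_avgOmega {ρ : ℝ → ℝ} (hρ : ContDiff ℝ ∞ ρ) :
    Van D.Q 2 (fun x => D.avgOmega ρ x (D.vel x) - ((∫ t in (0 : ℝ)..1, ρ t) •
      D.omega x.1 (D.vel x) + ((∫ t in (0 : ℝ)..1, t * ρ t) * x.2.2) •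
        fderiv ℝ D.omega x.1 (D.XH x.1) (D.XH x.1))) := by
  have hdω := van_of_contDiffOn (Y := E × ℝ) D.isOpen_Q
    (D.contDiffOn_omega.fderiv_of_isOpen D.isOpen_Q (m := ∞) (by simp))
  have h1 := (van_integral_taylor D.isOpen_Q D.contDiffOn_omega D.van_step hρ).clm_apply D.van_vel
  have h2 := (hdω.clm_apply D.van_step_sub).clm_apply D.van_vel
  have h3 := (hdω.clm_apply ((van_h D.Q).smul D.van_XH)).clm_apply (van_b D.Q)
  refine ((h1.mono (by omega)).add (((h2.mono (by omega)).add (h3.mono (by omega))).const_smul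
    (∫ t in (0 : ℝ)..1, t * ρ t))).congr_fun fun x => ?_
  simp only [avgOmega, vel, map_sub, map_add, map_smul, sub_apply, add_apply, smul_apply]
  module

/-- The terms $\partial\omega(X_H,X_H,\cdot)$ cancel: $\tfrac16$ from the weighted average of
$\omega$, $-\tfrac14$ from the Hessian of $H$, and $\tfrac1{12}$ from the correction in $\Sigma$. -/
theorem van_startForce (c : ℝ) : Van D.Q 2 (fun x => D.startForce c x -
    (x.2.2 • D.g x.1 (D.XH x.1) - ((1 / 2 : ℝ) • D.omega x.1 (D.relVelLin x) +
      (1 / 2 * c) • D.g x.1 (D.relVelLin x)))) := by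
  have i1 : (∫ t in (0 : ℝ)..1, (1 - t)) = 1 / 2 := by
    rw [intervalIntegral.integral_sub (by simp) (by simp)]
    simp
    norm_num
  have i2 : (∫ t in (0 : ℝ)..1, t * (1 - t)) = 1 / 6 := by
    have : (fun t : ℝ => t * (1 - t)) = fun t => t ^ 1 - t ^ 2 := by ext t; ring
    rw [this, intervalIntegral.integral_sub (by simp) (by simp)]
    simp only [integral_pow]
    norm_num
  have h1 := D.van_avgOmega (ρ := fun t => 1 - t) (by fun_prop)
  rw [i1, i2] at h1
  refine ((h1.add ((D.van_potForce c).const_smul (1 / 2))).sub (D.van_kinForce c)).neg.congr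
    fun q hq => ?_
  filter_upwards [continuousAt_fst.eventually (D.isOpen_Q.mem_nhds hq)] with x hx
  simp only [startForce, D.fderiv_dH hx, ← D.omega_XH hx, beta, vel, relVelLin, accel, map_add,
    map_sub, map_smul]
  module

/-- At the other end the balance is $\tfrac13-\tfrac14-\tfrac1{12}=0$, so the coefficient
$\tfrac1{12}$ serves both ends. -/
theorem van_endForce (c : ℝ) : Van D.Q 2 (fun x => D.endForce c x -
    (x.2.2 • D.g x.1 (D.XH x.1) + ((1 / 2 : ℝ) • D.omega x.1 (D.relVelLin x) -
      (1 / 2 * c) • D.g x.1 (D.relVelLin x)))) := by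
  have i1 : (∫ t in (0 : ℝ)..1, t) = 1 / 2 := by
    simp
  have i2 : (∫ t in (0 : ℝ)..1, t * t) = 1 / 3 := by
    have : (fun t : ℝ => t * t) = fun t => t ^ 2 := by ext t; ring
    rw [this]
    simp only [integral_pow]
    norm_num
  have h1 := D.van_avgOmega (ρ := fun t => t) (by fun_prop)
  rw [i1, i2] at h1
  refine ((h1.add ((D.van_potForce c).const_smul (1 / 2))).add (D.van_kinForce c)).congr
    fun q hq => ?_
  filter_upwards [continuousAt_fst.eventually (D.isOpen_Q.mem_nhds hq)] with x hx
  simp only [endForce, D.fderiv_dH hx, ← D.omega_XH hx, beta, vel, relVelLin, accel, map_add,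
    map_sub, map_smul]
  module

end ExactHamiltonianSystem

/-! ### The reduced map -/

namespace ExactHamiltonianSystem

set_option maxSynthPendingDepth 3

variable {E : Type*} [NormedAddCommGroup E] [NormedSpace ℝ E] [FiniteDimensional ℝ E]
  (D : ExactHamiltonianSystem E)

/-- The rescaled initial velocity `h (v - X_H)` of the segment encoded by `x`. -/
noncomputable def startB (c : ℝ) (x : E × (E × ℝ)) : E :=
  D.sharp x.1 (D.startForce c x) - x.2.2 • D.XH x.1

/-- The rescaled final velocity `h (v' - X_H)` of the segment encoded by `x`. -/
noncomputable def endB (c : ℝ) (x : E × (E × ℝ)) : E :=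
  D.sharp (D.endPt x) (D.endForce c x) - x.2.2 • D.XH (D.endPt x)

/-- The linear part of `startB` in the fibre direction. -/
noncomputable def tilt (c : ℝ) (q : E) : E →L[ℝ] E :=
  -((1 / 2 : ℝ) • (D.J q + c • ContinuousLinearMap.id ℝ E))

theorem tilt_apply (c : ℝ) (q u : E) : D.tilt c q u = -((1 / 2 : ℝ) • (D.J q u + c • u)) := rfl

variable {D} {x : E × (E × ℝ)}

theorem g_startB (c : ℝ) (hx : x.1 ∈ D.Q) :
    D.g x.1 (D.startB c x + x.2.2 • D.XH x.1) = D.startForce c x := by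
  rw [startB, sub_add_cancel, D.g_sharp hx]

theorem g_endB (c : ℝ) (hx : D.endPt x ∈ D.Q) :
    D.g (D.endPt x) (D.endB c x + x.2.2 • D.XH (D.endPt x)) = D.endForce c x := by
  rw [endB, sub_add_cancel, D.g_sharp hx]

theorem contDiffAt_startB (c : ℝ) (hx : x ∈ D.dom) : ContDiffAt ℝ ∞ (D.startB c) x := by
  have hq := D.isOpen_Q.mem_nhds (fst_mem_of_mem_dom hx)
  exact ((ContDiffAt.comp x (D.contDiffOn_sharp.contDiffAt hq) contDiffAt_fst).clm_apply
    (contDiffAt_startForce c hx)).sub (contDiffAt_h.smul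
      (ContDiffAt.comp x (D.contDiffOn_XH.contDiffAt hq) contDiffAt_fst))

theorem contDiffAt_endB (c : ℝ) (hx : x ∈ D.dom) : ContDiffAt ℝ ∞ (D.endB c) x :=
  ((contDiffAt_comp_endPt D.contDiffOn_sharp hx).clm_apply (contDiffAt_endForce c hx)).sub
    (contDiffAt_h.smul (contDiffAt_comp_endPt D.contDiffOn_XH hx))

theorem startB_of_h_eq_zero (c : ℝ) (hx : x.1 ∈ D.Q) (h0 : x.2.2 = 0) :
    D.startB c x = D.tilt c x.1 x.2.1 := by
  rw [startB, startForce_of_h_eq_zero c hx h0, h0, zero_smul, sub_zero, map_sub, map_neg,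
    map_smul, map_smul, D.sharp_omega hx, D.sharp_g hx, tilt_apply]
  module

/-- $(c-J)(c+J)=1+c^2$ is nonzero for every real $c$. -/
theorem tilt_injective (c : ℝ) {q : E} (hq : q ∈ D.Q) {u : E} (hu : D.tilt c q u = 0) : u = 0 := by
  rw [tilt_apply, neg_eq_zero, smul_eq_zero_iff_right (by norm_num)] at hu
  have h1 := congrArg (D.J q) hu
  rw [map_add, D.J_sq q hq, map_smul, map_zero] at h1
  have h2 : (1 + c ^ 2) • u = 0 := by
    have : (1 + c ^ 2) • u = c • (D.J q u + c • u) - (-u + c • D.J q u) := by module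
    rw [this, hu, h1, smul_zero, sub_zero]
  exact (smul_eq_zero_iff_right (by positivity)).1 h2

variable (D)

theorem van_relVelLin_tilt (c : ℝ) : Van D.Q 2 (fun x => D.startB c x -
    D.tilt c x.1 (D.relVelLin x)) := by
  have hs := van_of_contDiffOn (Y := E × ℝ) D.isOpen_Q D.contDiffOn_sharp
  refine ((hs.clm_apply (D.van_startForce c)).mono (by omega)).congr fun q hq => ?_
  filter_upwards [continuousAt_fst.eventually (D.isOpen_Q.mem_nhds hq)] with x hx
  simp only [startB, map_sub, map_add, map_smul, D.sharp_omega hx, D.sharp_g hx, tilt_apply]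
  module

theorem van_endB_sub (c : ℝ) : Van D.Q 2 (fun x => D.endB c x -
    (1 / 2 : ℝ) • (D.J x.1 (D.relVelLin x) - c • D.relVelLin x)) := by
  have hs := van_of_contDiffOn (Y := E × ℝ) D.isOpen_Q D.contDiffOn_sharp
  have hω := van_of_contDiffOn (Y := E × ℝ) D.isOpen_Q D.contDiffOn_omega
  have hg := van_of_contDiffOn (Y := E × ℝ) D.isOpen_Q D.contDiffOn_g
  have hlin : Van D.Q 1 (fun x => x.2.2 • D.g x.1 (D.XH x.1) +
      ((1 / 2 : ℝ) • D.omega x.1 (D.relVelLin x) - (1 / 2 * c) • D.g x.1 (D.relVelLin x))) :=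
    ((van_h D.Q).smul (hg.clm_apply D.van_XH)).add
      ((((hω.clm_apply D.van_relVelLin).const_smul _).sub
        ((hg.clm_apply D.van_relVelLin).const_smul _)).mono (by omega))
  have hF : Van D.Q 1 (D.endForce c) :=
    (((D.van_endForce c).mono (by omega)).add hlin).congr_fun fun x => by module
  have h1 := (van_comp_endPt_sub D.contDiffOn_sharp).clm_apply hF
  have h2 := hs.clm_apply (D.van_endForce c)
  have h3 := (van_h D.Q).smul (van_comp_endPt_sub D.contDiffOn_XH)
  refine ((h1.add (h2.mono (by omega))).sub h3).congr fun q hq => ?_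
  filter_upwards [continuousAt_fst.eventually (D.isOpen_Q.mem_nhds hq)] with x hx
  simp only [endB, map_sub, map_add, map_smul, D.sharp_omega hx, D.sharp_g hx, sub_apply]
  module

/-- The map `x ↦ (q, (b, h))` that sends a segment to its rescaled initial state. -/
noncomputable def initialState (c : ℝ) (x : E × (E × ℝ)) : E × (E × ℝ) :=
  (x.1, (D.startB c x, x.2.2))

variable {D}

theorem contDiffAt_initialState (c : ℝ) (hx : x ∈ D.dom) :
    ContDiffAt ℝ ∞ (D.initialState c) x :=
  contDiffAt_fst.prodMk ((contDiffAt_startB c hx).prodMk contDiffAt_h)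

/-- The derivative is the identity on the $q$ and $h$ components and `tilt` on the fibre direction,
so it is block triangular and injective. -/
theorem isInvertible_fderiv_initialState (c : ℝ) {q : E} (hq : q ∈ D.Q) :
    (fderiv ℝ (D.initialState c) (q, 0)).IsInvertible := by
  have hdom : (q, (0 : E × ℝ)) ∈ D.dom := mem_dom_of_h_eq_zero hq rfl
  have h1 := ((contDiffAt_startB c hdom).differentiableAt (by simp)).hasFDerivAt
  have h2 : HasFDerivAt (fun x : E × (E × ℝ) => x.2.2)
      ((ContinuousLinearMap.snd ℝ E ℝ).comp (ContinuousLinearMap.snd ℝ E (E × ℝ))) (q, 0) :=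
    ((ContinuousLinearMap.snd ℝ E ℝ).comp (ContinuousLinearMap.snd ℝ E (E × ℝ))).hasFDerivAt
  have h3 : fderiv ℝ (D.initialState c) (q, 0) = _ :=
    (hasFDerivAt_fst.prodMk (h1.prodMk h2)).fderiv
  have hfib : ∀ w : E, fderiv ℝ (D.startB c) (q, 0) (0, (w, 0)) = D.tilt c q w := by
    intro w
    have e1 : HasDerivAt (fun s : ℝ => (q, (s • w, (0 : ℝ)))) ((0 : E), (w, (0 : ℝ))) (0 : ℝ) := by
      have := (hasDerivAt_const (0 : ℝ) q).prodMk
        (((hasDerivAt_id (0 : ℝ)).smul_const w).prodMk (hasDerivAt_const (0 : ℝ) (0 : ℝ)))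
      simpa using this
    have e2 : HasDerivAt (fun s : ℝ => D.startB c (q, (s • w, (0 : ℝ))))
        (fderiv ℝ (D.startB c) (q, 0) (0, (w, 0))) 0 := by
      refine HasFDerivAt.comp_hasDerivAt (l := D.startB c)
        (f := fun s : ℝ => (q, (s • w, (0 : ℝ)))) (0 : ℝ) ?_ e1
      have e0 : (q, ((0 : ℝ) • w, (0 : ℝ))) = (q, (0 : E × ℝ)) := by
        rw [zero_smul, Prod.mk_zero_zero]
      rwa [e0]
    have e3 : (fun s : ℝ => D.startB c (q, (s • w, (0 : ℝ)))) = fun s => s • D.tilt c q w := by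
      ext1 s
      rw [startB_of_h_eq_zero c hq rfl, map_smul]
    rw [e3] at e2
    have e4 : HasDerivAt (fun s : ℝ => s • D.tilt c q w) (D.tilt c q w) 0 := by
      simpa using (hasDerivAt_id (0 : ℝ)).smul_const (D.tilt c q w)
    exact e2.unique e4
  set L := fderiv ℝ (D.initialState c) (q, 0) with hL
  have hinj : Function.Injective (L : E × (E × ℝ) →ₗ[ℝ] E × (E × ℝ)) := by
    rw [← LinearMap.ker_eq_bot, LinearMap.ker_eq_bot']
    rintro ⟨u, w, s⟩ hu
    have hu' : L (u, (w, s)) = 0 := hu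
    rw [h3] at hu'
    have hu1 : u = 0 := congrArg Prod.fst hu'
    have hu2 : s = 0 := congrArg (fun z => z.2.2) hu'
    have hu3 : fderiv ℝ (D.startB c) (q, 0) (u, (w, s)) = 0 := congrArg (fun z => z.2.1) hu'
    rw [hu1, hu2, hfib] at hu3
    rw [hu1, hu2, tilt_injective c hq hu3]
    rfl
  refine ⟨(LinearEquiv.ofInjectiveEndo _ hinj).toContinuousLinearEquiv, ?_⟩
  exact ContinuousLinearMap.ext fun u => rfl

/-- `S` is a smooth inverse of `initialState` on the neighbourhood `N` of the zero section. -/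
structure IsReducedInverse (D : ExactHamiltonianSystem E) (c : ℝ) (N : Set (E × (E × ℝ)))
    (S : E × (E × ℝ) → E × (E × ℝ)) : Prop where
  isOpen : IsOpen N
  mem : ∀ q ∈ D.Q, (q, 0) ∈ N
  smooth : ∀ y ∈ N, ContDiffAt ℝ ∞ S y
  right_inv : ∀ y ∈ N, D.initialState c (S y) = y
  mem_dom : ∀ y ∈ N, S y ∈ D.dom
  zero : ∀ q ∈ D.Q, S (q, 0) = (q, 0)
  left_inv : ∀ q ∈ D.Q, ∀ᶠ x in 𝓝 (q, (0 : E × ℝ)), S (D.initialState c x) = x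

theorem eventually_mem_dom {q : E} (hq : q ∈ D.Q) : ∀ᶠ x in 𝓝 (q, (0 : E × ℝ)), x ∈ D.dom :=
  D.isOpen_dom.mem_nhds (mem_dom_of_h_eq_zero hq rfl)

variable (D) in
theorem exists_isReducedInverse (c : ℝ) : ∃ N S, IsReducedInverse D c N S := by
  have : CompleteSpace E := FiniteDimensional.complete ℝ E
  have h0 : ∀ q ∈ D.Q, D.initialState c (q, 0) = (q, 0) := fun q hq => by
    have h : D.startB c (q, (0 : E × ℝ)) = 0 := by
      rw [startB_of_h_eq_zero c (x := (q, (0 : E × ℝ))) hq rfl]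
      exact map_zero _
    simp only [initialState, h]
    rfl
  obtain ⟨N, S, h1, h2, h3, h4, h5⟩ := exists_inverse_near_zero_section (Q := D.Q)
    (B := D.initialState c) (p := fun x => x ∈ D.dom)
    (fun q hq => (eventually_mem_dom hq).mono fun x hx => contDiffAt_initialState c hx)
    (fun x => rfl) h0 (fun q hq => isInvertible_fderiv_initialState c hq)
    (fun q hq => eventually_mem_dom hq)
  exact ⟨N, S, h1, h2, fun y hy => (h3 y hy).1, fun y hy => (h3 y hy).2.1,
    fun y hy => (h3 y hy).2.2, h4, h5⟩

namespace IsReducedInverse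

variable {c : ℝ} {N : Set (E × (E × ℝ))} {S : E × (E × ℝ) → E × (E × ℝ)}
  {y : E × (E × ℝ)} {θ₀ : ℝ}

theorem fst_eq (h : IsReducedInverse D c N S) (hy : y ∈ N) : (S y).1 = y.1 :=
  (congrArg (fun z => z.1) (h.right_inv y hy) :)

theorem startB_eq (h : IsReducedInverse D c N S) (hy : y ∈ N) : D.startB c (S y) = y.2.1 :=
  (congrArg (fun z => z.2.1) (h.right_inv y hy) :)

theorem h_eq (h : IsReducedInverse D c N S) (hy : y ∈ N) : (S y).2.2 = y.2.2 :=
  (congrArg (fun z => z.2.2) (h.right_inv y hy) :)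

theorem fst_mem (h : IsReducedInverse D c N S) (hy : y ∈ N) : y.1 ∈ D.Q := by
  rw [← h.fst_eq hy]
  exact fst_mem_of_mem_dom (h.mem_dom y hy)

theorem fixZ (h : IsReducedInverse D c N S) : FixZ D.Q S :=
  ⟨fun q hq => h.smooth _ (h.mem q hq), h.zero⟩

theorem eventually_mem (h : IsReducedInverse D c N S) {q : E} (hq : q ∈ D.Q) :
    ∀ᶠ y in 𝓝 (q, (0 : E × ℝ)), y ∈ N := h.isOpen.mem_nhds (h.mem q hq)

theorem contDiffAt_endPt (h : IsReducedInverse D c N S) (hy : y ∈ N) :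
    ContDiffAt ℝ ∞ (fun y => D.endPt (S y)) y :=
  ContDiffAt.comp y (ExactHamiltonianSystem.contDiffAt_endPt
    (fst_mem_of_mem_dom (h.mem_dom y hy))) (h.smooth y hy)

theorem contDiffAt_endB (h : IsReducedInverse D c N S) (hy : y ∈ N) :
    ContDiffAt ℝ ∞ (fun y => D.endB c (S y)) y :=
  ContDiffAt.comp y (ExactHamiltonianSystem.contDiffAt_endB c (h.mem_dom y hy)) (h.smooth y hy)

theorem endB_zero {q : E} (hq : q ∈ D.Q) : D.endB c (q, 0) = 0 := by
  have h1 := (D.van_endB_sub c).eq_zero hq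
  have h2 : D.relVelLin (q, 0) = 0 := D.van_relVelLin.eq_zero hq
  simpa [h2] using h1

theorem fixZ_mapOf (h : IsReducedInverse D c N S) :
    FixZ D.Q (mapOf (fun y => D.endPt (S y)) (fun y => D.endB c (S y))) := by
  refine ⟨fun q hq => (h.contDiffAt_endPt (h.mem q hq)).prodMk
    ((h.contDiffAt_endB (h.mem q hq)).prodMk contDiffAt_h), fun q hq => ?_⟩
  simp [mapOf, h.zero q hq, endB_zero hq, endPt]

/-- The inverse of `tilt`. -/
noncomputable def untilt (D : ExactHamiltonianSystem E) (θ₀ : ℝ) (q : E) : E →L[ℝ] E :=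
  (1 - Real.cos θ₀) • D.J q - Real.sin θ₀ • ContinuousLinearMap.id ℝ E

theorem untilt_apply (q u : E) : untilt D θ₀ q u =
    (1 - Real.cos θ₀) • D.J q u - Real.sin θ₀ • u := rfl

theorem cot_mul (hθ : 1 - Real.cos θ₀ ≠ 0) : cot θ₀ * (1 - Real.cos θ₀) = Real.sin θ₀ := by
  rw [cot, div_mul_cancel₀ _ hθ]

theorem sin_mul_cot (hθ : 1 - Real.cos θ₀ ≠ 0) : Real.sin θ₀ * cot θ₀ = 1 + Real.cos θ₀ := by
  rw [cot, mul_div_assoc', div_eq_iff hθ]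
  linear_combination Real.sin_sq_add_cos_sq θ₀

theorem untilt_tilt (hθ : 1 - Real.cos θ₀ ≠ 0) {q : E} (hq : q ∈ D.Q) (u : E) :
    untilt D θ₀ q (D.tilt (cot θ₀) q u) = u := by
  have h1 : (cot θ₀ * (1 - Real.cos θ₀)) • D.J q u = Real.sin θ₀ • D.J q u := by rw [cot_mul hθ]
  have h2 : (Real.sin θ₀ * cot θ₀) • u = (1 + Real.cos θ₀) • u := by rw [sin_mul_cot hθ]
  simp only [untilt_apply, tilt_apply, map_neg, map_smul, map_add, D.J_sq q hq]
  linear_combination (norm := module) (-(1 / 2 : ℝ)) • h1 + (1 / 2 : ℝ) • h2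

/-- With $J$ read as $i$ and $c=\cot(\theta_0/2)$ this is $(c-i)/(c+i)=e^{-i\theta_0}$. It explains
the coefficient in $\Sigma$: the passage from the initial to the final velocity is exactly a
rotation at leading order. -/
theorem rot_tilt (hθ : 1 - Real.cos θ₀ ≠ 0) {q : E} (hq : q ∈ D.Q) (u : E) :
    rot D.J (-θ₀) q (D.tilt (cot θ₀) q u) = (1 / 2 : ℝ) • (D.J q u - cot θ₀ • u) := by
  have h1 : (cot θ₀ * (1 - Real.cos θ₀)) • u = Real.sin θ₀ • u := by rw [cot_mul hθ]
  have h2 : (Real.sin θ₀ * cot θ₀) • D.J q u = (1 + Real.cos θ₀) • D.J q u := by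
    rw [sin_mul_cot hθ]
  simp only [rot_apply, tilt_apply, map_neg, map_smul, map_add, D.J_sq q hq, Real.cos_neg,
    Real.sin_neg]
  linear_combination (norm := module) (1 / 2 : ℝ) • h1 + (1 / 2 : ℝ) • h2

theorem untilt_eq (q u : E) (hq : q ∈ D.Q) :
    untilt D θ₀ q u = D.J q u - D.J q (rot D.J (-θ₀) q u) := by
  simp only [rot_apply, untilt_apply, map_smul, map_add, D.J_sq q hq, Real.cos_neg, Real.sin_neg]
  module

theorem van_untilt (D : ExactHamiltonianSystem E) (θ₀ : ℝ) :
    Van D.Q 0 (fun x : E × (E × ℝ) => untilt D θ₀ x.1) :=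
  van_of_contDiffOn D.isOpen_Q ((D.smooth_J.const_smul _).sub contDiffOn_const)

theorem van_relVelLin_sub (h : IsReducedInverse D (cot θ₀) N S) (hθ : 1 - Real.cos θ₀ ≠ 0) :
    Van D.Q 2 (fun y => D.relVelLin (S y) - untilt D θ₀ y.1 y.2.1) := by
  have h1 := (D.van_relVelLin_tilt (cot θ₀)).comp D.isOpen_Q h.fixZ
  have h2 := (van_untilt D θ₀).clm_apply h1
  refine (h2.mono (n := 0 + 2) le_rfl).neg.congr fun q hq => ?_
  filter_upwards [h.eventually_mem hq] with y hy
  rw [h.startB_eq hy, h.fst_eq hy, map_sub, untilt_tilt hθ (h.fst_mem hy)]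
  module

/-- The displacement is $h(X_H+W)$ with $W$ equal to the linearized relative velocity plus $\tfrac
h2$ times the acceleration. `untilt` expresses the former as $Jb-J\,\mathrm{rot}_{-\theta_0}b$, the
coboundary needed for the normal form. -/
theorem van_endPt (h : IsReducedInverse D (cot θ₀) N S) (hθ : 1 - Real.cos θ₀ ≠ 0) :
    Van D.Q 3 (fun x => D.endPt (S x) - (x.1 + x.2.2 • D.XH x.1 +
      x.2.2 ^ 2 • ((1 / 2 : ℝ) • D.accel x.1) +
      x.2.2 • (D.J x.1 x.2.1 - D.J x.1 (rot D.J (-θ₀) x.1 x.2.1)))) := by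
  have h1 := (van_h D.Q).smul (h.van_relVelLin_sub hθ)
  refine (h1.mono (by omega)).congr fun q hq => ?_
  filter_upwards [h.eventually_mem hq] with y hy
  simp only [endPt, vel, relVelLin, h.fst_eq hy, h.h_eq hy, ← untilt_eq _ _ (h.fst_mem hy)]
  module

theorem van_endB (h : IsReducedInverse D (cot θ₀) N S) (hθ : 1 - Real.cos θ₀ ≠ 0) :
    Van D.Q 2 (fun x => D.endB (cot θ₀) (S x) - rot D.J (-θ₀) x.1 x.2.1) := by
  have h1 := (D.van_relVelLin_tilt (cot θ₀)).comp D.isOpen_Q h.fixZ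
  have h2 := (van_rot D.isOpen_Q D.smooth_J (-θ₀)).clm_apply h1
  have h3 := (D.van_endB_sub (cot θ₀)).comp D.isOpen_Q h.fixZ
  refine (h3.sub (h2.mono (n := 0 + 2) le_rfl)).congr fun q hq => ?_
  filter_upwards [h.eventually_mem hq] with y hy
  rw [h.startB_eq hy, h.fst_eq hy, map_sub, rot_tilt hθ (h.fst_mem hy)]
  module

end IsReducedInverse

end ExactHamiltonianSystem

/-! ### Symplectic Lorentz maps -/

namespace ExactHamiltonianSystem

set_option maxSynthPendingDepth 3

variable {E : Type*} [NormedAddCommGroup E] [NormedSpace ℝ E] [FiniteDimensional ℝ E]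
  {D : ExactHamiltonianSystem E} {x y : E × (E × ℝ)} {θ₀ : ℝ} {N : Set (E × (E × ℝ))}
  {S : E × (E × ℝ) → E × (E × ℝ)}

theorem contDiffAt_S_endPt (hx : x ∈ D.dom) :
    ContDiffAt ℝ ∞ (fun x => D.S θ₀ x.2.2 x.1 (D.endPt x)) x := by
  have hq := fst_mem_of_mem_dom hx
  have he := contDiffAt_endPt hq
  have h1 : ContDiffAt ℝ ∞ (fun x => D.lineIntegral x.1 (D.endPt x)) x := by
    refine contDiffAt_integral_param
      (f := fun z : (E × (E × ℝ)) × ℝ => D.lineIntegrand ((z.1.1, D.endPt z.1), z.2))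
      fun t ht => ?_
    refine ContDiffAt.comp (g := D.lineIntegrand) (x, t) (contDiffAt_lineIntegrand ?_)
      (((contDiffAt_fst.comp _ contDiffAt_fst).prodMk (he.comp (x, t) contDiffAt_fst)).prodMk
        contDiffAt_snd)
    have := hx t ht
    simpa [endPt] using this
  have hmid : ∀ x, (1 / 2 : ℝ) • x.1 + (1 / 2 : ℝ) • D.endPt x = D.midPt x := fun x => by
    simp only [endPt, midPt]
    module
  have hξ : ContDiffAt ℝ ∞ (fun x => D.endPt x - x.1) x := he.sub contDiffAt_fst
  have hr := hξ.sub (contDiffAt_h.smul (contDiffAt_comp_midPt D.contDiffOn_XH hx))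
  have h2 : ContDiffAt ℝ ∞ (fun x => D.Sigma θ₀ x.2.2 (D.midPt x) (D.endPt x - x.1)) x := by
    simp only [Sigma_eq]
    exact ((contDiffAt_h.neg.mul (contDiffAt_comp_midPt D.smooth_H hx)).add
      ((contDiffAt_h.pow 2).mul ((contDiffAt_comp_midPt D.contDiffOn_beta hx).clm_apply
        hξ))).sub (contDiffAt_const.mul
          (((contDiffAt_comp_midPt D.contDiffOn_g hx).clm_apply hr).clm_apply hr))
  simp only [ExactHamiltonianSystem.S, hmid]
  exact h1.add h2

namespace IsReducedInverse

theorem contDiffAt_S (h : IsReducedInverse D (cot θ₀) N S) (hy : y ∈ N) :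
    ContDiffAt ℝ ∞ (fun y => D.S θ₀ y.2.2 y.1 (D.endPt (S y))) y := by
  have h1 : ContDiffAt ℝ ∞ (fun y => D.S θ₀ (S y).2.2 (S y).1 (D.endPt (S y))) y :=
    ContDiffAt.comp (g := fun x : E × (E × ℝ) => D.S θ₀ x.2.2 x.1 (D.endPt x)) (f := S) y
      (contDiffAt_S_endPt (h.mem_dom y hy)) (h.smooth y hy)
  refine h1.congr_of_eventuallyEq ?_
  filter_upwards [h.isOpen.mem_nhds hy] with z hz
  rw [h.fst_eq hz, h.h_eq hz]

/-- The reduced map is exact symplectic on the slices of constant `h`, with generating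
function `S`. -/
theorem actionForm_sub (h : IsReducedInverse D (cot θ₀) N S) (hy : y ∈ N) (v : E × (E × ℝ))
    (hv : v.2.2 = 0) :
    actionForm D.ϑ D.g D.XH (mapOf (fun y => D.endPt (S y)) (fun y => D.endB (cot θ₀) (S y)) y)
        (fderiv ℝ (fun y => D.endPt (S y)) y v) - actionForm D.ϑ D.g D.XH y v.1 =
      fderiv ℝ (fun y => D.S θ₀ y.2.2 y.1 (D.endPt (S y))) y v := by
  have hd := h.mem_dom y hy
  have hS := hasFDerivAt_S (θ₀ := θ₀) hd
  have hσ := ((h.contDiffAt_S hy).differentiableAt (by simp)).hasFDerivAt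
  have hE := ((h.contDiffAt_endPt hy).differentiableAt (by simp)).hasFDerivAt
  have hline : HasDerivAt (fun s : ℝ => y + s • v) v 0 := by
    simpa using ((hasDerivAt_id (0 : ℝ)).smul_const v).const_add y
  have hy0 : y + (0 : ℝ) • v = y := by simp
  have e1 : HasDerivAt (fun s : ℝ => D.endPt (S (y + s • v)))
      (fderiv ℝ (fun y => D.endPt (S y)) y v) 0 := by
    refine HasFDerivAt.comp_hasDerivAt (l := fun y => D.endPt (S y))
      (f := fun s : ℝ => y + s • v) (0 : ℝ) ?_ hline
    rwa [hy0]
  have e2 : HasDerivAt (fun s : ℝ => D.S θ₀ (y + s • v).2.2 (y + s • v).1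
      (D.endPt (S (y + s • v)))) (fderiv ℝ (fun y => D.S θ₀ y.2.2 y.1 (D.endPt (S y))) y v) 0 := by
    refine HasFDerivAt.comp_hasDerivAt (l := fun y => D.S θ₀ y.2.2 y.1 (D.endPt (S y)))
      (f := fun s : ℝ => y + s • v) (0 : ℝ) ?_ hline
    rwa [hy0]
  have e3 : HasDerivAt (fun s : ℝ => (y.1 + s • v.1, D.endPt (S (y + s • v))))
      (v.1, fderiv ℝ (fun y => D.endPt (S y)) y v) 0 := by
    refine HasDerivAt.prodMk ?_ e1
    simpa using ((hasDerivAt_id (0 : ℝ)).smul_const v.1).const_add y.1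
  rw [h.fst_eq hy, h.h_eq hy] at hS
  have e4 := HasFDerivAt.comp_hasDerivAt (l := fun p : E × E => D.S θ₀ y.2.2 p.1 p.2)
    (f := fun s : ℝ => (y.1 + s • v.1, D.endPt (S (y + s • v)))) (0 : ℝ)
    (by simpa only [zero_smul, add_zero] using hS) e3
  -- As `v` has no $h$-component, $\hbar$ is frozen along the line, and the chain rule involves only
  -- the two base points.
  have e5 : (fun s : ℝ => D.S θ₀ (y + s • v).2.2 (y + s • v).1 (D.endPt (S (y + s • v)))) =
      (fun p : E × E => D.S θ₀ y.2.2 p.1 p.2) ∘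
        fun s : ℝ => (y.1 + s • v.1, D.endPt (S (y + s • v))) := by
    ext s
    simp [hv]
  rw [e5] at e2
  rw [e2.unique e4]
  have f1 := g_startB (cot θ₀) (fst_mem_of_mem_dom hd)
  have f2 := g_endB (cot θ₀) (endPt_mem hd)
  rw [h.startB_eq hy, h.fst_eq hy, h.h_eq hy] at f1
  rw [h.h_eq hy] at f2
  simp only [actionForm, mapOf, f1, f2, add_apply, neg_apply, ContinuousLinearMap.comp_apply,
    ContinuousLinearMap.coe_fst', ContinuousLinearMap.coe_snd']
  ring

end IsReducedInverse

/-- The $\vartheta$ terms cancel by uniqueness of derivatives. Division by $h$ is deferred, so the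
equivalence includes $h=0$. -/
theorem lorentzRelation_iff (hx : x ∈ D.dom) (v v' : E) :
    D.LorentzRelation θ₀ x.2.2 (x.1, v) (D.endPt x, v') ↔
      x.2.2 • D.startForce (cot θ₀) x = x.2.2 ^ 2 • D.g x.1 v ∧
        x.2.2 • D.endForce (cot θ₀) x = x.2.2 ^ 2 • D.g (D.endPt x) v' := by
  have hS := hasFDerivAt_S (θ₀ := θ₀) hx
  have h1 : HasFDerivAt (fun p => D.S θ₀ x.2.2 x.1 p)
      (D.ϑ (D.endPt x) + x.2.2 • D.endForce (cot θ₀) x) (D.endPt x) := by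
    refine (HasFDerivAt.comp (g := fun p : E × E => D.S θ₀ x.2.2 p.1 p.2)
      (f := fun p => (x.1, p)) (D.endPt x) hS (hasFDerivAt_prodMk_right x.1 _)).congr_fderiv ?_
    ext u
    simp
  have h2 : HasFDerivAt (fun p => D.S θ₀ x.2.2 p (D.endPt x))
      (-(D.ϑ x.1 + x.2.2 • D.startForce (cot θ₀) x)) x.1 := by
    refine (HasFDerivAt.comp (g := fun p : E × E => D.S θ₀ x.2.2 p.1 p.2)
      (f := fun p => (p, D.endPt x)) x.1 hS (hasFDerivAt_prodMk_left x.1 _)).congr_fderiv ?_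
    ext u
    simp
  have hseg : segment ℝ x.1 (D.endPt x) ⊆ D.Q := by
    rw [segment_eq_image']
    rintro _ ⟨t, ht, rfl⟩
    have := hx t ht
    simpa [endPt] using this
  constructor
  · rintro ⟨-, h3, h4⟩
    exact ⟨add_left_cancel (neg_injective (h2.unique h4)), add_left_cancel (h1.unique h3)⟩
  · rintro ⟨h3, h4⟩
    rw [h3] at h2
    rw [h4] at h1
    exact ⟨hseg, h1, h2⟩

variable (D) in
/-- The rescaled coordinates `(q, (h (v - X_H), h))` of `(h, (q, v))`. -/
noncomputable def rescale (p : ℝ × (E × E)) : E × (E × ℝ) :=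
  (p.2.1, (p.1 • (p.2.2 - D.XH p.2.1), p.1))

theorem contDiffAt_rescale {p : ℝ × (E × E)} (hp : p.2.1 ∈ D.Q) :
    ContDiffAt ℝ ∞ D.rescale p := by
  have h1 : ContDiffAt ℝ ∞ (fun p : ℝ × (E × E) => p.2.1) p :=
    contDiffAt_fst.comp p contDiffAt_snd
  have h2 : ContDiffAt ℝ ∞ (fun p : ℝ × (E × E) => D.XH p.2.1) p :=
    ContDiffAt.comp p (D.contDiffOn_XH.contDiffAt (D.isOpen_Q.mem_nhds hp)) h1
  exact h1.prodMk ((contDiffAt_fst.smul ((contDiffAt_snd.comp p contDiffAt_snd).sub h2)).prodMk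
    contDiffAt_fst)

theorem rescale_zero (z : E × E) : D.rescale (0, z) = (z.1, 0) := by
  simp [rescale]

theorem isOpen_fst_snd_mem : IsOpen {p : ℝ × (E × E) | p.2.1 ∈ D.Q} :=
  D.isOpen_Q.preimage (continuous_fst.comp continuous_snd)

variable (D) in
-- The reduced inverse gives the new base point. The new velocity is $X_H$ plus `endB` divided by
-- $\hbar$, and this quotient extends smoothly across $\hbar=0$ because `endB` vanishes there.
theorem exists_isSymplecticLorentzMap (θ₀ : ℝ) : ∃ Ψ, D.IsSymplecticLorentzMap θ₀ Ψ := by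
  have : CompleteSpace E := FiniteDimensional.complete ℝ E
  obtain ⟨N, S, h⟩ := D.exists_isReducedInverse (cot θ₀)
  set U₀ : Set (ℝ × (E × E)) := {p | p.2.1 ∈ D.Q} ∩ D.rescale ⁻¹' N with hU₀
  have hU₀o : IsOpen U₀ := by
    refine ContinuousOn.isOpen_inter_preimage (fun p hp => ?_) isOpen_fst_snd_mem h.isOpen
    exact (contDiffAt_rescale hp).continuousAt.continuousWithinAt
  -- Shrinking to the part star-shaped in $\hbar$ makes the division by $\hbar$ available on the
  -- whole domain.
  set U : Set (ℝ × (E × E)) := {p | ∀ s ∈ Icc (0 : ℝ) 1, (s * p.1, p.2) ∈ U₀} with hU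
  have hUo : IsOpen U := isOpen_setOf_forall_smul_fst_mem hU₀o
  have hstar : ∀ p ∈ U, ∀ s ∈ Icc (0 : ℝ) 1, (s * p.1, p.2) ∈ U := by
    intro p hp s hs t ht
    have := hp (t * s) ⟨mul_nonneg ht.1 hs.1, mul_le_one₀ ht.2 hs.1 hs.2⟩
    rwa [mul_assoc] at this
  have hUU₀ : ∀ p ∈ U, p ∈ U₀ := fun p hp => by
    simpa using hp 1 ⟨zero_le_one, le_rfl⟩
  have hφ : ∀ p ∈ U, ContDiffAt ℝ ∞ (fun p => D.endB (cot θ₀) (S (D.rescale p))) p := fun p hp =>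
    ContDiffAt.comp (g := fun y => D.endB (cot θ₀) (S y)) p (h.contDiffAt_endB (hUU₀ p hp).2)
      (contDiffAt_rescale (hUU₀ p hp).1)
  obtain ⟨ψ, hψ⟩ := exists_contDiffAt_eq_fst_smul hstar hφ fun p hp => by
    rw [rescale_zero, h.zero _ (hUU₀ p hp).1, IsReducedInverse.endB_zero (hUU₀ p hp).1]
  have hend : ∀ p ∈ U, ContDiffAt ℝ ∞ (fun p => D.endPt (S (D.rescale p))) p := fun p hp =>
    ContDiffAt.comp (g := fun y => D.endPt (S y)) p (h.contDiffAt_endPt (hUU₀ p hp).2)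
      (contDiffAt_rescale (hUU₀ p hp).1)
  refine ⟨fun ħ z => (D.endPt (S (D.rescale (ħ, z))),
    D.XH (D.endPt (S (D.rescale (ħ, z)))) + ψ (ħ, z)), U, hUo,
    fun p hp => ⟨(hUU₀ p hp).1, mem_univ _⟩, fun z hz s _ => ?_, fun p hp => ?_, fun p hp => ?_,
    fun z hz => ?_⟩
  · refine ⟨hz.1, ?_⟩
    change D.rescale (s * 0, z) ∈ N
    rw [mul_zero, rescale_zero]
    exact h.mem _ hz.1
  · refine ContDiffAt.contDiffWithinAt ((hend p hp).prodMk (ContDiffAt.add ?_ (hψ p hp).1))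
    exact ContDiffAt.comp p (D.contDiffOn_XH.contDiffAt (D.isOpen_Q.mem_nhds
      (endPt_mem (h.mem_dom _ (hUU₀ p hp).2)))) (hend p hp)
  · have hy := (hUU₀ p hp).2
    have hd := h.mem_dom _ hy
    have f1 := g_startB (cot θ₀) (fst_mem_of_mem_dom hd)
    have f2 := g_endB (cot θ₀) (endPt_mem hd)
    have hrel := lorentzRelation_iff (θ₀ := θ₀) hd p.2.2
      (D.XH (D.endPt (S (D.rescale p))) + ψ p)
    rw [h.startB_eq hy, h.fst_eq hy, h.h_eq hy] at f1
    rw [(hψ p hp).2, h.h_eq hy] at f2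
    rw [h.fst_eq hy, h.h_eq hy, ← f1, ← f2] at hrel
    refine hrel.2 ⟨?_, ?_⟩
    · simp only [rescale, map_add, map_sub, map_smul]
      module
    · simp only [rescale, map_add, map_smul]
      module
  · simp only [rescale_zero, h.zero _ hz.1]
    simp [endPt]

end ExactHamiltonianSystem

/-! ### Adiabatic invariance of `μ₄` -/

namespace ExactHamiltonianSystem

set_option maxSynthPendingDepth 3

variable {E : Type*} [NormedAddCommGroup E] [NormedSpace ℝ E] [FiniteDimensional ℝ E]
  {D : ExactHamiltonianSystem E} {θ₀ : ℝ} {N : Set (E × (E × ℝ))}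
  {S : E × (E × ℝ) → E × (E × ℝ)}

/-- The segment joining the base points of `(q, v)` and `Ψ(q, v)`. -/
noncomputable def segmentOf (D : ExactHamiltonianSystem E) (Ψ : ℝ → E × E → E × E)
    (p : ℝ × (E × E)) : E × (E × ℝ) :=
  (p.2.1, (p.1⁻¹ • ((Ψ p.1 p.2).1 - p.2.1) - D.XH p.2.1, p.1))

theorem endPt_segmentOf {Ψ : ℝ → E × E → E × E} {p : ℝ × (E × E)} (hp : p.1 ≠ 0) :
    D.endPt (segmentOf D Ψ p) = (Ψ p.1 p.2).1 := by
  simp [endPt, vel, segmentOf, smul_smul, hp]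

theorem segmentOf_mem_dom {Ψ : ℝ → E × E → E × E} {p : ℝ × (E × E)} (hp : p.1 ≠ 0)
    (h : segment ℝ p.2.1 (Ψ p.1 p.2).1 ⊆ D.Q) : segmentOf D Ψ p ∈ D.dom := by
  intro t ht
  refine h ?_
  rw [segment_eq_image']
  refine ⟨t, ht, ?_⟩
  simp [vel, segmentOf, smul_smul, hp]

theorem startB_segmentOf {Ψ : ℝ → E × E → E × E} {p : ℝ × (E × E)} (hp : p.1 ≠ 0)
    (h : D.LorentzRelation θ₀ p.1 p.2 (Ψ p.1 p.2)) :
    D.startB (cot θ₀) (segmentOf D Ψ p) = p.1 • (p.2.2 - D.XH p.2.1) ∧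
      D.endB (cot θ₀) (segmentOf D Ψ p) = p.1 • ((Ψ p.1 p.2).2 - D.XH (Ψ p.1 p.2).1) := by
  have hd := segmentOf_mem_dom (D := D) hp h.1
  have he := endPt_segmentOf (D := D) (Ψ := Ψ) hp
  have h1 := (lorentzRelation_iff (θ₀ := θ₀) hd p.2.2 (Ψ p.1 p.2).2).1 (by rw [he]; exact h)
  have hh : (segmentOf D Ψ p).2.2 = p.1 := rfl
  have hq : (segmentOf D Ψ p).1 = p.2.1 := rfl
  rw [hh, hq, he, pow_two, mul_smul, mul_smul] at h1
  have h2 := smul_right_injective _ hp h1.1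
  have h3 := smul_right_injective _ hp h1.2
  have hQ1 := fst_mem_of_mem_dom hd
  have hQ2 := endPt_mem hd
  rw [hq] at hQ1
  rw [he] at hQ2
  constructor
  · rw [startB, h2, hq, hh, map_smul, D.sharp_g hQ1, smul_sub]
  · rw [endB, h3, he, hh, map_smul, D.sharp_g hQ2, smul_sub]

/-- Near `h = 0`, every symplectic Lorentz map is the reduced map in rescaled coordinates. -/
theorem IsReducedInverse.eventually_mapOf_rescale (h : IsReducedInverse D (cot θ₀) N S)
    {Ψ : ℝ → E × E → E × E} (hΨ : D.IsSymplecticLorentzMap θ₀ Ψ) {z₀ : E × E} (hz₀ : z₀ ∈ D.TQ) :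
    ∀ᶠ p in 𝓝[{p : ℝ × (E × E) | p.1 ≠ 0}] (0, z₀),
      mapOf (fun y => D.endPt (S y)) (fun y => D.endB (cot θ₀) (S y)) (D.rescale p) =
        D.rescale (p.1, Ψ p.1 p.2) := by
  obtain ⟨U, hUo, hUQ, hU0, hΨs, hrel, hΨ0⟩ := hΨ
  set F := 𝓝[{p : ℝ × (E × E) | p.1 ≠ 0}] ((0 : ℝ), z₀) with hF
  -- Nontriviality of the filter is needed for the uniqueness of limits below.
  rcases F.eq_or_neBot with hbot | hne
  · rw [hbot]
    exact eventually_bot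
  have hFle : F ≤ 𝓝 (0, z₀) := nhdsWithin_le_nhds
  have hne0 : ∀ᶠ p in F, p.1 ≠ 0 := eventually_mem_nhdsWithin
  have hU : ∀ᶠ p in F, p ∈ U := hFle (hUo.mem_nhds (hU0 z₀ hz₀))
  have hQ : ∀ᶠ p in F, p.2.1 ∈ D.Q := hFle (isOpen_fst_snd_mem.mem_nhds hz₀.1)
  -- the initial velocity converges
  have hs : ContDiffAt ℝ ∞ (fun p : ℝ × (E × E) => (Ψ p.1 p.2).1) (0, z₀) :=
    contDiffAt_fst.comp (0, z₀) (hΨs.contDiffAt (hUo.mem_nhds (hU0 z₀ hz₀)))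
  set L := fderiv ℝ (fun p : ℝ × (E × E) => (Ψ p.1 p.2).1) (0, z₀) with hL
  -- Strict differentiability compares `p` with `(0, p.2)`, so the difference quotient in $\hbar$
  -- converges while `z` also varies.
  have hstrict : HasStrictFDerivAt (fun p : ℝ × (E × E) => (Ψ p.1 p.2).1) L (0, z₀) :=
    hs.hasStrictFDerivAt (by simp)
  have hlim : Tendsto (fun p : ℝ × (E × E) => p.1⁻¹ • ((Ψ p.1 p.2).1 - p.2.1)) F
      (𝓝 (L (1, 0))) := by
    have hpair : Tendsto (fun p : ℝ × (E × E) => (p, ((0 : ℝ), p.2))) F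
        (𝓝 ((0, z₀), (0, z₀))) := by
      have : Continuous fun p : ℝ × (E × E) => (p, ((0 : ℝ), p.2)) := by fun_prop
      exact (this.tendsto (0, z₀)).mono_left hFle
    have h1 := hstrict.isLittleO.comp_tendsto hpair
    have h2 : (fun p : ℝ × (E × E) => (Ψ p.1 p.2).1 - p.2.1 - p.1 • L (1, 0)) =o[F]
        fun p => p.1 := by
      refine (h1.congr' ?_ EventuallyEq.rfl).trans_isBigO ?_
      · filter_upwards [hQ] with p hp
        have e1 : p - (0, p.2) = p.1 • ((1 : ℝ), (0 : E × E)) := by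
          ext <;> simp
        simp only [Function.comp, e1, map_smul, hΨ0 p.2 ⟨hp, mem_univ _⟩]
      · refine IsBigO.of_bound 1 (Eventually.of_forall fun p => ?_)
        have e1 : p - (0, p.2) = p.1 • ((1 : ℝ), (0 : E × E)) := by
          ext <;> simp
        simp [Function.comp, e1, Prod.norm_def]
    have h3 := (h2.tendsto_inv_smul_nhds_zero).add_const (L (1, 0))
    rw [zero_add] at h3
    refine h3.congr' ?_
    filter_upwards [hne0] with p hp
    rw [smul_sub _ _ (p.1 • L (1, 0)), smul_smul, inv_mul_cancel₀ hp, one_smul, sub_add_cancel]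
  have hX : Tendsto (fun p : ℝ × (E × E) => D.XH p.2.1) F (𝓝 (D.XH z₀.1)) := by
    have h1 : ContinuousAt (fun p : ℝ × (E × E) => D.XH p.2.1) (0, z₀) :=
      ContinuousAt.comp (g := D.XH) (f := fun p : ℝ × (E × E) => p.2.1)
        (D.contDiffOn_XH.contDiffAt (D.isOpen_Q.mem_nhds hz₀.1)).continuousAt (by fun_prop)
    exact h1.tendsto.mono_left hFle
  have hfst : Tendsto (fun p : ℝ × (E × E) => p.1) F (𝓝 0) :=
    (continuous_fst.tendsto ((0 : ℝ), z₀)).mono_left hFle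
  have hsnd : Tendsto (fun p : ℝ × (E × E) => p.2.1) F (𝓝 z₀.1) :=
    ((continuous_fst.comp continuous_snd).tendsto ((0 : ℝ), z₀)).mono_left hFle
  have hseg : Tendsto (segmentOf D Ψ) F (𝓝 (z₀.1, (L (1, 0) - D.XH z₀.1, 0))) :=
    hsnd.prodMk_nhds ((hlim.sub hX).prodMk_nhds hfst)
  have hdom : ((z₀.1, (L (1, 0) - D.XH z₀.1, 0)) : E × (E × ℝ)) ∈ D.dom :=
    mem_dom_of_h_eq_zero hz₀.1 rfl
  -- and its limit is the Hamiltonian vector field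
  have hvel : L (1, 0) - D.XH z₀.1 = 0 := by
    refine tilt_injective (D := D) (cot θ₀) hz₀.1 ?_
    have h1 := (contDiffAt_startB (cot θ₀) hdom).continuousAt.tendsto.comp hseg
    rw [startB_of_h_eq_zero (cot θ₀) hz₀.1 rfl] at h1
    have h2 : Tendsto (fun p => (D.rescale p).2.1) F (𝓝 0) := by
      have h3 : ContinuousAt (fun p => (D.rescale p).2.1) (0, z₀) :=
        continuousAt_fst.comp (continuousAt_snd.comp (contDiffAt_rescale hz₀.1).continuousAt)
      have h4 := h3.tendsto.mono_left hFle
      rwa [rescale_zero] at h4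
    refine tendsto_nhds_unique (h1.congr' ?_) h2
    filter_upwards [hne0, hU] with p hp hpU
    exact (startB_segmentOf hp (hrel p hpU)).1
  rw [hvel] at hseg
  have hinv : ∀ᶠ p in F, S (D.initialState (cot θ₀) (segmentOf D Ψ p)) = segmentOf D Ψ p :=
    hseg.eventually (h.left_inv z₀.1 hz₀.1)
  filter_upwards [hinv, hne0, hU] with p hp hp0 hpU
  obtain ⟨h1, h2⟩ := startB_segmentOf hp0 (hrel p hpU)
  have h3 : D.initialState (cot θ₀) (segmentOf D Ψ p) = D.rescale p := by
    simp only [initialState, h1]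
    rfl
  rw [h3] at hp
  simp only [mapOf, hp, h2, endPt_segmentOf hp0]
  rfl

theorem half_mul_g_rescale (p : ℝ × (E × E)) :
    (1 / 2) * (D.rescale p).2.2 ^ 2 * D.g (D.rescale p).1 (D.rescale p).2.1 (D.rescale p).2.1 =
      p.1 ^ 4 * D.mu4 p.2 := by
  simp only [rescale, mu4, map_smul, smul_apply, smul_eq_mul]
  ring

/-- Near a fixed state both fibre components $\hbar(v-X_H)$ and $\hbar$ are $O(|\hbar|)$, which
turns order `n` into $|\hbar|^n$. -/
theorem exists_bound_comp_rescale {n : ℕ} {f : E × (E × ℝ) → ℝ} (hf : Van D.Q n f) {z₀ : E × E}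
    (hz₀ : z₀ ∈ D.TQ) : ∃ K : ℝ, ∀ᶠ p in 𝓝 (0, z₀), |f (D.rescale p)| ≤ K * |p.1| ^ n := by
  obtain ⟨C, hC⟩ := hf.exists_bound hz₀.1
  have hcont := (contDiffAt_rescale (D := D) (p := (0, z₀)) hz₀.1).continuousAt
  have h1 : ∀ᶠ p in 𝓝 ((0 : ℝ), z₀), ‖f (D.rescale p)‖ ≤ C * ‖(D.rescale p).2‖ ^ n := by
    have := hcont.tendsto
    rw [rescale_zero] at this
    exact this.eventually hC
  have h2 : ∀ᶠ p in 𝓝 ((0 : ℝ), z₀), ‖p.2.2 - D.XH p.2.1‖ < ‖z₀.2 - D.XH z₀.1‖ + 1 := by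
    have h3 : ContinuousAt (fun p : ℝ × (E × E) => D.XH p.2.1) (0, z₀) :=
      ContinuousAt.comp (g := D.XH) (f := fun p : ℝ × (E × E) => p.2.1)
        (D.contDiffOn_XH.contDiffAt (D.isOpen_Q.mem_nhds hz₀.1)).continuousAt (by fun_prop)
    have h4 : ContinuousAt (fun p : ℝ × (E × E) => ‖p.2.2 - D.XH p.2.1‖) (0, z₀) :=
      (ContinuousAt.sub (by fun_prop) h3).norm
    exact h4.eventually_lt_const (lt_add_one _)
  refine ⟨|C| * (‖z₀.2 - D.XH z₀.1‖ + 1) ^ n, ?_⟩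
  filter_upwards [h1, h2] with p hp1 hp2
  have hnorm : ‖(D.rescale p).2‖ ≤ (‖z₀.2 - D.XH z₀.1‖ + 1) * |p.1| := by
    rw [rescale, Prod.norm_def]
    refine max_le ?_ ?_
    · rw [norm_smul, Real.norm_eq_abs, mul_comm]
      exact mul_le_mul_of_nonneg_right hp2.le (abs_nonneg _)
    · rw [Real.norm_eq_abs]
      exact le_mul_of_one_le_left (abs_nonneg _) (by linarith [norm_nonneg (z₀.2 - D.XH z₀.1)])
  calc |f (D.rescale p)| ≤ C * ‖(D.rescale p).2‖ ^ n := hp1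
    _ ≤ |C| * ((‖z₀.2 - D.XH z₀.1‖ + 1) * |p.1|) ^ n :=
      mul_le_mul (le_abs_self C) (pow_le_pow_left₀ (norm_nonneg _) hnorm n) (by positivity)
        (abs_nonneg C)
    _ = _ := by rw [mul_pow, mul_assoc]

/-- A statement that holds locally uniformly near `{0} × C` for small nonzero `h`, up to a
constant, holds uniformly on `C`. -/
theorem exists_uniform_bound {Z : Type*} [TopologicalSpace Z] {C : Set Z} (hC : IsCompact C)
    {a : ℝ × Z → ℝ} {b : ℝ → ℝ} (hb : ∀ h, 0 ≤ b h)
    (hloc : ∀ z ∈ C, ∃ K : ℝ, ∀ᶠ p in 𝓝[{p : ℝ × Z | p.1 ≠ 0}] (0, z), a p ≤ K * b p.1) :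
    ∃ h₀ > 0, ∃ K : ℝ, ∀ h, 0 < h → h < h₀ → ∀ z ∈ C, a (h, z) ≤ K * b h := by
  refine hC.induction_on (p := fun s => ∃ h₀ > 0, ∃ K : ℝ, ∀ h, 0 < h → h < h₀ → ∀ z ∈ s,
    a (h, z) ≤ K * b h) ⟨1, one_pos, 0, fun _ _ _ _ hz => hz.elim⟩ ?_ ?_ ?_
  · rintro s t hst ⟨h₀, hh₀, K, hK⟩
    exact ⟨h₀, hh₀, K, fun h h1 h2 z hz => hK h h1 h2 z (hst hz)⟩
  · rintro s t ⟨h₀, hh₀, K, hK⟩ ⟨h₁, hh₁, K', hK'⟩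
    refine ⟨min h₀ h₁, lt_min hh₀ hh₁, max K K', fun h hpos hlt z hz => ?_⟩
    rcases hz with hz | hz
    · exact (hK h hpos (hlt.trans_le (min_le_left _ _)) z hz).trans
        (mul_le_mul_of_nonneg_right (le_max_left _ _) (hb h))
    · exact (hK' h hpos (hlt.trans_le (min_le_right _ _)) z hz).trans
        (mul_le_mul_of_nonneg_right (le_max_right _ _) (hb h))
  · intro z hz
    obtain ⟨K, hK⟩ := hloc z hz
    rw [eventually_nhdsWithin_iff, nhds_prod_eq] at hK
    obtain ⟨P, hP, R, hR, hPR⟩ := eventually_prod_iff.1 hK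
    obtain ⟨ε, hε, hball⟩ := Metric.eventually_nhds_iff.1 hP
    refine ⟨{w | R w}, mem_nhdsWithin_of_mem_nhds hR, ε, hε, K, fun h hpos hlt w hw => ?_⟩
    refine hPR (hball ?_) hw hpos.ne'
    rwa [Real.dist_eq, sub_zero, abs_of_pos hpos]

theorem continuousOn_mu4 : ContinuousOn D.mu4 D.TQ := by
  have h1 : ContinuousOn (fun z : E × E => z.1) D.TQ := continuousOn_fst
  have h2 : MapsTo (fun z : E × E => z.1) D.TQ D.Q := fun z hz => hz.1
  have h3 : ContinuousOn (fun z : E × E => z.2 - D.XH z.1) D.TQ :=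
    continuousOn_snd.sub (D.contDiffOn_XH.continuousOn.comp h1 h2)
  exact continuousOn_const.mul (((D.contDiffOn_g.continuousOn.comp h1 h2).clm_apply h3).clm_apply
    h3)

theorem one_sub_cos_ne_zero (hθ₀ : Irrational (θ₀ / (2 * Real.pi))) : 1 - Real.cos θ₀ ≠ 0 := by
  intro h
  obtain ⟨k, hk⟩ := (Real.cos_eq_one_iff θ₀).1 (by linarith)
  refine hθ₀ ⟨k, ?_⟩
  rw [← hk, mul_div_assoc, div_self (by positivity), mul_one]
  simp

/-- The adiabatic invariant to order `n` of a symplectic Lorentz map, with uniform estimates on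
compact sets. -/
theorem exists_almost_invariant (hθ₀ : Irrational (θ₀ / (2 * Real.pi)))
    {Ψ : ℝ → E × E → E × E} (hΨ : D.IsSymplecticLorentzMap θ₀ Ψ) {C : Set (E × E)}
    (hC : IsCompact C) (hCQ : C ⊆ D.TQ) (n : ℕ) :
    ∃ (I : ℝ × (E × E) → ℝ), ∃ h₀ > 0, ∃ K ≥ 0, ∀ h, 0 < h → h < h₀ → ∀ z ∈ C,
      |I (h, Ψ h z) - I (h, z)| ≤ K * h ^ n ∧ |I (h, z) - h ^ 4 * D.mu4 z| ≤ K * h ^ 5 := by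
  have hθ := one_sub_cos_ne_zero hθ₀
  have hα : Irrational (-θ₀ / (2 * Real.pi)) := by
    rw [neg_div]
    exact hθ₀.neg
  obtain ⟨N, S, h⟩ := D.exists_isReducedInverse (cot θ₀)
  -- The rotation angle of the reduced map is $-\theta_0$, and its second-order drift is half the
  -- acceleration of the Hamiltonian flow.
  obtain ⟨I, hI1, hI2⟩ := exists_adiabatic_invariant D.isOpen_Q D.smooth_J D.J_sq hα D.smooth_ϑ
    D.contDiffOn_g D.contDiffOn_XH (fun q _ u => D.fderiv_ϑ_sub q u) (fun q hq => D.g_J_J hq)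
    (D.contDiffOn_accel.const_smul (1 / 2 : ℝ)) h.fixZ_mapOf (h.van_endPt hθ) (h.van_endB hθ)
    (σ := fun y => D.S θ₀ y.2.2 y.1 (D.endPt (S y)))
    (fun q hq => h.contDiffAt_S (h.mem q hq))
    (fun q hq => (h.eventually_mem hq).mono fun y hy => h.actionForm_sub hy) n
  have h1 := exists_uniform_bound hC
    (a := fun p => |I (D.rescale (p.1, Ψ p.1 p.2)) - I (D.rescale p)|) (b := fun h => |h| ^ n)
    (fun h => by positivity) fun z hz => by
      obtain ⟨K, hK⟩ := exists_bound_comp_rescale hI1 (hCQ hz)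
      refine ⟨K, ?_⟩
      filter_upwards [h.eventually_mapOf_rescale hΨ (hCQ hz), nhdsWithin_le_nhds hK] with p hp hp'
      rwa [hp] at hp'
  have h2 := exists_uniform_bound hC
    (a := fun p => |I (D.rescale p) - p.1 ^ 4 * D.mu4 p.2|) (b := fun h => |h| ^ 5)
    (fun h => by positivity) fun z hz => by
      obtain ⟨K, hK⟩ := exists_bound_comp_rescale hI2 (hCQ hz)
      refine ⟨K, ?_⟩
      filter_upwards [nhdsWithin_le_nhds hK] with p hp
      rwa [half_mul_g_rescale] at hp
  obtain ⟨h₁, hh₁, K₁, hK₁⟩ := h1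
  obtain ⟨h₂, hh₂, K₂, hK₂⟩ := h2
  refine ⟨fun p => I (D.rescale p), min h₁ h₂, lt_min hh₁ hh₂, max 0 (max K₁ K₂),
    le_max_left _ _, fun h hpos hlt z hz => ⟨?_, ?_⟩⟩
  · have := hK₁ h hpos (hlt.trans_le (min_le_left _ _)) z hz
    rw [abs_of_pos hpos] at this
    exact this.trans (mul_le_mul_of_nonneg_right ((le_max_left _ _).trans (le_max_right _ _))
      (by positivity))
  · have := hK₂ h hpos (hlt.trans_le (min_le_right _ _)) z hz
    rw [abs_of_pos hpos] at this
    exact this.trans (mul_le_mul_of_nonneg_right ((le_max_right _ _).trans (le_max_right _ _))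
      (by positivity))

end ExactHamiltonianSystem

/-! ### Accumulated drift and the final estimate. -/

theorem abs_sub_le_of_abs_succ_sub_le {u : ℕ → ℝ} {ε : ℝ} (h : ∀ k, |u (k + 1) - u k| ≤ ε)
    (k : ℕ) : |u k - u 0| ≤ k * ε := by
  induction k with
  | zero => simp
  | succ k ih =>
    have h1 : u (k + 1) - u 0 = (u (k + 1) - u k) + (u k - u 0) := by ring
    rw [h1]
    refine (abs_add_le _ _).trans ?_
    push_cast
    linarith [h k]

theorem mainTheorem8 {E : Type*} [NormedAddCommGroup E] [NormedSpace ℝ E] [FiniteDimensional ℝ E]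
    (D : ExactHamiltonianSystem E) (θ₀ : ℝ) (hθ₀ : Irrational (θ₀ / (2 * Real.pi))) :
    (∃ Ψ : ℝ → E × E → E × E, D.IsSymplecticLorentzMap θ₀ Ψ) ∧
    ∀ Ψ : ℝ → E × E → E × E, D.IsSymplecticLorentzMap θ₀ Ψ →
      ∀ N : ℝ, 0 < N → ∀ C : Set (E × E), IsCompact C → C ⊆ D.TQ →
        ∃ M : ℝ, 0 < M ∧ ∀ ħ : ℝ, 0 < ħ → ∀ z : E × E, PositivelyContained (Ψ ħ) C z →
          ∀ k : ℕ, k ≤ ⌊ħ ^ (-N)⌋₊ →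
            |D.mu4 ((Ψ ħ)^[k] z) - D.mu4 z| ≤ M * ħ := by
  refine ⟨D.exists_isSymplecticLorentzMap θ₀, fun Ψ hΨ N hN C hC hCQ => ?_⟩
  obtain ⟨I, h₀, hh₀, K, hK, hI⟩ :=
    -- The exponent $\lceil N\rceil$ pays for the number of iterations; the remaining $5$ matches
    -- the error in $I=\hbar^4\mu_4+O(\hbar^5)$.
    ExactHamiltonianSystem.exists_almost_invariant hθ₀ hΨ hC hCQ (⌈N⌉₊ + 5)
  obtain ⟨B, hB⟩ := hC.exists_bound_of_continuousOn
    (ExactHamiltonianSystem.continuousOn_mu4.mono hCQ)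
  -- Below $1$ one has $\hbar^{\lceil N\rceil}\le\hbar^N$.
  set h₁ := min h₀ 1 with hh₁
  have hh₁pos : 0 < h₁ := lt_min hh₀ one_pos
  -- One `K` bounds the drift of `I` and two compare `I` with $\hbar^4\mu_4$ at the two ends. For
  -- $\hbar\ge h_1$ the trivial bound $2|B|$ is at most $(2|B|/h_1)\hbar$. The added $1$ ensures
  -- positivity.
  refine ⟨max (3 * K) (2 * |B| / h₁) + 1, by positivity, fun ħ hħ z hz k hk => ?_⟩
  have hzk : ∀ j, (Ψ ħ)^[j] z ∈ C := hz
  rcases lt_or_ge ħ h₁ with hlt | hge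
  · have hlt0 : ħ < h₀ := hlt.trans_le (min_le_left _ _)
    have hlt1 : ħ < 1 := hlt.trans_le (min_le_right _ _)
    have hstep : |I (ħ, (Ψ ħ)^[k] z) - I (ħ, (Ψ ħ)^[0] z)| ≤ k * (K * ħ ^ (⌈N⌉₊ + 5)) := by
      refine abs_sub_le_of_abs_succ_sub_le (u := fun j => I (ħ, (Ψ ħ)^[j] z)) (fun j => ?_) k
      simp only [Function.iterate_succ_apply']
      exact (hI ħ hħ hlt0 _ (hzk j)).1
    have hkle : (k : ℝ) * ħ ^ ⌈N⌉₊ ≤ 1 := by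
      have h1 : (k : ℝ) ≤ ħ ^ (-N) :=
        (Nat.cast_le.2 hk).trans (Nat.floor_le (Real.rpow_nonneg hħ.le _))
      have h2 : ħ ^ ⌈N⌉₊ ≤ ħ ^ N := by
        rw [← Real.rpow_natCast]
        exact Real.rpow_le_rpow_of_exponent_ge hħ hlt1.le (Nat.le_ceil N)
      calc (k : ℝ) * ħ ^ ⌈N⌉₊ ≤ ħ ^ (-N) * ħ ^ N :=
            mul_le_mul h1 h2 (by positivity) (Real.rpow_nonneg hħ.le _)
        _ = 1 := by rw [← Real.rpow_add hħ, neg_add_cancel, Real.rpow_zero]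
    have hstep' : |I (ħ, (Ψ ħ)^[k] z) - I (ħ, z)| ≤ K * ħ ^ 5 := by
      refine hstep.trans ?_
      calc (k : ℝ) * (K * ħ ^ (⌈N⌉₊ + 5)) = (k * ħ ^ ⌈N⌉₊) * (K * ħ ^ 5) := by ring
        _ ≤ 1 * (K * ħ ^ 5) := mul_le_mul_of_nonneg_right hkle (by positivity)
        _ = K * ħ ^ 5 := one_mul _
    have ha := (hI ħ hħ hlt0 _ (hzk k)).2
    have hb := (hI ħ hħ hlt0 _ (hzk 0)).2
    have hfin : ħ ^ 4 * |D.mu4 ((Ψ ħ)^[k] z) - D.mu4 z| ≤ ħ ^ 4 * (3 * K * ħ) := by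
      rw [← abs_of_pos (show 0 < ħ ^ 4 by positivity), ← abs_mul,
        abs_of_pos (show 0 < ħ ^ 4 by positivity)]
      simp only [Function.iterate_zero, id_eq] at hb
      rw [abs_le] at ha hb hstep' ⊢
      constructor <;> nlinarith [ha.1, ha.2, hb.1, hb.2, hstep'.1, hstep'.2]
    have h3 := le_of_mul_le_mul_left hfin (by positivity)
    refine h3.trans (mul_le_mul_of_nonneg_right ?_ hħ.le)
    linarith [le_max_left (3 * K) (2 * |B| / h₁)]
  · have ha := (hB _ (hzk k)).trans (le_abs_self B)
    have hb := (hB _ (hzk 0)).trans (le_abs_self B)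
    simp only [Function.iterate_zero, id_eq, Real.norm_eq_abs] at ha hb
    have h1 : 2 * |B| ≤ 2 * |B| / h₁ * ħ := by
      rw [div_mul_eq_mul_div, le_div_iff₀ hh₁pos]
      exact mul_le_mul_of_nonneg_left hge (by positivity)
    calc |D.mu4 ((Ψ ħ)^[k] z) - D.mu4 z| ≤ |D.mu4 ((Ψ ħ)^[k] z)| + |D.mu4 z| := abs_sub _ _
      _ ≤ 2 * |B| := by linarith
      _ ≤ 2 * |B| / h₁ * ħ := h1
      _ ≤ _ := mul_le_mul_of_nonneg_right
        (by linarith [le_max_right (3 * K) (2 * |B| / h₁)]) hħ.le
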